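/- Consider an M/G/1 queue with vacations. Customers arrive according to a Poisson process with rate $\lambda>0$; service times are distributed as $B\ge 0$ with $\mathbb E[B^2]<\infty$, independent of the arrivals and of the past, and $\rho=\lambda\,\mathbb E[B]$. Right after a service completion that leaves $i$ customers behind, the server becomes inactive with probability $\psi(i)$ (and otherwise starts the next service at once). It becomes active again, and starts the next service, after a vacation whose length does not depend on future arrivals; the number of arrivals during a vacation that begins with $i$ customers in the system is distributed as $X_i$, where $\mathbb E[X_i^2]<\infty$ for all $i$ and $\mathbb P(X_0=0)=0$. Write $L(t)$ for the number of customers in the system at time $t$, time $0$ being a service completion that leaves $k\ge 0$ customers behind, and $G_W(r)=\mathbb E[r^W]$. For non-negative integer-valued $W_1,W_2$ write $W_1>_{\rm st}W_2$ if $\mathbb P(W_1\le w)\le\mathbb P(W_2\le w)$ for all $w$, with strict inequality for some $w$. Let $X$ be a random variable with $X>_{\rm st}0$, assume that $X_i$ is distributed as $X$ for all $i\ge 1$, and that either $X_0$ is distributed as $X$ and $\mathbb P(X=0)=0$, or $X_0>_{\rm st}X$ and $\mathbb P(X=0)>0$. Put $h(r)=\mathbb E[e^{-\lambda(1-r)B}]$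 and, for $0\le r<1$, $$Y(r)=\frac{h(r)\,(1-G_X(r))}{h(r)-r},\qquad K(r)=\frac{h(r)\,(G_X(r)-G_{X_0}(r))}{h(r)-r},$$ and $Y(1)=\lim_{r\uparrow1}Y(r)=\frac{\mathbb E[X]}{1-\rho}$, $K(1)=\lim_{r\uparrow1}K(r)=\frac{\mathbb E[X_0]-\mathbb E[X]}{1-\rho}$. **Theorem.** Let $\rho<1$ and $\psi(i)=a^i$ for all $i\ge0$, where $0\le a<1$ and $0^0=1$. Then $L(t)$ has a steady-state distribution: there is a probability distribution on $\{0,1,2,\dots\}$, that of a random variable $L$, such that for every $j$ $$\lim_{T\to\infty}\frac1T\int_0^T\mathbb P(L(t)=j)\,dt=\mathbb P(L=j);$$ in particular $\mathbb P(L=j)=\lim_{t\to\infty}\mathbb P(L(t)=j)$ whenever the latter limit exists. Its generating function is given, for all $r\in[0,1]$, as follows. (i) If $X_0$ is distributed as $X$, then $$G_L(r)=\frac{\prod_{i=0}^{\infty}Y(a^ir)}{\prod_{i=0}^{\infty}Y(a^i)},$$ where the products converge for all $r\in[0,1]$ and the denominator is positive. (ii) If $X_0>_{\rm st}X$, then $$G_L(r)=\frac{\sum_{j=0}^{\infty}K(a^jr)\prod_{i=0}^{j-1}Y(a^ir)}{\sum_{j=0}^{\infty}K(a^j)\prod_{i=0}^{j-1}Y(a^i)},$$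 where empty products are $1$, the series converge for all $r\in[0,1]$, and the denominator is positive. -/

import Mathlib

open MeasureTheory ProbabilityTheory Filter Topology
open scoped NNReal ENNReal

noncomputable section

/-! ### Laws on the non-negative integers -/

/-- The generating function `G_W(r) = E[r ^ W]` of a random variable `W` with law `p`. -/
def genFun (p : PMF ℕ) (r : ℝ) : ℝ := ∑' m : ℕ, (p m).toReal * r ^ m

/-- The mean `E[W]` of a random variable `W` with law `p`. -/
def meanNat (p : PMF ℕ) : ℝ := ∑' m : ℕ, (p m).toReal * (m : ℝ)

/-- `E[W ^ 2] < ∞` for a random variable `W` with law `p`. -/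
def FiniteSecondMoment (p : PMF ℕ) : Prop := ∑' m : ℕ, p m * (m : ℝ≥0∞) ^ 2 < ∞

/-- `P(W ≤ w)` for a random variable `W` with law `p`. -/
def cdfNat (p : PMF ℕ) (w : ℕ) : ℝ≥0∞ := ∑ m ∈ Finset.range (w + 1), p m

/-- A variable with law `p` is stochastically strictly larger than one with law `q`. -/
def StochStrictlyLarger (p q : PMF ℕ) : Prop :=
  (∀ w, cdfNat p w ≤ cdfNat q w) ∧ ∃ w, cdfNat p w < cdfNat q w

/-! ### The parameters of the M/G/1 queue with random vacations -/

/-- The primitives of the model, with its standing assumptions. -/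
structure VacationQueue where
  /-- the rate `λ` of the Poisson arrival process -/
  arrivalRate : ℝ≥0
  arrivalRate_pos : 0 < arrivalRate
  /-- the law of a service time `B` -/
  serviceLaw : Measure ℝ≥0
  isProbabilityMeasure_serviceLaw : IsProbabilityMeasure serviceLaw
  service_secondMoment : ∫⁻ x, (x : ℝ≥0∞) ^ 2 ∂serviceLaw < ∞
  /-- `vacArrivals i` is the law of the number `X_i` of arrivals during a vacation period that
  begins with `i` customers in the system -/
  vacArrivals : ℕ → PMF ℕ
  vacArrivals_zero : vacArrivals 0 0 = 0
  vacArrivals_secondMoment : ∀ i, FiniteSecondMoment (vacArrivals i)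
  /-- `deact i` is the probability that the server becomes inactive right after a service
  completion that leaves `i` customers behind -/
  deact : ℕ → ℝ
  deact_nonneg : ∀ i, 0 ≤ deact i
  deact_le_one : ∀ i, deact i ≤ 1
  deact_zero : deact 0 = 1

namespace VacationQueue

/-- The traffic intensity `ρ = λ E[B]`. -/
def load (Q : VacationQueue) : ℝ := Q.arrivalRate * ∫ x, (x : ℝ) ∂Q.serviceLaw

/-- The Laplace-Stieltjes transform of the service time law. -/
def serviceLST (Q : VacationQueue) (s : ℝ) : ℝ := ∫ x, Real.exp (-s * (x : ℝ)) ∂Q.serviceLaw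

/-- `h(r) = E[exp(-λ (1 - r) B)]`. -/
def serviceArrivalsGF (Q : VacationQueue) (r : ℝ) : ℝ :=
  Q.serviceLST ((Q.arrivalRate : ℝ) * (1 - r))

/-- Equal vacation distributions: `X_i` is distributed as `X` for `i ≥ 1`, `X` is stochastically
strictly larger than `0`, and either `X_0` is distributed as `X` and `P(X = 0) = 0`, or `X_0` is
stochastically strictly larger than `X` and `P(X = 0) > 0`. -/
def EqualVacations (Q : VacationQueue) (X : PMF ℕ) : Prop :=
  (∀ i, 1 ≤ i → Q.vacArrivals i = X) ∧ StochStrictlyLarger X (PMF.pure 0) ∧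
    ((Q.vacArrivals 0 = X ∧ X 0 = 0) ∨ (StochStrictlyLarger (Q.vacArrivals 0) X ∧ 0 < X 0))

/-- The function `Y` on `[0, 1]`, with its limit as `r ↑ 1` as its value at `1`. -/
def Y (Q : VacationQueue) (X : PMF ℕ) (r : ℝ) : ℝ :=
  if r = 1 then meanNat X / (1 - Q.load)
  else Q.serviceArrivalsGF r * (1 - genFun X r) / (Q.serviceArrivalsGF r - r)

/-- The function `K` on `[0, 1]`, with its limit as `r ↑ 1` as its value at `1`. -/
def K (Q : VacationQueue) (X : PMF ℕ) (r : ℝ) : ℝ :=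
  if r = 1 then (meanNat (Q.vacArrivals 0) - meanNat X) / (1 - Q.load)
  else Q.serviceArrivalsGF r * (genFun X r - genFun (Q.vacArrivals 0) r) /
    (Q.serviceArrivalsGF r - r)

end VacationQueue

/-! ### The queue in continuous time -/

variable {Ω : Type*} {mΩ : MeasurableSpace Ω}

/-- `N` is a Poisson process with rate `lam` relative to the filtration `𝓕`. -/
structure IsPoissonProcess (P : Measure Ω) (𝓕 : Filtration ℝ≥0 mΩ) (lam : ℝ≥0)
    (N : ℝ≥0 → Ω → ℕ) : Prop where
  zero : ∀ ω, N 0 ω = 0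
  mono : ∀ ω, Monotone fun t => N t ω
  rightCont : ∀ ω t, ContinuousWithinAt (fun s => N s ω) (Set.Ici t) t
  adapted : ∀ t, Measurable[𝓕 t] (N t)
  increment_law : ∀ s t, s ≤ t →
    HasLaw (fun ω => N t ω - N s ω) (poissonMeasure (lam * (t - s))) P
  increment_indep : ∀ s t, s ≤ t →
    Indep (MeasurableSpace.comap (fun ω => N t ω - N s ω) ⊤) (𝓕 s) P

/-- The number of customers just after the `n`-th service completion: `k` customers at time `0`,
plus the arrivals up to the epoch `S n` of that completion, minus the `n` departures. -/
def numAfterService (k : ℕ) (N : ℝ≥0 → Ω → ℕ) (S : ℕ → Ω → ℝ≥0) (n : ℕ) (ω : Ω) : ℤ :=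
  (k : ℤ) + (N (S n ω) ω : ℤ) - (n : ℤ)

/-- The number of customers in the system at time `t`: initial customers plus arrivals minus
services completed in `[0, t]` (the epoch `S 0 = 0` precedes all services and is not counted). -/
def numInSystem (k : ℕ) (N : ℝ≥0 → Ω → ℕ) (S : ℕ → Ω → ℝ≥0) (t : ℝ≥0) (ω : Ω) : ℤ :=
  (k : ℤ) + (N t ω : ℤ) - (Set.ncard {n : ℕ | 1 ≤ n ∧ S n ω ≤ t} : ℤ)

/-- The history at the `n`-th service completion: the completion epochs `S 0, …, S n` and the
activation epochs `V 0, …, V (n - 1)` so far, with the numbers of arrivals up to these epochs. -/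
@[reducible] def historyAtCompletion (N : ℝ≥0 → Ω → ℕ) (S V : ℕ → Ω → ℝ≥0) (n : ℕ) : MeasurableSpace Ω :=
  (⨆ m : ℕ, ⨆ _ : m ≤ n,
      MeasurableSpace.comap (fun ω => (S m ω, N (S m ω) ω)) inferInstance) ⊔
    (⨆ m : ℕ, ⨆ _ : m < n,
      MeasurableSpace.comap (fun ω => (V m ω, N (V m ω) ω)) inferInstance)

/-- The history at the beginning of the next service, which starts at the epoch `V n`. -/
@[reducible] def historyAtActivation (N : ℝ≥0 → Ω → ℕ) (S V : ℕ → Ω → ℝ≥0) (n : ℕ) : MeasurableSpace Ω :=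
  historyAtCompletion N S V n ⊔
    MeasurableSpace.comap (fun ω => (V n ω, N (V n ω) ω)) inferInstance

/-- The information in the arrivals after the epoch `V n`. -/
@[reducible] def arrivalsAfter (N : ℝ≥0 → Ω → ℕ) (V : ℕ → Ω → ℝ≥0) (n : ℕ) : MeasurableSpace Ω :=
  ⨆ u : ℝ≥0, MeasurableSpace.comap (fun ω => N (V n ω + u) ω - N (V n ω) ω) ⊤

/-- The M/G/1 queue with vacations in continuous time, started at time `0` from a service
completion that leaves `k` customers behind.

* `N` counts the arrivals;
* `S n` is the epoch of the `n`-th service completion (`S 0 = 0`);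
* `W n` is the event that the server becomes inactive at time `S n`;
* `V n` is the epoch at which the server is active again (`V n = S n` without a vacation), and
  the `(n + 1)`-st service takes place in `[V n, S (n + 1)]`.

The epochs are stopping times of a filtration for which `N` is a Poisson process: they do not
depend on future arrivals. -/
structure IsVacationQueueProcess (Q : VacationQueue) (P : Measure Ω) (𝓕 : Filtration ℝ≥0 mΩ)
    (k : ℕ) (N : ℝ≥0 → Ω → ℕ) (S V : ℕ → Ω → ℝ≥0) (W : ℕ → Set Ω) : Prop where
  arrivals : IsPoissonProcess P 𝓕 Q.arrivalRate N
  start : ∀ ω, S 0 ω = 0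
  completion_le_activation : ∀ n ω, S n ω ≤ V n ω
  activation_le_completion : ∀ n ω, V n ω ≤ S (n + 1) ω
  completion_stopping : ∀ n, IsStoppingTime 𝓕 fun ω => (S n ω : WithTop ℝ≥0)
  activation_stopping : ∀ n, IsStoppingTime 𝓕 fun ω => (V n ω : WithTop ℝ≥0)
  measurableSet_vacation : ∀ n, MeasurableSet (W n)
  no_vacation : ∀ n, ∀ ω ∉ W n, V n ω = S n ω
  /-- Given the history, a completion that leaves `i` customers behind is followed with
  probability `ψ(i)` by a vacation, during which the number of arrivals is distributed as `X_i`. -/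
  vacation_law : ∀ (n : ℕ) (A : Set Ω), MeasurableSet[historyAtCompletion N S V n] A →
    ∀ i m : ℕ,
      P (A ∩ {ω | numAfterService k N S n ω = (i : ℤ)} ∩
          (W n ∩ {ω | N (V n ω) ω = N (S n ω) ω + m})) =
        P (A ∩ {ω | numAfterService k N S n ω = (i : ℤ)}) *
          (ENNReal.ofReal (Q.deact i) * Q.vacArrivals i m)
  service_law : ∀ n, HasLaw (fun ω => S (n + 1) ω - V n ω) Q.serviceLaw P
  /-- Service times are independent of the past and of the arrivals. -/
  service_indep : ∀ n,
    Indep (MeasurableSpace.comap (fun ω => S (n + 1) ω - V n ω) inferInstance)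
      (historyAtActivation N S V n ⊔ arrivalsAfter N V n) P

/-- `p` is the steady-state law of the integer-valued process `L`: for every `j`, the long-run
average over time of `P(L(t) = j)` exists and equals `p j`. -/
def IsSteadyStateLaw (P : Measure Ω) (L : ℝ≥0 → Ω → ℤ) (p : PMF ℕ) : Prop :=
  ∀ j : ℕ, Tendsto
    (fun T : ℝ => T⁻¹ * ∫ t in (0 : ℝ)..T, P.real {ω | L t.toNNReal ω = (j : ℤ)})
    atTop (𝓝 (p j).toReal)

end

/-!
The process is studied through its *occupation counts*: `U_T(i)` is the expected number of service
completions up to time `T` that leave `i` customers behind. Three facts about them are used, none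
of which needs an ergodic theorem.

* *Invariance.* Whether the `n`-th completion takes place before `T` is decided at that completion,
  and the arrivals of the cycle that begins there have a law that depends on the past only through
  the number of customers (`IsVacationQueueProcess.measure_transition`, from the strong Markov
  property of the arrivals). Hence `U_T` is invariant for the Markov chain of the numbers of
  customers left behind, up to the first and the last cycle
  (`IsVacationQueueProcess.occupation_balance`).
* *Mass.* The departures up to `T` number at most `k + N(T)`, so `U_T` has total mass at most
  `λ T + O(1)`. On the other hand every arrival up to `T` falls into a cycle that begins before `T`,
  and a cycle that begins with `i` customers has `a ^ i E[X_i] + ρ` arrivals in the mean; so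
  `λ T ≤ ∑ U_T(i) (a ^ i E[X_i] + ρ)` (`IsVacationQueueProcess.arrivals_le_tsum_occupation`).
* *Time averages.* The arrivals that find `j` customers alternate with the departures that leave `j`
  behind, and by independence of increments the former have the expected number
  `λ ∫ P(L(t) = j) dt`; so this differs from `U_T(j)` by a bounded amount
  (`IsVacationQueueProcess.abs_time_sub_occupation_le`).

Let `c` be the limit of `U_T / (λ T)` along an ultrafilter that tends to infinity, with generating
function `G`. Invariance passes to the limit for `r < 1` and becomes
`G(r) = Y(r) G(a r) + K(r) c(0)`; the mass inequality, whose weights `a ^ i` decay, becomes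
`E[X] G(a) + (E[X_0] - E[X]) c(0) ≥ 1 - ρ`. Letting `r ↑ 1` in the functional equation, the latter
says `G(1) ≥ 1`, which is the tightness of the family
(`VacationQueue.IsStationarySequence.seqGenFun_one`). Iterating the functional equation along
`r, a r, a ^ 2 r, …` gives `G` in closed form up to the factor `c(0)`, which is fixed by
`G(1) = 1`; the latter also shows that the denominators are positive. So all limit points
coincide, and `U_T / (λ T)`, hence the time averages, converge.
-/

/-! ### Discretising random times -/

/-- The first point of the grid `{0, d, 2 d, …}` that is at or after `x`. -/
noncomputable def gridCeil (d x : ℝ≥0) : ℝ≥0 := ⌈x / d⌉₊ * d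

theorem le_gridCeil {d : ℝ≥0} (hd : 0 < d) (x : ℝ≥0) : x ≤ gridCeil d x := by
  have h := Nat.le_ceil (x / d)
  rwa [div_le_iff₀ hd] at h

theorem gridCeil_le_add {d : ℝ≥0} (hd : 0 < d) (x : ℝ≥0) : gridCeil d x ≤ x + d := by
  have h := (Nat.ceil_lt_add_one (a := x / d) zero_le).le
  calc gridCeil d x ≤ (x / d + 1) * d := by unfold gridCeil; gcongr
    _ = x + d := by field_simp

theorem tendsto_gridCeil (x : ℝ≥0) :
    Tendsto (fun d => gridCeil d x) (𝓝[>] 0) (𝓝[≥] x) := by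
  refine tendsto_nhdsWithin_iff.2 ⟨?_, ?_⟩
  · refine tendsto_of_tendsto_of_tendsto_of_le_of_le' (g := fun _ => x) (h := fun d => x + d)
      tendsto_const_nhds ?_ ?_ ?_
    · have : Tendsto (fun d : ℝ≥0 => x + d) (𝓝 0) (𝓝 (x + 0)) := by
        exact (continuous_const.add continuous_id).tendsto 0
      rw [add_zero] at this
      exact this.mono_left nhdsWithin_le_nhds
    · filter_upwards [self_mem_nhdsWithin] with d hd using le_gridCeil hd x
    · filter_upwards [self_mem_nhdsWithin] with d hd using gridCeil_le_add hd x
  · filter_upwards [self_mem_nhdsWithin] with d hd using le_gridCeil hd x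

theorem measurable_natCeil_div {Ω : Type*} {m : MeasurableSpace Ω} {τ : Ω → ℝ≥0}
    (hτ : Measurable τ) (d : ℝ≥0) : Measurable fun ω => ⌈τ ω / d⌉₊ :=
  Nat.measurable_ceil.comp (hτ.div_const d)

/-- A right-continuous process with values in `ℕ` is measurable at a measurable random time. -/
theorem measurable_process_at_random_time {Ω : Type*} {m : MeasurableSpace Ω} {Z : ℝ≥0 → Ω → ℕ}
    (hZ : ∀ s, Measurable (Z s)) (hrc : ∀ ω t, ∀ᶠ s in 𝓝[≥] t, Z s ω = Z t ω)
    {τ : Ω → ℝ≥0} (hτ : Measurable τ) : Measurable fun ω => Z (τ ω) ω := by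
  refine measurable_of_tendsto_metrizable' (𝓝[>] (0 : ℝ≥0))
    (f := fun d ω => Z (gridCeil d (τ ω)) ω) (fun d => ?_) ?_
  · have h1 : Measurable (fun q : ℕ × Ω => Z (q.1 * d) q.2) :=
      measurable_from_prod_countable_right fun n => hZ (n * d)
    exact h1.comp ((measurable_natCeil_div hτ d).prodMk measurable_id)
  · refine tendsto_pi_nhds.2 fun ω => ?_
    refine tendsto_const_nhds.congr' ?_
    filter_upwards [(tendsto_gridCeil (τ ω)).eventually (hrc ω (τ ω))] with d hd using hd.symm

/-! ### The strong Markov property of the arrival process -/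

section Poisson

variable {Ω : Type*} {mΩ : MeasurableSpace Ω} {P : Measure Ω} {𝓕 : Filtration ℝ≥0 mΩ} {lam : ℝ≥0}
  {N : ℝ≥0 → Ω → ℕ}

theorem measurable_of_isStoppingTime_coe {τ : Ω → ℝ≥0}
    (hτ : IsStoppingTime 𝓕 fun ω => (τ ω : WithTop ℝ≥0)) : Measurable τ := by
  refine measurable_of_Iic fun t => 𝓕.le t _ ?_
  have := hτ t
  simp only [WithTop.coe_le_coe] at this
  exact this

theorem IsPoissonProcess.eventually_eq (h : IsPoissonProcess P 𝓕 lam N) (ω : Ω) (t : ℝ≥0) :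
    ∀ᶠ s in 𝓝[≥] t, N s ω = N t ω := by
  have := h.rightCont ω t
  unfold ContinuousWithinAt at this
  rw [nhds_discrete] at this
  exact tendsto_pure.1 this

theorem IsPoissonProcess.measurable (h : IsPoissonProcess P 𝓕 lam N) (t : ℝ≥0) :
    Measurable (N t) :=
  (h.adapted t).mono (𝓕.le t) le_rfl

theorem IsPoissonProcess.measurable_at (h : IsPoissonProcess P 𝓕 lam N) {τ : Ω → ℝ≥0}
    (hτ : Measurable τ) : Measurable fun ω => N (τ ω) ω :=
  measurable_process_at_random_time h.measurable h.eventually_eq hτ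

/-- The number of arrivals up to a stopping time `τ` is determined at time `τ`. -/
theorem IsPoissonProcess.measurable_stopped (h : IsPoissonProcess P 𝓕 lam N) {τ : Ω → ℝ≥0}
    (hτ : IsStoppingTime 𝓕 fun ω => (τ ω : WithTop ℝ≥0)) :
    Measurable[hτ.measurableSpace] fun ω => N (τ ω) ω := by
  intro B hB
  suffices hkey : ∀ t, MeasurableSet[𝓕 t] ((fun ω => N (τ ω) ω) ⁻¹' B ∩ {ω | τ ω ≤ t}) by
    refine (hτ.measurableSet _).2 ⟨?_, fun t => by simpa only [WithTop.coe_le_coe] using hkey t⟩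
    have hcover : (fun ω => N (τ ω) ω) ⁻¹' B =
        ⋃ n : ℕ, ((fun ω => N (τ ω) ω) ⁻¹' B ∩ {ω | τ ω ≤ n}) := by
      rw [← Set.inter_iUnion]
      refine (Set.inter_eq_left.2 fun ω _ => ?_).symm
      exact Set.mem_iUnion.2 (exists_nat_ge (τ ω))
    rw [hcover]
    exact @MeasurableSet.iUnion _ _ (⨆ t, 𝓕 t) _ _ fun n =>
      le_iSup (fun t => (𝓕 t : MeasurableSpace Ω)) n _ (hkey n)
  intro t
  have hmin : Measurable[𝓕 t] fun ω => min (τ ω) t := by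
    refine measurable_of_Iic (mδ := 𝓕 t) fun s => ?_
    have hs := 𝓕.mono (min_le_right s t) _ (hτ (min s t))
    simp only [WithTop.coe_le_coe] at hs
    by_cases hst : s < t
    · rw [min_eq_left hst.le] at hs
      convert hs using 1
      ext ω
      simp [hst]
    · convert @MeasurableSet.univ _ (𝓕 t) using 1
      ext ω
      simp [not_lt.1 hst]
  have hZ : Measurable[𝓕 t] fun ω => N (min (min (τ ω) t) t) ω := by
    refine @measurable_process_at_random_time Ω (𝓕 t) (fun s ω => N (min s t) ω) (fun s => ?_)
      (fun ω s => ?_) _ hmin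
    · exact (h.adapted _).mono (𝓕.mono (min_le_right s t)) le_rfl
    · have hc : Tendsto (fun s' => min s' t) (𝓝[≥] s) (𝓝[≥] (min s t)) := by
        refine tendsto_nhdsWithin_iff.2 ⟨?_, ?_⟩
        · exact ((continuous_id.min continuous_const).tendsto s).mono_left nhdsWithin_le_nhds
        · filter_upwards [self_mem_nhdsWithin] with s' hs'
          exact min_le_min_right t hs'
      exact hc.eventually (h.eventually_eq ω (min s t))
  have hle : MeasurableSet[𝓕 t] {ω | τ ω ≤ t} := by
    simpa only [WithTop.coe_le_coe] using hτ t
  convert @MeasurableSet.inter _ (𝓕 t) _ _ (hZ hB) hle using 1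
  ext ω
  simp only [Set.mem_inter_iff, Set.mem_preimage, Set.mem_ofPred_eq]
  refine and_congr_left fun hω => ?_
  rw [min_eq_left hω, min_eq_left hω]

/-- The event that the grid point following a stopping time is `m d` is decided at time `m d`. -/
theorem measurableSet_inter_natCeil {τ : Ω → ℝ≥0}
    (hτ : IsStoppingTime 𝓕 fun ω => (τ ω : WithTop ℝ≥0)) {A : Set Ω}
    (hA : MeasurableSet[hτ.measurableSpace] A) {d : ℝ≥0} (hd : 0 < d) (m : ℕ) :
    MeasurableSet[𝓕 (m * d)] (A ∩ {ω | ⌈τ ω / d⌉₊ = m}) := by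
  have h1 := ((hτ.measurableSet _).1 hA).2 (m * d)
  have h2 : ∀ l : ℕ, l < m → MeasurableSet[𝓕 (m * d)] {ω | τ ω ≤ l * d} := fun l hl => by
    have := hτ (l * d)
    simp only [WithTop.coe_le_coe] at this
    exact 𝓕.mono (by gcongr) _ this
  have h3 : MeasurableSet[𝓕 (m * d)] (⋃ l : ℕ, ⋃ _ : l < m, {ω | τ ω ≤ l * d}) :=
    @MeasurableSet.iUnion _ _ (𝓕 (m * d)) _ _ fun l =>
      @MeasurableSet.iUnion _ _ (𝓕 (m * d)) _ _ fun hl => h2 l hl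
  simp only [WithTop.coe_le_coe] at h1
  convert @MeasurableSet.diff _ (𝓕 (m * d)) _ _ h1 h3 using 1
  ext ω
  simp only [Set.mem_inter_iff, Set.mem_ofPred_eq, Set.mem_sdiff, Set.mem_iUnion, exists_prop,
    not_exists, not_and, and_assoc]
  refine and_congr_right fun _ => ?_
  have key : ∀ l : ℕ, τ ω ≤ l * d ↔ ⌈τ ω / d⌉₊ ≤ l := fun l => by
    rw [Nat.ceil_le, div_le_iff₀ hd]
  simp only [key]
  constructor
  · rintro rfl
    exact ⟨le_rfl, fun l hl => by omega⟩
  · rintro ⟨h4, h5⟩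
    by_contra h6
    exact h5 _ (lt_of_le_of_ne h4 h6) le_rfl

theorem measure_eq_tsum_inter_fiber {A : Set Ω} {f : Ω → ℕ} (hf : Measurable f)
    (hA : MeasurableSet A) : P A = ∑' m, P (A ∩ {ω | f ω = m}) := by
  have hm : ∀ m, MeasurableSet {ω | f ω = m} := fun m => hf (measurableSet_singleton m)
  rw [← measure_iUnion]
  · congr 1
    ext ω
    simp
  · intro i j hij
    refine Set.disjoint_left.2 ?_
    rintro ω ⟨_, h1⟩ ⟨_, h2⟩
    exact hij (h1.symm.trans h2)
  · exact fun m => hA.inter (hm m)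

/-- After a stopping time the arrival process starts afresh. The stopping time is approximated from
the right by stopping times with values in a grid. -/
theorem IsPoissonProcess.strong_markov [IsProbabilityMeasure P] (h : IsPoissonProcess P 𝓕 lam N)
    {τ : Ω → ℝ≥0} (hτ : IsStoppingTime 𝓕 fun ω => (τ ω : WithTop ℝ≥0)) {A : Set Ω}
    (hA : MeasurableSet[hτ.measurableSpace] A) (u : ℝ≥0) (l : ℕ) :
    P (A ∩ {ω | N (τ ω + u) ω - N (τ ω) ω = l}) = P A * poissonMeasure (lam * u) {l} := by
  have hτm := measurable_of_isStoppingTime_coe hτ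
  have hAm : MeasurableSet A := hτ.measurableSpace_le _ hA
  have hinc : ∀ {σ : Ω → ℝ≥0}, Measurable σ →
      MeasurableSet {ω | N (σ ω + u) ω - N (σ ω) ω = l} := fun {σ} hσ =>
    ((h.measurable_at (hσ.add_const u)).sub (h.measurable_at hσ)) (measurableSet_singleton l)
  have hgrid : ∀ d, Measurable fun ω => gridCeil d (τ ω) := fun d =>
    (measurable_from_nat (f := fun n : ℕ => (n : ℝ≥0) * d)).comp (measurable_natCeil_div hτm d)
  have hlim := tendsto_measure_of_ae_tendsto_indicator_of_isFiniteMeasure (𝓝[>] (0 : ℝ≥0))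
    (μ := P) (A := A ∩ {ω | N (τ ω + u) ω - N (τ ω) ω = l})
    (As := fun d => A ∩ {ω | N (gridCeil d (τ ω) + u) ω - N (gridCeil d (τ ω)) ω = l})
    (hAm.inter (hinc hτm)) (fun d => hAm.inter (hinc (hgrid d))) (ae_of_all _ fun ω => by
      have hc : Tendsto (fun d => gridCeil d (τ ω) + u) (𝓝[>] 0) (𝓝[≥] (τ ω + u)) := by
        refine tendsto_nhdsWithin_iff.2 ⟨?_, ?_⟩
        · exact ((tendsto_gridCeil (τ ω)).mono_right nhdsWithin_le_nhds).add_const u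
        · filter_upwards [self_mem_nhdsWithin] with d hd
          exact add_le_add_left (le_gridCeil hd _) _
      filter_upwards [(tendsto_gridCeil (τ ω)).eventually (h.eventually_eq ω (τ ω)),
        hc.eventually (h.eventually_eq ω (τ ω + u))] with d h1 h2
      simp only [Set.mem_inter_iff, Set.mem_ofPred_eq, h1, h2])
  -- It remains to treat the grid times `m d`, where independence of increments applies.
  refine tendsto_nhds_unique hlim (tendsto_const_nhds.congr' ?_)
  filter_upwards [self_mem_nhdsWithin] with d hd
  rw [measure_eq_tsum_inter_fiber (measurable_natCeil_div hτm d) hAm,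
    measure_eq_tsum_inter_fiber (measurable_natCeil_div hτm d) (hAm.inter (hinc (hgrid d))),
    ← ENNReal.tsum_mul_right]
  refine tsum_congr fun m => ?_
  have hset : A ∩ {ω | N (gridCeil d (τ ω) + u) ω - N (gridCeil d (τ ω)) ω = l} ∩
      {ω | ⌈τ ω / d⌉₊ = m} =
      {ω | N (m * d + u) ω - N (m * d) ω = l} ∩ (A ∩ {ω | ⌈τ ω / d⌉₊ = m}) := by
    ext ω
    simp only [Set.mem_inter_iff, Set.mem_ofPred_eq, gridCeil]
    constructor
    · rintro ⟨⟨h1, h2⟩, rfl⟩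
      exact ⟨h2, h1, rfl⟩
    · rintro ⟨h2, h1, rfl⟩
      exact ⟨⟨h1, h2⟩, rfl⟩
  have hind : P ({ω | N (m * d + u) ω - N (m * d) ω = l} ∩ (A ∩ {ω | ⌈τ ω / d⌉₊ = m})) = _ :=
    (Indep_iff _ _ _).1 (h.increment_indep (m * d) (m * d + u) le_self_add) _ _
      ⟨{l}, trivial, rfl⟩ (measurableSet_inter_natCeil hτ hA hd m)
  rw [hset, hind, mul_comm]
  congr 1
  have := (h.increment_law (m * d) (m * d + u) le_self_add).measure_eq
    (p := fun x => x = l) (measurableSet_singleton l)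
  rw [add_tsub_cancel_left] at this
  exact this.symm

end Poisson

/-! ### The transition law of the queue between service completions -/

theorem continuous_poissonMeasure_singleton (lam : ℝ≥0) (l : ℕ) :
    Continuous fun x : ℝ≥0 => poissonMeasure (lam * x) {l} := by
  simp only [poissonMeasure_singleton]
  refine ENNReal.continuous_ofReal.comp ?_
  push_cast
  fun_prop

theorem tsum_poissonMeasure_singleton (r : ℝ≥0) : ∑' l : ℕ, poissonMeasure r {l} = 1 := by
  simpa using Measure.tsum_indicator_apply_singleton (poissonMeasure r) Set.univ MeasurableSet.univ

/-- The law of the number of arrivals during a service time. -/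
noncomputable def VacationQueue.serviceArrivals (Q : VacationQueue) : PMF ℕ :=
  ⟨fun l => ∫⁻ x, poissonMeasure (Q.arrivalRate * x) {l} ∂Q.serviceLaw, by
    have := Q.isProbabilityMeasure_serviceLaw
    rw [ENNReal.summable.hasSum_iff, ← lintegral_tsum fun l =>
      (continuous_poissonMeasure_singleton _ l).measurable.aemeasurable]
    simp [tsum_poissonMeasure_singleton]⟩

theorem VacationQueue.serviceArrivals_apply (Q : VacationQueue) (l : ℕ) :
    Q.serviceArrivals l = ∫⁻ x, poissonMeasure (Q.arrivalRate * x) {l} ∂Q.serviceLaw := rfl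

/-- The probability that `m` customers arrive between a service completion that leaves `i`
customers behind and the beginning of the next service. -/
noncomputable def VacationQueue.idleArrivals (Q : VacationQueue) (i m : ℕ) : ℝ≥0∞ :=
  ENNReal.ofReal (Q.deact i) * Q.vacArrivals i m +
    if m = 0 then ENNReal.ofReal (1 - Q.deact i) else 0

theorem VacationQueue.idleArrivals_zero_zero (Q : VacationQueue) : Q.idleArrivals 0 0 = 0 := by
  simp [VacationQueue.idleArrivals, Q.vacArrivals_zero, Q.deact_zero]

section Transition

variable {Ω : Type*} {mΩ : MeasurableSpace Ω} {Q : VacationQueue} {P : Measure Ω}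
  {𝓕 : Filtration ℝ≥0 mΩ} {k : ℕ} {N : ℝ≥0 → Ω → ℕ} {S V : ℕ → Ω → ℝ≥0} {W : ℕ → Set Ω}

namespace IsVacationQueueProcess

theorem measurable_completion (h : IsVacationQueueProcess Q P 𝓕 k N S V W) (n : ℕ) :
    Measurable (S n) := measurable_of_isStoppingTime_coe (h.completion_stopping n)

theorem measurable_activation (h : IsVacationQueueProcess Q P 𝓕 k N S V W) (n : ℕ) :
    Measurable (V n) := measurable_of_isStoppingTime_coe (h.activation_stopping n)

theorem measurable_arrivals_completion (h : IsVacationQueueProcess Q P 𝓕 k N S V W) (n : ℕ) :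
    Measurable fun ω => N (S n ω) ω := h.arrivals.measurable_at (h.measurable_completion n)

theorem measurable_arrivals_activation (h : IsVacationQueueProcess Q P 𝓕 k N S V W) (n : ℕ) :
    Measurable fun ω => N (V n ω) ω := h.arrivals.measurable_at (h.measurable_activation n)

theorem measurable_numAfterService (h : IsVacationQueueProcess Q P 𝓕 k N S V W) (n : ℕ) :
    Measurable (numAfterService k N S n) :=
  (((measurable_from_top (f := fun x : ℕ => (x : ℤ))).comp
    (h.measurable_arrivals_completion n)).const_add (k : ℤ)).sub_const _

theorem arrivals_completion_le (h : IsVacationQueueProcess Q P 𝓕 k N S V W) (n : ℕ) (ω : Ω) :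
    N (S n ω) ω ≤ N (V n ω) ω := h.arrivals.mono ω (h.completion_le_activation n ω)

theorem arrivals_activation_le (h : IsVacationQueueProcess Q P 𝓕 k N S V W) (n : ℕ) (ω : Ω) :
    N (V n ω) ω ≤ N (S (n + 1) ω) ω := h.arrivals.mono ω (h.activation_le_completion n ω)

/-- During a service the arrivals are independent of the past, and their number has the law
`Q.serviceArrivals`. -/
theorem measure_inter_service [IsProbabilityMeasure P]
    (h : IsVacationQueueProcess Q P 𝓕 k N S V W) (n : ℕ)
    {A : Set Ω} (hA : MeasurableSet[historyAtActivation N S V n] A)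
    (hAτ : MeasurableSet[(h.activation_stopping n).measurableSpace] A) (l : ℕ) :
    P (A ∩ {ω | N (S (n + 1) ω) ω = N (V n ω) ω + l}) = P A * Q.serviceArrivals l := by
  have := Q.isProbabilityMeasure_serviceLaw
  have hVm := h.measurable_activation n
  have hSm := h.measurable_completion (n + 1)
  have hAm : MeasurableSet A := (h.activation_stopping n).measurableSpace_le _ hAτ
  set σ : Ω → ℝ≥0 := fun ω => S (n + 1) ω - V n ω with hσ
  have hσm : Measurable σ := hSm.sub hVm
  have hVσ : ∀ ω, V n ω + σ ω = S (n + 1) ω := fun ω =>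
    add_tsub_cancel_of_le (h.activation_le_completion n ω)
  have hinc : ∀ {ρ : Ω → ℝ≥0}, Measurable ρ →
      MeasurableSet {ω | N (V n ω + ρ ω) ω - N (V n ω) ω = l} := fun {ρ} hρ =>
    ((h.arrivals.measurable_at (hVm.add hρ)).sub (h.arrivals.measurable_at hVm))
      (measurableSet_singleton l)
  have hgrid : ∀ d, Measurable fun ω => gridCeil d (σ ω) := fun d =>
    (measurable_from_nat (f := fun n : ℕ => (n : ℝ≥0) * d)).comp (measurable_natCeil_div hσm d)
  have hset0 : A ∩ {ω | N (S (n + 1) ω) ω = N (V n ω) ω + l} =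
      A ∩ {ω | N (V n ω + σ ω) ω - N (V n ω) ω = l} := by
    ext ω
    simp only [Set.mem_inter_iff, Set.mem_ofPred_eq, hVσ]
    have := h.arrivals_activation_le n ω
    refine and_congr_right fun _ => ?_
    omega
  rw [hset0]
  -- The service time is rounded up to a grid; the arrivals during `m d` time units from `V n` on are
  -- covered by the strong Markov property.
  have hlim := tendsto_measure_of_ae_tendsto_indicator_of_isFiniteMeasure (𝓝[>] (0 : ℝ≥0))
    (μ := P) (A := A ∩ {ω | N (V n ω + σ ω) ω - N (V n ω) ω = l})
    (As := fun d => A ∩ {ω | N (V n ω + gridCeil d (σ ω)) ω - N (V n ω) ω = l})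
    (hAm.inter (hinc hσm)) (fun d => hAm.inter (hinc (hgrid d))) (ae_of_all _ fun ω => by
      have hc : Tendsto (fun d => V n ω + gridCeil d (σ ω)) (𝓝[>] 0) (𝓝[≥] (V n ω + σ ω)) := by
        refine tendsto_nhdsWithin_iff.2 ⟨?_, ?_⟩
        · exact ((tendsto_gridCeil (σ ω)).mono_right nhdsWithin_le_nhds).const_add (V n ω)
        · filter_upwards [self_mem_nhdsWithin] with d hd
          exact add_le_add_right (le_gridCeil hd _) _
      filter_upwards [hc.eventually (h.arrivals.eventually_eq ω (V n ω + σ ω))] with d h2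
      simp only [Set.mem_inter_iff, Set.mem_ofPred_eq, h2])
  have hlim2 : Tendsto (fun d => P A * ∫⁻ x, poissonMeasure (Q.arrivalRate * gridCeil d x) {l}
      ∂Q.serviceLaw) (𝓝[>] 0) (𝓝 (P A * Q.serviceArrivals l)) := by
    refine ENNReal.Tendsto.const_mul ?_ (Or.inr (measure_ne_top _ _))
    refine tendsto_lintegral_filter_of_dominated_convergence (fun _ => 1)
      (Eventually.of_forall fun d => ?_) (Eventually.of_forall fun d => ae_of_all _ fun x =>
        prob_le_one) (by simp) (ae_of_all _ fun x => ?_)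
    · exact (continuous_poissonMeasure_singleton _ l).measurable.comp
        ((measurable_from_nat (f := fun n : ℕ => (n : ℝ≥0) * d)).comp
          (measurable_natCeil_div measurable_id d))
    · exact ((continuous_poissonMeasure_singleton Q.arrivalRate l).tendsto x).comp
        ((tendsto_gridCeil x).mono_right nhdsWithin_le_nhds)
  refine tendsto_nhds_unique hlim (hlim2.congr' ?_)
  filter_upwards [self_mem_nhdsWithin] with d hd
  have hint : ∫⁻ x, poissonMeasure (Q.arrivalRate * gridCeil d x) {l} ∂Q.serviceLaw =
      ∑' m : ℕ, poissonMeasure (Q.arrivalRate * (m * d)) {l} *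
        P {ω | ⌈σ ω / d⌉₊ = m} := by
    have hc : Measurable fun x : ℝ≥0 => ⌈x / d⌉₊ := measurable_natCeil_div measurable_id d
    simp only [gridCeil]
    rw [← lintegral_map (f := fun m : ℕ => poissonMeasure (Q.arrivalRate * (m * d)) {l})
      (measurable_from_nat) hc, lintegral_countable']
    refine tsum_congr fun m => ?_
    rw [Measure.map_apply hc (measurableSet_singleton m), ← (h.service_law n).map_eq,
      Measure.map_apply hσm (hc (measurableSet_singleton m))]
    rfl
  rw [hint, measure_eq_tsum_inter_fiber (measurable_natCeil_div hσm d)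
    (hAm.inter (hinc (hgrid d))), ← ENNReal.tsum_mul_left]
  refine tsum_congr fun m => ?_
  have hset : A ∩ {ω | N (V n ω + gridCeil d (σ ω)) ω - N (V n ω) ω = l} ∩
      {ω | ⌈σ ω / d⌉₊ = m} =
      {ω | ⌈σ ω / d⌉₊ = m} ∩ (A ∩ {ω | N (V n ω + m * d) ω - N (V n ω) ω = l}) := by
    ext ω
    simp only [Set.mem_inter_iff, Set.mem_ofPred_eq, gridCeil]
    constructor
    · rintro ⟨⟨h1, h2⟩, rfl⟩
      exact ⟨rfl, h1, h2⟩
    · rintro ⟨rfl, h1, h2⟩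
      exact ⟨⟨h1, h2⟩, rfl⟩
  have hpast : MeasurableSet[historyAtActivation N S V n ⊔ arrivalsAfter N V n]
      (A ∩ {ω | N (V n ω + m * d) ω - N (V n ω) ω = l}) := by
    refine MeasurableSet.inter ((le_sup_left : historyAtActivation N S V n ≤ _) _ hA) ?_
    refine (le_sup_right : arrivalsAfter N V n ≤ _) _ ?_
    exact le_iSup (fun u : ℝ≥0 => MeasurableSpace.comap
      (fun ω => N (V n ω + u) ω - N (V n ω) ω) ⊤) (m * d) _ ⟨{l}, trivial, rfl⟩
  have hind : P ({ω | ⌈σ ω / d⌉₊ = m} ∩ (A ∩ {ω | N (V n ω + m * d) ω - N (V n ω) ω = l})) = _ :=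
    (Indep_iff _ _ _).1 (h.service_indep n) _ _
      ⟨{x | ⌈x / d⌉₊ = m}, (measurable_natCeil_div measurable_id d) (measurableSet_singleton m),
        rfl⟩ hpast
  rw [hset, hind, h.arrivals.strong_markov (h.activation_stopping n) hAτ]
  simp only [hσ]
  ring

/-- Given the history at a service completion that leaves `i` customers behind, the number of
arrivals before the next service begins has the law `Q.idleArrivals i`. -/
theorem measure_inter_idle [IsProbabilityMeasure P]
    (h : IsVacationQueueProcess Q P 𝓕 k N S V W) (n : ℕ)
    {A : Set Ω} (hA : MeasurableSet[historyAtCompletion N S V n] A) (hAm : MeasurableSet A)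
    (i m : ℕ) :
    P (A ∩ {ω | numAfterService k N S n ω = (i : ℤ)} ∩ {ω | N (V n ω) ω = N (S n ω) ω + m}) =
      P (A ∩ {ω | numAfterService k N S n ω = (i : ℤ)}) * Q.idleArrivals i m := by
  have hNS := h.measurable_arrivals_completion n
  have hNV := h.measurable_arrivals_activation n
  have hξ := h.measurable_numAfterService n
  set E := A ∩ {ω | numAfterService k N S n ω = (i : ℤ)} with hE
  have hEm : MeasurableSet E := hAm.inter (hξ (measurableSet_singleton _))
  -- The vacation law summed over the number of arrivals gives the probability of a vacation.
  have hWE : P (E ∩ W n) = P E * ENNReal.ofReal (Q.deact i) := by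
    rw [measure_eq_tsum_inter_fiber (hNV.sub hNS) (hEm.inter (h.measurableSet_vacation n))]
    have : ∀ m : ℕ, P (E ∩ W n ∩ {ω | N (V n ω) ω - N (S n ω) ω = m}) =
        P E * ENNReal.ofReal (Q.deact i) * Q.vacArrivals i m := fun m => by
      rw [mul_assoc, ← h.vacation_law n A hA i m]
      congr 1
      ext ω
      have := h.arrivals_completion_le n ω
      simp only [Set.mem_inter_iff, Set.mem_ofPred_eq, hE]
      rw [and_assoc (b := ω ∈ W n)]
      refine and_congr_right fun _ => and_congr_right fun _ => ?_
      omega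
    simp only [Pi.sub_apply, this]
    rw [ENNReal.tsum_mul_left, PMF.tsum_coe, mul_one]
  have hWc : P (E \ W n) = P E * ENNReal.ofReal (1 - Q.deact i) := by
    have h1 := measure_inter_add_sdiff (μ := P) E (h.measurableSet_vacation n)
    rw [hWE] at h1
    have h2 : P E * ENNReal.ofReal (Q.deact i) + P E * ENNReal.ofReal (1 - Q.deact i) = P E := by
      rw [← mul_add, ← ENNReal.ofReal_add (Q.deact_nonneg i) (sub_nonneg.2 (Q.deact_le_one i))]
      simp
    exact (ENNReal.add_right_inj (by finiteness)).1 (h1.trans h2.symm)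
  rw [← measure_inter_add_sdiff _ (h.measurableSet_vacation n), VacationQueue.idleArrivals,
    mul_add]
  congr 1
  · rw [← h.vacation_law n A hA i m]
    congr 1
    ext ω
    simp only [Set.mem_inter_iff, Set.mem_ofPred_eq, hE]
    tauto
  · split_ifs with hm
    · rw [← hWc]
      congr 1
      ext ω
      simp only [Set.mem_inter_iff, Set.mem_ofPred_eq, Set.mem_sdiff, hm, add_zero]
      constructor
      · rintro ⟨⟨h1, h2⟩, h3⟩
        exact ⟨h1, h3⟩
      · rintro ⟨h1, h3⟩
        exact ⟨⟨h1, by rw [h.no_vacation n ω h3]⟩, h3⟩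
    · rw [mul_zero]
      convert measure_empty (μ := P)
      ext ω
      simp only [Set.mem_inter_iff, Set.mem_ofPred_eq, Set.mem_sdiff, Set.mem_empty_iff_false,
        iff_false]
      rintro ⟨⟨h1, h2⟩, h3⟩
      rw [h.no_vacation n ω h3] at h2
      omega

theorem numAfterService_succ (h : IsVacationQueueProcess Q P 𝓕 k N S V W) (n : ℕ) (ω : Ω) :
    numAfterService k N S (n + 1) ω + 1 = numAfterService k N S n ω +
      ((N (V n ω) ω - N (S n ω) ω : ℕ) : ℤ) + ((N (S (n + 1) ω) ω - N (V n ω) ω : ℕ) : ℤ) := by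
  have h1 := h.arrivals_completion_le n ω
  have h2 := h.arrivals_activation_le n ω
  unfold numAfterService
  push_cast [Nat.cast_sub h1, Nat.cast_sub h2]
  ring

/-- Almost surely no service completion leaves a negative number of customers behind: a service
that would begin in an empty system is preceded by a vacation with an arrival. -/
theorem ae_numAfterService_nonneg [IsProbabilityMeasure P]
    (h : IsVacationQueueProcess Q P 𝓕 k N S V W) :
    ∀ᵐ ω ∂P, ∀ n, 0 ≤ numAfterService k N S n ω := by
  refine ae_all_iff.2 fun n => ?_
  induction n with
  | zero =>
    refine ae_of_all _ fun ω => ?_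
    simp only [numAfterService, Nat.cast_zero, sub_zero]
    positivity
  | succ n ih =>
    have h0 : P (Set.univ ∩ {ω | numAfterService k N S n ω = ((0 : ℕ) : ℤ)} ∩
        {ω | N (V n ω) ω = N (S n ω) ω + 0}) = 0 := by
      rw [h.measure_inter_idle n MeasurableSet.univ MeasurableSet.univ,
        Q.idleArrivals_zero_zero, mul_zero]
    filter_upwards [ih, measure_eq_zero_iff_ae_notMem.1 h0] with ω h1 h2
    have h3 := h.numAfterService_succ n ω
    by_contra hneg
    refine h2 ⟨⟨trivial, ?_⟩, ?_⟩
    · simp only [Set.mem_ofPred_eq]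
      omega
    · have := h.arrivals_completion_le n ω
      simp only [Set.mem_ofPred_eq]
      omega

/-- The joint law of the numbers of customers, of arrivals before the next service, and of
arrivals during the next service, on the event that the `n`-th completion occurs before `T`. -/
theorem measure_transition [IsProbabilityMeasure P]
    (h : IsVacationQueueProcess Q P 𝓕 k N S V W) (n : ℕ) (T : ℝ≥0) (i m l : ℕ) :
    P ({ω | S n ω ≤ T} ∩ {ω | numAfterService k N S n ω = (i : ℤ)} ∩
        {ω | N (V n ω) ω = N (S n ω) ω + m} ∩ {ω | N (S (n + 1) ω) ω = N (V n ω) ω + l}) =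
      P ({ω | S n ω ≤ T} ∩ {ω | numAfterService k N S n ω = (i : ℤ)}) *
        (Q.idleArrivals i m * Q.serviceArrivals l) := by
  have hpair : Measurable[historyAtCompletion N S V n] fun ω => (S n ω, N (S n ω) ω) :=
    Measurable.mono (comap_measurable _) ((le_iSup₂ (f := fun (m : ℕ) (_ : m ≤ n) =>
      MeasurableSpace.comap (fun ω => (S m ω, N (S m ω) ω)) inferInstance) n le_rfl).trans
        le_sup_left) le_rfl
  have hpairV : Measurable[historyAtActivation N S V n] fun ω => (V n ω, N (V n ω) ω) :=
    Measurable.mono (comap_measurable _) le_sup_right le_rfl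
  have hle : historyAtCompletion N S V n ≤ historyAtActivation N S V n := le_sup_left
  have hST : MeasurableSet[historyAtCompletion N S V n] {ω | S n ω ≤ T} :=
    (measurable_fst.comp hpair) measurableSet_Iic
  have hNS : Measurable[historyAtActivation N S V n] fun ω => N (S n ω) ω :=
    (measurable_snd.comp hpair).mono hle le_rfl
  have hNV : Measurable[historyAtActivation N S V n] fun ω => N (V n ω) ω :=
    measurable_snd.comp hpairV
  have hmono : (h.completion_stopping n).measurableSpace ≤
      (h.activation_stopping n).measurableSpace :=
    IsStoppingTime.measurableSpace_mono _ _ fun ω => by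
      exact WithTop.coe_le_coe.2 (h.completion_le_activation n ω)
  have hST' : MeasurableSet[(h.activation_stopping n).measurableSpace] {ω | S n ω ≤ T} := by
    have := hmono _ ((h.completion_stopping n).measurableSet_le' T)
    simpa only [WithTop.coe_le_coe] using this
  have hNS' : Measurable[(h.activation_stopping n).measurableSpace] fun ω => N (S n ω) ω :=
    (h.arrivals.measurable_stopped (h.completion_stopping n)).mono hmono le_rfl
  have hNV' : Measurable[(h.activation_stopping n).measurableSpace] fun ω => N (V n ω) ω :=
    h.arrivals.measurable_stopped (h.activation_stopping n)
  have hset : ∀ (G : MeasurableSpace Ω), MeasurableSet[G] {ω | S n ω ≤ T} →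
      (Measurable[G] fun ω => N (S n ω) ω) → (Measurable[G] fun ω => N (V n ω) ω) →
      MeasurableSet[G] ({ω | S n ω ≤ T} ∩ {ω | numAfterService k N S n ω = (i : ℤ)} ∩
        {ω | N (V n ω) ω = N (S n ω) ω + m}) := by
    intro G h1 h2 h3
    refine MeasurableSet.inter (MeasurableSet.inter h1 ?_) ?_
    · exact h2 (MeasurableSet.of_discrete (s := {x : ℕ | (k : ℤ) + (x : ℤ) - (n : ℤ) = i}))
    · exact (h2.prodMk h3) (MeasurableSet.of_discrete (s := {x : ℕ × ℕ | x.2 = x.1 + m}))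
  rw [h.measure_inter_service n (hset _ (hle _ hST) hNS hNV) (hset _ hST' hNS' hNV'),
    h.measure_inter_idle n hST ((h.measurable_completion n) measurableSet_Iic), mul_assoc]

/-- Expectations of functionals of one service cycle, on the event that the cycle begins before
`T`. -/
theorem lintegral_transition [IsProbabilityMeasure P]
    (h : IsVacationQueueProcess Q P 𝓕 k N S V W) (n : ℕ) (T : ℝ≥0) (f : ℕ → ℕ → ℕ → ℝ≥0∞) :
    ∫⁻ ω in {ω | S n ω ≤ T}, f (numAfterService k N S n ω).toNat (N (V n ω) ω - N (S n ω) ω)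
        (N (S (n + 1) ω) ω - N (V n ω) ω) ∂P =
      ∑' i : ℕ, P ({ω | S n ω ≤ T} ∩ {ω | numAfterService k N S n ω = (i : ℤ)}) *
        ∑' m : ℕ, Q.idleArrivals i m * ∑' l : ℕ, Q.serviceArrivals l * f i m l := by
  have hNS := h.measurable_arrivals_completion n
  have hNV := h.measurable_arrivals_activation n
  have hNS' := h.measurable_arrivals_completion (n + 1)
  have hξ : Measurable fun ω => (numAfterService k N S n ω).toNat :=
    (measurable_from_top (f := Int.toNat)).comp (h.measurable_numAfterService n)
  set g : Ω → ℕ × ℕ × ℕ := fun ω => ((numAfterService k N S n ω).toNat,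
    N (V n ω) ω - N (S n ω) ω, N (S (n + 1) ω) ω - N (V n ω) ω) with hg
  have hgm : Measurable g := hξ.prodMk ((hNV.sub hNS).prodMk (hNS'.sub hNV))
  have h1 := lintegral_map (μ := P.restrict {ω | S n ω ≤ T})
    (f := fun x : ℕ × ℕ × ℕ => f x.1 x.2.1 x.2.2) (measurable_of_countable _) hgm
  rw [lintegral_countable', ENNReal.tsum_prod'] at h1
  rw [← h1]
  refine tsum_congr fun i => ?_
  rw [ENNReal.tsum_prod', ← ENNReal.tsum_mul_left]
  refine tsum_congr fun m => ?_
  rw [← ENNReal.tsum_mul_left, ← ENNReal.tsum_mul_left]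
  refine tsum_congr fun l => ?_
  rw [Measure.map_apply hgm (measurableSet_singleton _),
    Measure.restrict_apply (hgm (measurableSet_singleton _))]
  have hae : P (g ⁻¹' {(i, m, l)} ∩ {ω | S n ω ≤ T}) =
      P ({ω | S n ω ≤ T} ∩ {ω | numAfterService k N S n ω = (i : ℤ)} ∩
        {ω | N (V n ω) ω = N (S n ω) ω + m} ∩ {ω | N (S (n + 1) ω) ω = N (V n ω) ω + l}) := by
    refine measure_congr ?_
    filter_upwards [h.ae_numAfterService_nonneg] with ω hω
    have h1 := h.arrivals_completion_le n ω
    have h2 := h.arrivals_activation_le n ω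
    have h3 := hω n
    refine propext ?_
    change (g ω ∈ ({(i, m, l)} : Set _) ∧ S n ω ≤ T) ↔ (((S n ω ≤ T ∧ _ = _) ∧ _ = _) ∧ _ = _)
    simp only [hg, Set.mem_singleton_iff, Prod.mk.injEq]
    constructor
    · rintro ⟨⟨h4, h5, h6⟩, h7⟩
      refine ⟨⟨⟨h7, ?_⟩, ?_⟩, ?_⟩ <;> omega
    · rintro ⟨⟨⟨h7, h4⟩, h5⟩, h6⟩
      refine ⟨⟨?_, ?_, ?_⟩, h7⟩ <;> omega
  rw [hae, h.measure_transition]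
  ring

end IsVacationQueueProcess

end Transition

/-! ### Moments of the Poisson law -/

theorem tsum_poissonMeasure_mul_natCast (r : ℝ≥0) :
    ∑' l : ℕ, poissonMeasure r {l} * (l : ℝ≥0∞) = r := by
  rw [tsum_eq_zero_add' ENNReal.summable]
  have h1 : ∀ l : ℕ, poissonMeasure r {l + 1} * ((l + 1 : ℕ) : ℝ≥0∞) =
      r * poissonMeasure r {l} := fun l => by
    rw [poissonMeasure_singleton, poissonMeasure_singleton, ← ENNReal.ofReal_natCast,
      ← ENNReal.ofReal_mul (by positivity), ← ENNReal.ofReal_coe_nnreal,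
      ← ENNReal.ofReal_mul (by positivity), Nat.factorial_succ]
    congr 1
    push_cast
    field_simp
    ring
  simp_rw [h1]
  rw [ENNReal.tsum_mul_left, tsum_poissonMeasure_singleton]
  simp

theorem tsum_poissonMeasure_mul_pow (r : ℝ≥0) {x : ℝ} (hx : 0 ≤ x) :
    ∑' l : ℕ, poissonMeasure r {l} * ENNReal.ofReal x ^ l =
      ENNReal.ofReal (Real.exp (-(r * (1 - x)))) := by
  have h1 : HasSum (fun l : ℕ => Real.exp (-r) * (r * x) ^ l / l.factorial)
      (Real.exp (-(r * (1 - x)))) := by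
    have h2 := (NormedSpace.exp_series_hasSum_exp' (𝕂 := ℝ) ((r : ℝ) * x)).mul_left
      (Real.exp (-r))
    rw [← Real.exp_eq_exp_ℝ, ← Real.exp_add] at h2
    rw [show -((r : ℝ) * (1 - x)) = -r + r * x by ring]
    refine h2.congr_fun fun l => ?_
    rw [smul_eq_mul]
    ring
  rw [← h1.tsum_eq, ENNReal.ofReal_tsum_of_nonneg (fun l => by positivity) h1.summable]
  refine tsum_congr fun l => ?_
  rw [poissonMeasure_singleton, ← ENNReal.ofReal_pow hx, ← ENNReal.ofReal_mul (by positivity)]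
  congr 1
  ring

theorem poissonMeasure_two_le_le (r : ℝ≥0) :
    poissonMeasure r {l | 2 ≤ l} ≤ ENNReal.ofReal ((r : ℝ) ^ 2) := by
  have hc : {l : ℕ | 2 ≤ l} = {0, 1}ᶜ := by
    ext l
    simp only [Set.mem_ofPred_eq, Set.mem_compl_iff, Set.mem_insert_iff, Set.mem_singleton_iff]
    omega
  rw [hc, prob_compl_eq_one_sub (Set.toFinite _).measurableSet, Set.insert_eq,
    measure_union (by simp) (measurableSet_singleton 1), poissonMeasure_singleton,
    poissonMeasure_singleton, ← ENNReal.ofReal_add (by positivity) (by positivity),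
    ← ENNReal.ofReal_one, ← ENNReal.ofReal_sub _ (by positivity)]
  refine ENNReal.ofReal_le_ofReal ?_
  have := Real.add_one_le_exp (-(r : ℝ))
  have hr : (0 : ℝ) ≤ r := r.2
  simp only [pow_zero, Nat.factorial_zero, Nat.cast_one, pow_one, Nat.factorial_one, div_one,
    mul_one]
  nlinarith

theorem IsPoissonProcess.lintegral_natCast {Ω : Type*} {mΩ : MeasurableSpace Ω} {P : Measure Ω}
    {𝓕 : Filtration ℝ≥0 mΩ} {lam : ℝ≥0} {N : ℝ≥0 → Ω → ℕ} (h : IsPoissonProcess P 𝓕 lam N)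
    {s t : ℝ≥0} (hst : s ≤ t) :
    ∫⁻ ω, ((N t ω - N s ω : ℕ) : ℝ≥0∞) ∂P = lam * (t - s : ℝ≥0) := by
  have h1 := lintegral_map (μ := P) (f := fun l : ℕ => (l : ℝ≥0∞)) (measurable_of_countable _)
    ((h.measurable t).sub (h.measurable s))
  have h2 := (h.increment_law s t hst).map_eq
  simp only [Pi.sub_apply] at h1
  rw [← h1]
  change ∫⁻ l : ℕ, (l : ℝ≥0∞) ∂(P.map fun ω => N t ω - N s ω) = _
  rw [h2, lintegral_countable']
  simp_rw [mul_comm _ (poissonMeasure _ _)]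
  rw [tsum_poissonMeasure_mul_natCast, ENNReal.coe_mul]

/-! ### Occupation counts of the queue at service completions -/

/-- The expected number of service completions up to time `T` (with the one at time `0`) that
leave `i` customers behind. -/
noncomputable def occupation {Ω : Type*} {mΩ : MeasurableSpace Ω} (P : Measure Ω) (k : ℕ)
    (N : ℝ≥0 → Ω → ℕ) (S : ℕ → Ω → ℝ≥0) (T : ℝ≥0) (i : ℕ) : ℝ≥0∞ :=
  ∑' n : ℕ, P ({ω | S n ω ≤ T} ∩ {ω | numAfterService k N S n ω = (i : ℤ)})

theorem VacationQueue.tsum_idleArrivals (Q : VacationQueue) (i : ℕ) :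
    ∑' m, Q.idleArrivals i m = 1 := by
  simp only [VacationQueue.idleArrivals]
  rw [ENNReal.tsum_add, ENNReal.tsum_mul_left, PMF.tsum_coe, tsum_ite_eq, mul_one,
    ← ENNReal.ofReal_add (Q.deact_nonneg i) (sub_nonneg.2 (Q.deact_le_one i))]
  simp

namespace IsVacationQueueProcess

variable {Ω : Type*} {mΩ : MeasurableSpace Ω} {Q : VacationQueue} {P : Measure Ω}
  {𝓕 : Filtration ℝ≥0 mΩ} {k : ℕ} {N : ℝ≥0 → Ω → ℕ} {S V : ℕ → Ω → ℝ≥0} {W : ℕ → Set Ω}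

theorem monotone_completion (h : IsVacationQueueProcess Q P 𝓕 k N S V W) (ω : Ω) :
    Monotone fun n => S n ω :=
  monotone_nat_of_le_succ fun n =>
    (h.completion_le_activation n ω).trans (h.activation_le_completion n ω)

theorem measurableSet_completion_le (h : IsVacationQueueProcess Q P 𝓕 k N S V W) (n : ℕ)
    (T : ℝ≥0) : MeasurableSet {ω | S n ω ≤ T} :=
  (h.measurable_completion n) measurableSet_Iic

/-- There are never more departures than customers. -/
theorem ae_le_of_completion_le [IsProbabilityMeasure P]
    (h : IsVacationQueueProcess Q P 𝓕 k N S V W) :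
    ∀ᵐ ω ∂P, ∀ n t, S n ω ≤ t → n ≤ k + N t ω := by
  filter_upwards [h.ae_numAfterService_nonneg] with ω hω n t hn
  have h1 := hω n
  have h2 : N (S n ω) ω ≤ N t ω := h.arrivals.mono ω hn
  unfold numAfterService at h1
  omega

theorem tsum_lintegral_transition [IsProbabilityMeasure P]
    (h : IsVacationQueueProcess Q P 𝓕 k N S V W) (T : ℝ≥0) (f : ℕ → ℕ → ℕ → ℝ≥0∞) :
    ∑' n, ∫⁻ ω in {ω | S n ω ≤ T}, f (numAfterService k N S n ω).toNat
        (N (V n ω) ω - N (S n ω) ω) (N (S (n + 1) ω) ω - N (V n ω) ω) ∂P =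
      ∑' i : ℕ, occupation P k N S T i *
        ∑' m : ℕ, Q.idleArrivals i m * ∑' l : ℕ, Q.serviceArrivals l * f i m l := by
  simp_rw [h.lintegral_transition _ T f, occupation, ← ENNReal.tsum_mul_right]
  exact ENNReal.tsum_comm

theorem tsum_lintegral_pow [IsProbabilityMeasure P]
    (h : IsVacationQueueProcess Q P 𝓕 k N S V W) (T : ℝ≥0) (x : ℝ≥0∞) :
    ∑' n, ∫⁻ ω in {ω | S n ω ≤ T}, x ^ (numAfterService k N S n ω).toNat ∂P =
      ∑' i : ℕ, occupation P k N S T i * x ^ i := by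
  rw [h.tsum_lintegral_transition T fun i _ _ => x ^ i]
  refine tsum_congr fun i => ?_
  simp_rw [ENNReal.tsum_mul_right, Q.serviceArrivals.tsum_coe, one_mul]
  rw [Q.tsum_idleArrivals, one_mul]

theorem lintegral_arrivals [IsProbabilityMeasure P]
    (h : IsVacationQueueProcess Q P 𝓕 k N S V W) (T : ℝ≥0) :
    ∫⁻ ω, (N T ω : ℝ≥0∞) ∂P = Q.arrivalRate * T := by
  have := h.arrivals.lintegral_natCast (zero_le (a := T))
  simpa [h.arrivals.zero] using this

theorem tsum_occupation_le [IsProbabilityMeasure P]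
    (h : IsVacationQueueProcess Q P 𝓕 k N S V W) (T : ℝ≥0) :
    ∑' i, occupation P k N S T i ≤ 1 + k + Q.arrivalRate * T := by
  have h1 := h.tsum_lintegral_pow T 1
  simp only [one_pow, mul_one] at h1
  rw [← h1, ← h.lintegral_arrivals T]
  have h2 : ∀ n, ∫⁻ _ in {ω | S n ω ≤ T}, (1 : ℝ≥0∞) ∂P =
      ∫⁻ ω, {ω | S n ω ≤ T}.indicator 1 ω ∂P := fun n => by
    rw [← lintegral_indicator (h.measurableSet_completion_le n T)]
    rfl
  simp_rw [h2]
  rw [← lintegral_tsum fun n =>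
    (measurable_one.indicator (h.measurableSet_completion_le n T)).aemeasurable]
  have h3 : (1 + k + ∫⁻ ω, (N T ω : ℝ≥0∞) ∂P) = ∫⁻ ω, (1 + k + (N T ω : ℝ≥0∞)) ∂P := by
    rw [lintegral_add_left measurable_const, lintegral_const, measure_univ, mul_one]
  rw [h3]
  refine lintegral_mono_ae ?_
  filter_upwards [h.ae_le_of_completion_le] with ω hω
  rw [tsum_eq_sum (s := Finset.range (1 + k + N T ω))]
  · calc ∑ n ∈ Finset.range (1 + k + N T ω), {ω | S n ω ≤ T}.indicator (1 : Ω → ℝ≥0∞) ω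
        ≤ ∑ n ∈ Finset.range (1 + k + N T ω), 1 :=
          Finset.sum_le_sum fun n _ => Set.indicator_le_self' (by simp) ω
      _ = 1 + k + (N T ω : ℝ≥0∞) := by simp
  · intro n hn
    refine Set.indicator_of_notMem (fun hS => hn ?_) _
    have := hω n T hS
    simp only [Finset.mem_range]
    omega

/-- All arrivals up to time `T` fall into service cycles that begin before `T`. -/
theorem arrivals_le_tsum_occupation [IsProbabilityMeasure P]
    (h : IsVacationQueueProcess Q P 𝓕 k N S V W) (T : ℝ≥0) :
    (Q.arrivalRate * T : ℝ≥0∞) ≤ ∑' i, occupation P k N S T i *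
        ∑' m : ℕ, Q.idleArrivals i m * ∑' l : ℕ, Q.serviceArrivals l * ((m : ℝ≥0∞) + l) := by
  have hNS := h.measurable_arrivals_completion
  have hNV := h.measurable_arrivals_activation
  rw [← h.lintegral_arrivals T, ← h.tsum_lintegral_transition T fun _ m l => (m : ℝ≥0∞) + l]
  simp_rw [← lintegral_indicator (h.measurableSet_completion_le _ T)]
  have hmeas : ∀ n, Measurable fun ω => ((N (V n ω) ω - N (S n ω) ω : ℕ) : ℝ≥0∞) +
      ((N (S (n + 1) ω) ω - N (V n ω) ω : ℕ) : ℝ≥0∞) := fun n =>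
    ((measurable_from_top (f := fun x : ℕ => (x : ℝ≥0∞))).comp ((hNV n).sub (hNS n))).add
      ((measurable_from_top (f := fun x : ℕ => (x : ℝ≥0∞))).comp ((hNS (n + 1)).sub (hNV n)))
  rw [← lintegral_tsum fun n =>
    ((hmeas n).indicator (h.measurableSet_completion_le n T)).aemeasurable]
  refine lintegral_mono_ae ?_
  filter_upwards [h.ae_le_of_completion_le] with ω hω
  have hex : ∃ n, T < S n ω := by
    by_contra! hcon
    have := hω (k + N T ω + 1) T (hcon _)
    omega
  classical
  -- The cycles up to the first completion after `T` cover `[0, T]`.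
  have hlt := Nat.find_spec hex
  have hmin : ∀ n < Nat.find hex, S n ω ≤ T := fun n hn => not_lt.1 (Nat.find_min hex hn)
  have htel : ∀ n, ((N (S n ω) ω : ℕ) : ℝ≥0∞) = ∑ j ∈ Finset.range n,
      (((N (V j ω) ω - N (S j ω) ω : ℕ) : ℝ≥0∞) +
        ((N (S (j + 1) ω) ω - N (V j ω) ω : ℕ) : ℝ≥0∞)) := fun n => by
    induction n with
    | zero => simp [h.start, h.arrivals.zero]
    | succ n ih =>
      rw [Finset.sum_range_succ, ← ih]
      have h1 := h.arrivals_completion_le n ω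
      have h2 := h.arrivals_activation_le n ω
      norm_cast
      omega
  calc ((N T ω : ℕ) : ℝ≥0∞) ≤ (N (S (Nat.find hex) ω) ω : ℕ) := by
        exact_mod_cast h.arrivals.mono ω hlt.le
    _ = _ := htel _
    _ = ∑ n ∈ Finset.range (Nat.find hex), {ω | S n ω ≤ T}.indicator (fun ω =>
          ((N (V n ω) ω - N (S n ω) ω : ℕ) : ℝ≥0∞) +
            ((N (S (n + 1) ω) ω - N (V n ω) ω : ℕ) : ℝ≥0∞)) ω := by
        refine Finset.sum_congr rfl fun n hn => ?_
        rw [Set.indicator_of_mem]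
        exact hmin n (Finset.mem_range.1 hn)
    _ ≤ _ := ENNReal.sum_le_tsum _

/-- The occupation counts are invariant under the transitions between service completions, up to
the first and the last of these. -/
theorem occupation_balance [IsProbabilityMeasure P]
    (h : IsVacationQueueProcess Q P 𝓕 k N S V W) (T : ℝ≥0) {x : ℝ≥0∞} (hx : x ≤ 1) :
    x * ∑' i, occupation P k N S T i * x ^ i ≤ 1 + ∑' i, occupation P k N S T i *
        ∑' m : ℕ, Q.idleArrivals i m * ∑' l : ℕ, Q.serviceArrivals l * x ^ (i + m + l) ∧
    ∑' i, occupation P k N S T i *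
        ∑' m : ℕ, Q.idleArrivals i m * ∑' l : ℕ, Q.serviceArrivals l * x ^ (i + m + l) ≤
      1 + x * ∑' i, occupation P k N S T i * x ^ i := by
  -- `R` counts the completions that end a cycle begun before `T`; these are the completions up to
  -- `T` without the one at time `0` and with the first one after `T`.
  set R : ℝ≥0∞ := ∑' n, ∫⁻ ω in {ω | S n ω ≤ T}, x ^ (numAfterService k N S (n + 1) ω).toNat ∂P
    with hR
  have hle : ∀ n : ℕ, x ^ n ≤ 1 := fun n => pow_le_one₀ zero_le hx
  have hw : ∑' i, occupation P k N S T i *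
      ∑' m : ℕ, Q.idleArrivals i m * ∑' l : ℕ, Q.serviceArrivals l * x ^ (i + m + l) = x * R := by
    rw [← h.tsum_lintegral_transition T fun i m l => x ^ (i + m + l), hR, ← ENNReal.tsum_mul_left]
    refine tsum_congr fun n => ?_
    rw [← lintegral_const_mul]
    · refine lintegral_congr_ae (ae_restrict_of_ae ?_)
      filter_upwards [h.ae_numAfterService_nonneg] with ω hω
      have h1 := h.numAfterService_succ n ω
      have h2 := hω n
      have h3 := hω (n + 1)
      rw [← pow_succ']
      congr 1
      omega
    · exact (measurable_from_top (f := fun z : ℤ => x ^ z.toNat)).comp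
        (h.measurable_numAfterService (n + 1))
  have hu := h.tsum_lintegral_pow T x
  have h1 : ∑' i, occupation P k N S T i * x ^ i ≤ 1 + R := by
    rw [← hu, tsum_eq_zero_add' ENNReal.summable]
    gcongr
    · calc ∫⁻ ω in {ω | S 0 ω ≤ T}, x ^ (numAfterService k N S 0 ω).toNat ∂P
          ≤ ∫⁻ _, 1 ∂P := by
            refine (setLIntegral_le_lintegral _ _).trans (lintegral_mono fun ω => hle _)
        _ = 1 := by simp
    · refine ENNReal.tsum_le_tsum fun n => lintegral_mono_set fun ω hω => ?_
      exact (h.monotone_completion ω n.le_succ).trans hω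
  have h2 : R ≤ 1 + ∑' i, occupation P k N S T i * x ^ i := by
    rw [← hu]
    have h3 : ∀ n, ∫⁻ ω in {ω | S n ω ≤ T}, x ^ (numAfterService k N S (n + 1) ω).toNat ∂P ≤
        P ({ω | S n ω ≤ T} \ {ω | S (n + 1) ω ≤ T}) +
        ∫⁻ ω in {ω | S (n + 1) ω ≤ T}, x ^ (numAfterService k N S (n + 1) ω).toNat ∂P := by
      intro n
      rw [← lintegral_inter_add_sdiff _ _ (h.measurableSet_completion_le (n + 1) T), add_comm]
      gcongr
      · calc ∫⁻ ω in {ω | S n ω ≤ T} \ {ω | S (n + 1) ω ≤ T},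
              x ^ (numAfterService k N S (n + 1) ω).toNat ∂P
            ≤ ∫⁻ ω in {ω | S n ω ≤ T} \ {ω | S (n + 1) ω ≤ T}, 1 ∂P :=
              lintegral_mono fun ω => hle _
          _ = _ := by simp
      · exact Set.inter_subset_right
    refine (ENNReal.tsum_le_tsum h3).trans ?_
    rw [ENNReal.tsum_add]
    refine add_le_add ?_ ?_
    · rw [← measure_iUnion]
      · exact prob_le_one
      · intro m n hmn
        refine Set.disjoint_left.2 ?_
        rintro ω ⟨h4, h5⟩ ⟨h6, h7⟩
        rcases lt_or_gt_of_ne hmn with hlt | hlt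
        · exact h5 ((h.monotone_completion ω hlt).trans h6)
        · exact h7 ((h.monotone_completion ω hlt).trans h4)
      · exact fun n => (h.measurableSet_completion_le n T).diff
          (h.measurableSet_completion_le (n + 1) T)
    · refine ENNReal.tsum_comp_le_tsum_of_injective (f := fun n : ℕ => n + 1)
        (fun a b hab => by simpa using hab)
        (fun n => ∫⁻ ω in {ω | S n ω ≤ T}, x ^ (numAfterService k N S n ω).toNat ∂P)
  rw [hw]
  constructor
  · calc x * ∑' i, occupation P k N S T i * x ^ i ≤ x * (1 + R) := by gcongr
      _ ≤ 1 + x * R := by rw [mul_add, mul_one]; gcongr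
  · calc x * R ≤ x * (1 + ∑' i, occupation P k N S T i * x ^ i) := by gcongr
      _ ≤ _ := by rw [mul_add, mul_one]; gcongr

end IsVacationQueueProcess

/-! ### Right-continuity of the state probabilities -/

/-- The number of service completions in `[0, t]`, without the start `S 0 = 0`. It is `0` also when
infinitely many epochs `S n` lie in `[0, t]`, which has probability zero. -/
noncomputable def departures {Ω : Type*} (S : ℕ → Ω → ℝ≥0) (t : ℝ≥0) (ω : Ω) : ℕ :=
  Set.ncard {n : ℕ | 1 ≤ n ∧ S n ω ≤ t}

theorem natCast_departures_eq_tsum {Ω : Type*} (S : ℕ → Ω → ℝ≥0) (t : ℝ≥0) (ω : Ω) :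
    (departures S t ω : ℝ) =
      (∑' n : ℕ, {ω | S (n + 1) ω ≤ t}.indicator (1 : Ω → ℝ≥0∞) ω).toReal := by
  have h1 : {n : ℕ | 1 ≤ n ∧ S n ω ≤ t} = (fun n => n + 1) '' {n : ℕ | S (n + 1) ω ≤ t} := by
    ext n
    simp only [Set.mem_ofPred_eq, Set.mem_image]
    constructor
    · rintro ⟨hn, h⟩
      exact ⟨n - 1, by rwa [Nat.sub_add_cancel hn], Nat.sub_add_cancel hn⟩
    · rintro ⟨m, hm, rfl⟩
      exact ⟨by omega, hm⟩
  have h2 : ∑' n : ℕ, {ω | S (n + 1) ω ≤ t}.indicator (1 : Ω → ℝ≥0∞) ω =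
      ∑' n : ℕ, {n : ℕ | S (n + 1) ω ≤ t}.indicator (1 : ℕ → ℝ≥0∞) n :=
    tsum_congr fun n => by simp [Set.indicator_apply]
  rw [departures, h1, Set.ncard_image_of_injective _ (add_left_injective 1), h2, ← tsum_subtype]
  simp only [Pi.one_apply, ENNReal.tsum_set_one]
  rw [Set.ncard_def]
  cases Set.encard {n : ℕ | S (n + 1) ω ≤ t} using ENat.recTopCoe <;> simp

theorem numInSystem_eq {Ω : Type*} (k : ℕ) (N : ℝ≥0 → Ω → ℕ) (S : ℕ → Ω → ℝ≥0) (t : ℝ≥0)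
    (ω : Ω) : numInSystem k N S t ω = (k : ℤ) + N t ω - departures S t ω := rfl

namespace IsVacationQueueProcess

variable {Ω : Type*} {mΩ : MeasurableSpace Ω} {Q : VacationQueue} {P : Measure Ω}
  {𝓕 : Filtration ℝ≥0 mΩ} {k : ℕ} {N : ℝ≥0 → Ω → ℕ} {S V : ℕ → Ω → ℝ≥0} {W : ℕ → Set Ω}

theorem adapted_numInSystem (h : IsVacationQueueProcess Q P 𝓕 k N S V W) (t : ℝ≥0) (j : ℤ) :
    MeasurableSet[𝓕 t] {ω | numInSystem k N S t ω = j} := by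
  have hS : ∀ n, MeasurableSet[𝓕 t] {ω | S n ω ≤ t} := fun n => by
    have := h.completion_stopping n t
    simpa only [WithTop.coe_le_coe] using this
  have hD : Measurable[𝓕 t] fun ω => (departures S t ω : ℝ) := by
    simp_rw [natCast_departures_eq_tsum]
    refine Measurable.ennreal_toReal ?_
    exact @Measurable.tsum Ω ℝ≥0∞ ℕ (𝓕 t) _ _ _ _ _ _ _ _ _ _ _ _ fun n =>
      (@measurable_const _ _ _ (𝓕 t) 1).indicator (hS (n + 1))
  have hN : Measurable[𝓕 t] fun ω => (N t ω : ℝ) :=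
    (measurable_from_top (f := fun n : ℕ => (n : ℝ))).comp (h.arrivals.adapted t)
  have hL : Measurable[𝓕 t] fun ω => (k : ℝ) + N t ω - departures S t ω :=
    (hN.const_add _).sub hD
  convert hL (measurableSet_singleton (j : ℝ)) using 1
  ext ω
  simp only [Set.mem_ofPred_eq, Set.mem_preimage, Set.mem_singleton_iff, numInSystem_eq]
  norm_cast

theorem measurableSet_numInSystem (h : IsVacationQueueProcess Q P 𝓕 k N S V W) (t : ℝ≥0) (j : ℤ) :
    MeasurableSet {ω | numInSystem k N S t ω = j} :=
  𝓕.le t _ (h.adapted_numInSystem t j)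

/-- Almost surely only finitely many services are completed by time `t`, and they are the first
`departures S t` ones. -/
theorem ae_completion_le_iff [IsProbabilityMeasure P]
    (h : IsVacationQueueProcess Q P 𝓕 k N S V W) :
    ∀ᵐ ω ∂P, ∀ n t, S n ω ≤ t ↔ n ≤ departures S t ω := by
  filter_upwards [h.ae_le_of_completion_le] with ω hω n t
  have hex : ∃ n, t < S n ω := by
    by_contra! hcon
    have := hω (k + N t ω + 1) t (hcon _)
    omega
  classical
  have key : ∀ n, S n ω ≤ t ↔ n < Nat.find hex := fun n => by
    rw [Nat.lt_find_iff]
    constructor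
    · intro hn m hm
      exact not_lt.2 ((h.monotone_completion ω hm).trans hn)
    · intro hn
      exact not_lt.1 (hn n le_rfl)
  have hpos : 0 < Nat.find hex := by
    rw [← key, h.start]
    exact zero_le
  have hset : {n : ℕ | 1 ≤ n ∧ S n ω ≤ t} = (Finset.Ico 1 (Nat.find hex) : Set ℕ) := by
    ext n
    simp only [Set.mem_ofPred_eq, key, Finset.coe_Ico, Set.mem_Ico]
  rw [departures, hset, Set.ncard_coe_finset, Nat.card_Ico, key]
  omega

theorem ae_eventually_numInSystem_eq [IsProbabilityMeasure P]
    (h : IsVacationQueueProcess Q P 𝓕 k N S V W) :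
    ∀ᵐ ω ∂P, ∀ t, ∀ᶠ s in 𝓝[≥] t, numInSystem k N S s ω = numInSystem k N S t ω := by
  filter_upwards [h.ae_completion_le_iff] with ω hω t
  have h1 : t < S (departures S t ω + 1) ω := by
    rw [← not_le, hω]
    omega
  filter_upwards [h.arrivals.eventually_eq ω t, self_mem_nhdsWithin,
    nhdsWithin_le_nhds (Iio_mem_nhds h1)] with s hs1 hs2 hs3
  have h2 : departures S s ω < departures S t ω + 1 := by
    rw [← not_le, ← hω]
    exact not_le.2 hs3
  have h3 : departures S t ω ≤ departures S s ω := by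
    rw [← hω]
    exact ((hω _ _).2 le_rfl).trans hs2
  rw [numInSystem_eq, numInSystem_eq, hs1, le_antisymm (Nat.lt_succ_iff.1 h2) h3]

theorem tendsto_measure_numInSystem [IsProbabilityMeasure P]
    (h : IsVacationQueueProcess Q P 𝓕 k N S V W) (j : ℤ) (t : ℝ≥0) :
    Tendsto (fun s => P.real {ω | numInSystem k N S s ω = j}) (𝓝[≥] t)
      (𝓝 (P.real {ω | numInSystem k N S t ω = j})) := by
  refine (ENNReal.tendsto_toReal (measure_ne_top _ _)).comp ?_
  refine tendsto_measure_of_ae_tendsto_indicator_of_isFiniteMeasure _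
    (h.measurableSet_numInSystem t j) (fun s => h.measurableSet_numInSystem s j) ?_
  filter_upwards [h.ae_eventually_numInSystem_eq] with ω hω
  filter_upwards [hω t] with s hs
  simp only [hs]

end IsVacationQueueProcess

/-! ### Riemann sums of right-continuous functions -/

theorem tendsto_div_two_pow (T : ℝ≥0) : Tendsto (fun p : ℕ => T / 2 ^ p) atTop (𝓝 0) := by
  have h := (NNReal.tendsto_pow_atTop_nhds_zero_of_lt_one
    (show (2⁻¹ : ℝ≥0) < 1 by rw [← NNReal.coe_lt_coe]; norm_num)).const_mul T
  rw [mul_zero] at h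
  refine h.congr fun p => ?_
  rw [inv_pow, div_eq_mul_inv]

theorem measurable_of_tendsto_nhdsGE {φ : ℝ≥0 → ℝ}
    (hφ : ∀ t, Tendsto φ (𝓝[≥] t) (𝓝 (φ t))) : Measurable φ := by
  refine measurable_of_tendsto_metrizable' (𝓝[>] (0 : ℝ≥0))
    (f := fun d t => φ (gridCeil d t)) (fun d => ?_) ?_
  · exact (measurable_from_nat (f := fun n : ℕ => φ (n * d))).comp
      (measurable_natCeil_div measurable_id d)
  · exact tendsto_pi_nhds.2 fun t => (hφ t).comp (tendsto_gridCeil t)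

theorem tendsto_riemannSum_of_tendsto_nhdsGE {φ : ℝ≥0 → ℝ}
    (hφ : ∀ t, Tendsto φ (𝓝[≥] t) (𝓝 (φ t))) (h0 : ∀ t, 0 ≤ φ t) (h1 : ∀ t, φ t ≤ 1)
    {T : ℝ≥0} (hT : 0 < T) :
    Tendsto (fun p : ℕ => ∑ m ∈ Finset.range (2 ^ p), φ (m * (T / 2 ^ p)) * (T / 2 ^ p : ℝ≥0))
      atTop (𝓝 (∫ t in (0 : ℝ)..T, φ t.toNNReal)) := by
  have hd : ∀ p : ℕ, 0 < T / 2 ^ p := fun p => by positivity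
  have hnorm : ∀ t, ‖φ t‖ ≤ 1 := fun t => by
    rw [Real.norm_eq_abs, abs_of_nonneg (h0 t)]
    exact h1 t
  have hd0 : Tendsto (fun p : ℕ => T / 2 ^ p) atTop (𝓝[>] 0) :=
    tendsto_nhdsWithin_iff.2 ⟨tendsto_div_two_pow T, Eventually.of_forall hd⟩
  have hstep : ∀ p : ℕ, Measurable fun t : ℝ => φ (gridCeil (T / 2 ^ p) t.toNNReal) := fun p =>
    ((measurable_from_nat (f := fun n : ℕ => φ (n * (T / 2 ^ p)))).comp
      (measurable_natCeil_div measurable_id (T / 2 ^ p))).comp measurable_real_toNNReal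
  have hint : ∀ (p : ℕ) (a b : ℝ),
      IntervalIntegrable (fun t : ℝ => φ (gridCeil (T / 2 ^ p) t.toNNReal)) volume a b :=
    fun p a b => (intervalIntegrable_const (c := (1 : ℝ))).mono_fun
      (hstep p).aestronglyMeasurable (ae_of_all _ fun t => by simpa using hnorm _)
  have hR : Tendsto (fun p : ℕ => ∫ t in (0 : ℝ)..T, φ (gridCeil (T / 2 ^ p) t.toNNReal)) atTop
      (𝓝 (∫ t in (0 : ℝ)..T, φ t.toNNReal)) := by
    refine intervalIntegral.tendsto_integral_filter_of_dominated_convergence (fun _ => 1)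
      (Eventually.of_forall fun p => (hstep p).aestronglyMeasurable)
      (Eventually.of_forall fun p => ae_of_all _ fun t _ => hnorm _)
      intervalIntegrable_const (ae_of_all _ fun t _ => ?_)
    exact (hφ _).comp ((tendsto_gridCeil _).comp hd0)
  have hsum : ∀ p : ℕ, ∫ t in (0 : ℝ)..T, φ (gridCeil (T / 2 ^ p) t.toNNReal) =
      ∑ m ∈ Finset.range (2 ^ p), φ ((m + 1 : ℕ) * (T / 2 ^ p)) * (T / 2 ^ p : ℝ≥0) := by
    intro p
    have h3 := intervalIntegral.sum_integral_adjacent_intervals (n := 2 ^ p)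
      (f := fun t : ℝ => φ (gridCeil (T / 2 ^ p) t.toNNReal)) (μ := volume)
      (a := fun m : ℕ => ((m * (T / 2 ^ p) : ℝ≥0) : ℝ)) (fun m _ => hint p _ _)
    have h4 : (((2 ^ p : ℕ) * (T / 2 ^ p) : ℝ≥0) : ℝ) = T := by
      push_cast
      field_simp
    simp only [Nat.cast_zero, zero_mul, NNReal.coe_zero] at h3
    rw [h4] at h3
    rw [← h3]
    refine Finset.sum_congr rfl fun m _ => ?_
    have hle : ((m * (T / 2 ^ p) : ℝ≥0) : ℝ) ≤ (((m + 1 : ℕ) * (T / 2 ^ p) : ℝ≥0) : ℝ) := by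
      rw [NNReal.coe_le_coe]
      gcongr
      omega
    have h5 : ∀ t ∈ Set.Ioc ((m * (T / 2 ^ p) : ℝ≥0) : ℝ) (((m + 1 : ℕ) * (T / 2 ^ p) : ℝ≥0) : ℝ),
        φ (gridCeil (T / 2 ^ p) t.toNNReal) = φ ((m + 1 : ℕ) * (T / 2 ^ p)) := by
      intro t ht
      have ht0 : 0 ≤ t := (NNReal.coe_nonneg _).trans ht.1.le
      lift t to ℝ≥0 using ht0
      simp only [Set.mem_Ioc, NNReal.coe_lt_coe, NNReal.coe_le_coe] at ht
      rw [Real.toNNReal_coe, gridCeil]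
      congr 2
      have : ⌈t / (T / 2 ^ p)⌉₊ = m + 1 := by
        rw [Nat.ceil_eq_iff (by omega), Nat.add_sub_cancel, lt_div_iff₀ (hd p),
          div_le_iff₀ (hd p)]
        exact ht
      exact_mod_cast this
    rw [intervalIntegral.integral_of_le hle, setIntegral_congr_fun measurableSet_Ioc h5,
      setIntegral_const, smul_eq_mul, mul_comm, Real.volume_real_Ioc_of_le hle]
    congr 1
    push_cast
    ring
  -- Right-continuity suits the values at right end points; the sums over left end points differ from
  -- these by a boundary term.
  have hdiff : Tendsto (fun p : ℕ => (φ 0 - φ T) * (T / 2 ^ p : ℝ≥0)) atTop (𝓝 0) := by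
    have := ((NNReal.tendsto_coe.2 (hd0.mono_right nhdsWithin_le_nhds)).const_mul (φ 0 - φ T))
    simpa using this
  have hfin := hR.add hdiff
  rw [add_zero] at hfin
  refine hfin.congr fun p => ?_
  rw [hsum p, ← Finset.sum_mul, ← Finset.sum_mul, ← add_mul]
  congr 1
  have h6 := Finset.sum_range_succ (fun m : ℕ => φ (m * (T / 2 ^ p))) (2 ^ p)
  have h7 := Finset.sum_range_succ' (fun m : ℕ => φ (m * (T / 2 ^ p))) (2 ^ p)
  have h8 : ((2 ^ p : ℕ) : ℝ≥0) * (T / 2 ^ p) = T := by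
    push_cast
    field_simp
  rw [h8] at h6
  simp only [Nat.cast_zero, zero_mul] at h7
  linarith

/-! ### Level crossings -/

theorem card_filter_downcrossing {ξ : ℕ → ℤ} {A j : ℤ} {D D' : ℕ} (hD : D ≤ D')
    (hξ : ∀ n ∈ Finset.Ioc D D', ξ n = A - n) :
    ((Finset.Ioc D D').filter fun n => ξ n = j).card + (if j < A - D' then 1 else 0) =
      if j < A - D then 1 else 0 := by
  have h1 : (Finset.Ioc D D').filter (fun n => ξ n = j) =
      (Finset.Ioc D D').filter fun n : ℕ => (n : ℤ) = A - j := by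
    refine Finset.filter_congr fun n hn => ?_
    rw [hξ n hn]
    omega
  rw [h1]
  by_cases hc : (D : ℤ) < A - j ∧ A - j ≤ D'
  · have h2 : (Finset.Ioc D D').filter (fun n : ℕ => (n : ℤ) = A - j) = {(A - j).toNat} := by
      ext n
      simp only [Finset.mem_filter, Finset.mem_Ioc, Finset.mem_singleton]
      omega
    rw [h2, Finset.card_singleton, if_neg (by omega), if_pos (by omega)]
  · have h2 : (Finset.Ioc D D').filter (fun n : ℕ => (n : ℤ) = A - j) = ∅ := by
      ext n
      simp only [Finset.mem_filter, Finset.mem_Ioc, Finset.notMem_empty, iff_false]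
      omega
    rw [h2, Finset.card_empty, zero_add]
    split_ifs <;> omega

/-- Upcrossings and downcrossings of the level between `j` and `j + 1`, for a queue observed at
times `0, 1, …, M`: `a m` customers have arrived and `D m` have departed by time `m`, at most one
arrives between consecutive times, and it does so before the departures between these times.
The upcrossings are the arrivals that find `j` customers, the downcrossings are the departures that
leave `j` customers behind. -/
theorem sum_upcrossing_add_eq {k : ℕ} {j : ℤ} {ξ : ℕ → ℤ} {a D : ℕ → ℕ} (hD : Monotone D)
    (ha : Monotone a) (h0 : a 0 = 0) (hξ0 : ∀ n ∈ Finset.Ioc 0 (D 0), ξ n = k - n) (M : ℕ)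
    (hone : ∀ m < M, a (m + 1) ≤ a m + 1)
    (hξ : ∀ m < M, ∀ n ∈ Finset.Ioc (D m) (D (m + 1)), ξ n = k + a (m + 1) - n) :
    ∑ m ∈ Finset.range M, (if (k : ℤ) + a m - D m = j then a (m + 1) - a m else 0) +
        (if j < k then 1 else 0) =
      ((Finset.Ioc 0 (D M)).filter fun n => ξ n = j).card +
        (if j < (k : ℤ) + a M - D M then 1 else 0) := by
  induction M with
  | zero =>
    have := card_filter_downcrossing (j := j) (Nat.zero_le (D 0)) hξ0
    simp only [Finset.range_zero, Finset.sum_empty, zero_add, h0, Nat.cast_zero, add_zero,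
      sub_zero] at this ⊢
    exact this.symm
  | succ M ih =>
    have ih' := ih (fun m hm => hone m (by omega)) fun m hm => hξ m (by omega)
    have hstep := card_filter_downcrossing (j := j) (D' := D (M + 1)) (hD M.le_succ)
      (hξ M (by omega))
    have hunion : (Finset.Ioc 0 (D (M + 1))).filter (fun n => ξ n = j) =
        (Finset.Ioc 0 (D M)).filter (fun n => ξ n = j) ∪
          (Finset.Ioc (D M) (D (M + 1))).filter fun n => ξ n = j := by
      rw [← Finset.filter_union, Finset.Ioc_union_Ioc_eq_Ioc (Nat.zero_le _) (hD M.le_succ)]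
    have hdisj : Disjoint ((Finset.Ioc 0 (D M)).filter fun n => ξ n = j)
        ((Finset.Ioc (D M) (D (M + 1))).filter fun n => ξ n = j) := by
      refine Finset.disjoint_filter_filter (Finset.disjoint_left.2 fun n h1 h2 => ?_)
      rw [Finset.mem_Ioc] at h1 h2
      omega
    rw [hunion, Finset.card_union_of_disjoint hdisj, Finset.sum_range_succ]
    have h1 := hone M (by omega)
    have h2 : a M ≤ a (M + 1) := ha M.le_succ
    have hup : (if (k : ℤ) + a M - D M = j then a (M + 1) - a M else 0) +
        (if j < (k : ℤ) + a M - D M then 1 else 0) =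
        if j < (k : ℤ) + a (M + 1) - D M then 1 else 0 := by
      rcases Nat.eq_or_lt_of_le h2 with h3 | h3
      · rw [← h3]
        split_ifs <;> simp
      · have h4 : a (M + 1) = a M + 1 := by omega
        rw [h4]
        push_cast
        split_ifs <;> omega
    omega

/-! ### Arrivals see time averages -/

namespace IsVacationQueueProcess

variable {Ω : Type*} {mΩ : MeasurableSpace Ω} {Q : VacationQueue} {P : Measure Ω}
  {𝓕 : Filtration ℝ≥0 mΩ} {k : ℕ} {N : ℝ≥0 → Ω → ℕ} {S V : ℕ → Ω → ℝ≥0} {W : ℕ → Set Ω}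

/-- Almost surely, every sufficiently fine dyadic cell of `[0, T]` contains at most one arrival. -/
theorem ae_eventually_arrivals_le_one [IsProbabilityMeasure P]
    (h : IsVacationQueueProcess Q P 𝓕 k N S V W) (T : ℝ≥0) :
    ∀ᵐ ω ∂P, ∀ᶠ p : ℕ in atTop, ∀ m < 2 ^ p,
      N ((m + 1 : ℕ) * (T / 2 ^ p)) ω ≤ N (m * (T / 2 ^ p)) ω + 1 := by
  set B : ℕ → ℕ → Set Ω := fun p m =>
    {ω | 2 ≤ N ((m + 1 : ℕ) * (T / 2 ^ p)) ω - N (m * (T / 2 ^ p)) ω} with hB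
  have hPB : ∀ p m, P (B p m) ≤ ENNReal.ofReal ((Q.arrivalRate * T) ^ 2 * ((1 / 2) ^ p) ^ 2) := by
    intro p m
    have hle : (m : ℝ≥0) * (T / 2 ^ p) ≤ (m + 1 : ℕ) * (T / 2 ^ p) := by
      gcongr
      omega
    have h1 := (h.arrivals.increment_law _ _ hle).measure_eq (p := fun l => 2 ≤ l)
      (MeasurableSet.of_discrete)
    have h2 : ((m + 1 : ℕ) : ℝ≥0) * (T / 2 ^ p) - m * (T / 2 ^ p) = T / 2 ^ p := by
      push_cast
      rw [add_mul, one_mul, add_tsub_cancel_left]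
    rw [h2] at h1
    rw [hB]
    refine h1.trans_le ((poissonMeasure_two_le_le _).trans (ENNReal.ofReal_le_ofReal ?_))
    push_cast
    refine le_of_eq ?_
    rw [one_div, inv_pow]
    field_simp
  have hsum : ∑' p : ℕ, P (⋃ m ∈ Finset.range (2 ^ p), B p m) ≠ ∞ := by
    have hg : Summable fun p : ℕ => ((Q.arrivalRate : ℝ) * T) ^ 2 * (1 / 2) ^ p :=
      (summable_geometric_of_lt_one (by norm_num) (by norm_num)).mul_left _
    refine ne_top_of_le_ne_top hg.tsum_ofReal_ne_top (ENNReal.tsum_le_tsum fun p => ?_)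
    refine (measure_biUnion_finset_le _ _).trans ((Finset.sum_le_sum fun m _ => hPB p m).trans ?_)
    rw [Finset.sum_const, Finset.card_range, nsmul_eq_mul, ← ENNReal.ofReal_natCast,
      ← ENNReal.ofReal_mul (by positivity)]
    refine ENNReal.ofReal_le_ofReal (le_of_eq ?_)
    push_cast
    rw [div_pow, one_pow]
    field_simp
  filter_upwards [ae_eventually_notMem hsum] with ω hω
  filter_upwards [hω] with p hp m hm
  simp only [Set.mem_iUnion, Finset.mem_range, hB, Set.mem_ofPred_eq, not_exists, not_le] at hp
  have := hp m hm
  omega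

/-- Almost surely, in every sufficiently fine dyadic cell of `[0, T]` no arrival follows a service
completion. -/
theorem ae_eventually_arrivals_eq [IsProbabilityMeasure P]
    (h : IsVacationQueueProcess Q P 𝓕 k N S V W) (T : ℝ≥0) :
    ∀ᵐ ω ∂P, ∀ᶠ p : ℕ in atTop, ∀ m : ℕ, m < 2 ^ p → ∀ n,
      m * (T / 2 ^ p) < S n ω → S n ω ≤ (m + 1 : ℕ) * (T / 2 ^ p) →
        N (S n ω) ω = N ((m + 1 : ℕ) * (T / 2 ^ p)) ω := by
  filter_upwards [h.ae_le_of_completion_le] with ω hω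
  have hn : ∀ n, ∀ᶠ p : ℕ in atTop, ∀ s, S n ω ≤ s → s ≤ S n ω + T / 2 ^ p →
      N s ω = N (S n ω) ω := by
    intro n
    obtain ⟨u, hu, hsub⟩ := mem_nhdsGE_iff_exists_Ico_subset.1 (h.arrivals.eventually_eq ω (S n ω))
    have h3 : Tendsto (fun p : ℕ => S n ω + T / 2 ^ p) atTop (𝓝 (S n ω)) := by
      simpa using (tendsto_div_two_pow T).const_add (S n ω)
    filter_upwards [h3.eventually_lt_const hu] with p hp s hs1 hs2
    exact hsub ⟨hs1, hs2.trans_lt hp⟩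
  filter_upwards [(Finset.eventually_all (Finset.range (k + N T ω + 1))).2 fun n _ => hn n]
    with p hp m hm n h1 h2
  have hT : ((m + 1 : ℕ) : ℝ≥0) * (T / 2 ^ p) ≤ T := by
    calc ((m + 1 : ℕ) : ℝ≥0) * (T / 2 ^ p) ≤ ((2 ^ p : ℕ) : ℝ≥0) * (T / 2 ^ p) := by
          gcongr
          omega
      _ = T := by
          push_cast
          field_simp
  refine (hp n ?_ _ h2 ?_).symm
  · rw [Finset.mem_range]
    have := hω n T (h2.trans hT)
    omega
  · push_cast
    rw [add_mul, one_mul]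
    gcongr

theorem lintegral_arrivals_indicator [IsProbabilityMeasure P]
    (h : IsVacationQueueProcess Q P 𝓕 k N S V W) (j : ℤ) {s t : ℝ≥0} (hst : s ≤ t) :
    ∫⁻ ω, {ω | numInSystem k N S s ω = j}.indicator 1 ω * ((N t ω - N s ω : ℕ) : ℝ≥0∞) ∂P =
      P {ω | numInSystem k N S s ω = j} * (Q.arrivalRate * (t - s : ℝ≥0)) := by
  have hmeas := (h.arrivals.measurable t).sub (h.arrivals.measurable s)
  rw [lintegral_mul_eq_lintegral_mul_lintegral_of_independent_measurableSpace (𝓕.le s)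
    hmeas.comap_le (h.arrivals.increment_indep s t hst).symm
    (f := {ω | numInSystem k N S s ω = j}.indicator 1)
    ((@measurable_const _ _ _ (𝓕 s) 1).indicator (h.adapted_numInSystem s j))
    (g := fun ω => ((N t ω - N s ω : ℕ) : ℝ≥0∞))
    ((measurable_from_top (f := fun n : ℕ => (n : ℝ≥0∞))).comp (comap_measurable _)),
    h.arrivals.lintegral_natCast hst, lintegral_indicator_one (h.measurableSet_numInSystem s j)]

/-- The expected number of departures up to time `T` that leave `j` customers behind differs by at
most `1` from `λ` times the expected time up to `T` during which `j` customers are present: the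
arrivals that find `j` customers see time averages, and they alternate with these departures. -/
theorem departures_vs_time [IsProbabilityMeasure P]
    (h : IsVacationQueueProcess Q P 𝓕 k N S V W) (j : ℤ) {T : ℝ≥0} (hT : 0 < T) :
    ∑' n : ℕ, P ({ω | S (n + 1) ω ≤ T} ∩ {ω | numAfterService k N S (n + 1) ω = j}) ≤
      ENNReal.ofReal (Q.arrivalRate * ∫ t in (0 : ℝ)..T,
        P.real {ω | numInSystem k N S t.toNNReal ω = j}) + 1 ∧
    ENNReal.ofReal (Q.arrivalRate * ∫ t in (0 : ℝ)..T,
        P.real {ω | numInSystem k N S t.toNNReal ω = j}) ≤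
      ∑' n : ℕ, P ({ω | S (n + 1) ω ≤ T} ∩ {ω | numAfterService k N S (n + 1) ω = j}) + 1 := by
  have hmn : ∀ n, MeasurableSet
      ({ω | S (n + 1) ω ≤ T} ∩ {ω | numAfterService k N S (n + 1) ω = j}) := fun n =>
    (h.measurableSet_completion_le (n + 1) T).inter
      (h.measurable_numAfterService (n + 1) (measurableSet_singleton j))
  set g : Ω → ℝ≥0∞ := fun ω => ∑' n : ℕ,
    ({ω | S (n + 1) ω ≤ T} ∩ {ω | numAfterService k N S (n + 1) ω = j}).indicator 1 ω with hg
  have hgint : ∑' n : ℕ, P ({ω | S (n + 1) ω ≤ T} ∩ {ω | numAfterService k N S (n + 1) ω = j}) =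
      ∫⁻ ω, g ω ∂P := by
    rw [hg, lintegral_tsum fun n => (measurable_one.indicator (hmn n)).aemeasurable]
    exact tsum_congr fun n => (lintegral_indicator_one (hmn n)).symm
  set U : ℕ → Ω → ℝ≥0∞ := fun p ω => ∑ m ∈ Finset.range (2 ^ p),
    {ω | numInSystem k N S (m * (T / 2 ^ p)) ω = j}.indicator 1 ω *
      ((N ((m + 1 : ℕ) * (T / 2 ^ p)) ω - N (m * (T / 2 ^ p)) ω : ℕ) : ℝ≥0∞) with hU
  have hle : ∀ p m : ℕ, (m : ℝ≥0) * (T / 2 ^ p) ≤ (m + 1 : ℕ) * (T / 2 ^ p) := fun p m => by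
    gcongr
    omega
  have hMT : ∀ p : ℕ, ((2 ^ p : ℕ) : ℝ≥0) * (T / 2 ^ p) = T := fun p => by
    push_cast
    field_simp
  have hterm : ∀ p m : ℕ, Measurable fun ω =>
      {ω | numInSystem k N S (m * (T / 2 ^ p)) ω = j}.indicator (1 : Ω → ℝ≥0∞) ω *
      ((N ((m + 1 : ℕ) * (T / 2 ^ p)) ω - N (m * (T / 2 ^ p)) ω : ℕ) : ℝ≥0∞) := fun p m =>
    (measurable_one.indicator (h.measurableSet_numInSystem _ j)).mul
      ((measurable_from_top (f := fun n : ℕ => (n : ℝ≥0∞))).comp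
        ((h.arrivals.measurable _).sub (h.arrivals.measurable _)))
  have hUm : ∀ p, Measurable (U p) := fun p => Finset.measurable_fun_sum _ fun m _ => hterm p m
  -- The expectation of the discretised number of upcrossings is a Riemann sum.
  have hUint : ∀ p, ∫⁻ ω, U p ω ∂P = ENNReal.ofReal (Q.arrivalRate *
      ∑ m ∈ Finset.range (2 ^ p), P.real {ω | numInSystem k N S (m * (T / 2 ^ p)) ω = j} *
        (T / 2 ^ p : ℝ≥0)) := by
    intro p
    rw [hU, lintegral_finsetSum _ fun m _ => hterm p m, Finset.mul_sum,
      ENNReal.ofReal_sum_of_nonneg fun m _ => by positivity]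
    refine Finset.sum_congr rfl fun m _ => ?_
    rw [h.lintegral_arrivals_indicator j (hle p m), ENNReal.ofReal_mul (by positivity),
      ENNReal.ofReal_mul (by positivity), ofReal_measureReal, ENNReal.ofReal_coe_nnreal,
      ENNReal.ofReal_coe_nnreal]
    have h2 : ((m + 1 : ℕ) : ℝ≥0) * (T / 2 ^ p) - m * (T / 2 ^ p) = T / 2 ^ p := by
      push_cast
      rw [add_mul, one_mul, add_tsub_cancel_left]
    rw [h2]
    ring
  have hUlim1 : Tendsto (fun p => ∫⁻ ω, U p ω ∂P) atTop (𝓝 (ENNReal.ofReal (Q.arrivalRate *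
      ∫ t in (0 : ℝ)..T, P.real {ω | numInSystem k N S t.toNNReal ω = j}))) := by
    simp_rw [hUint]
    exact ENNReal.tendsto_ofReal ((tendsto_riemannSum_of_tendsto_nhdsGE
      (h.tendsto_measure_numInSystem j) (fun t => measureReal_nonneg)
      (fun t => measureReal_le_one) hT).const_mul _)
  -- The upcrossings exceed the downcrossings by the change of the indicator of `L > j`.
  set f : Ω → ℝ≥0∞ := fun ω => g ω + (if j < numInSystem k N S T ω then 1 else 0) -
    (if j < (k : ℤ) then 1 else 0) with hf
  have hUlim2 : Tendsto (fun p => ∫⁻ ω, U p ω ∂P) atTop (𝓝 (∫⁻ ω, f ω ∂P)) := by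
    refine tendsto_lintegral_filter_of_dominated_convergence (fun ω => (N T ω : ℝ≥0∞))
      (Eventually.of_forall hUm) (Eventually.of_forall fun p => ae_of_all _ fun ω => ?_) ?_ ?_
    · calc U p ω ≤ ∑ m ∈ Finset.range (2 ^ p),
            ((N ((m + 1 : ℕ) * (T / 2 ^ p)) ω - N (m * (T / 2 ^ p)) ω : ℕ) : ℝ≥0∞) := by
            refine Finset.sum_le_sum fun m _ => ?_
            refine (mul_le_mul_left (Set.indicator_le_self' (by simp) ω) _).trans ?_
            simp
        _ = (N T ω : ℝ≥0∞) := by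
            have hmono : Monotone fun m : ℕ => N (m * (T / 2 ^ p)) ω :=
              monotone_nat_of_le_succ fun m => h.arrivals.mono ω (hle p m)
            have htel := Finset.sum_range_tsub hmono (2 ^ p)
            rw [← Nat.cast_sum, htel, hMT]
            simp [h.arrivals.zero]
    · rw [h.lintegral_arrivals T]
      finiteness
    · filter_upwards [h.ae_completion_le_iff, h.ae_eventually_arrivals_le_one T,
        h.ae_eventually_arrivals_eq T] with ω h1 h2 h3
      refine tendsto_const_nhds.congr' ?_
      filter_upwards [h2, h3] with p h4 h5
      have hDmono : Monotone fun m : ℕ => departures S (m * (T / 2 ^ p)) ω :=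
        monotone_nat_of_le_succ fun m => by
          rw [← h1]
          exact ((h1 _ _).2 le_rfl).trans (hle p m)
      have hNmono : Monotone fun m : ℕ => N (m * (T / 2 ^ p)) ω :=
        monotone_nat_of_le_succ fun m => h.arrivals.mono ω (hle p m)
      have key := sum_upcrossing_add_eq (k := k) (j := j)
        (ξ := fun n => numAfterService k N S n ω) hDmono hNmono
        (by simp [h.arrivals.zero]) (fun n hn => ?_) (2 ^ p) h4 (fun m hm n hn => ?_)
      · simp only [hMT] at key
        have hgω : g ω = (((Finset.Ioc 0 (departures S T ω)).filter
            fun n => numAfterService k N S n ω = j).card : ℝ≥0∞) := by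
          have hsub : ∀ n, ({ω | S (n + 1) ω ≤ T} ∩
              {ω | numAfterService k N S (n + 1) ω = j}).indicator (1 : Ω → ℝ≥0∞) ω =
              if n + 1 ∈ (Finset.Ioc 0 (departures S T ω)).filter
                fun n => numAfterService k N S n ω = j then 1 else 0 := fun n => by
            simp only [Set.indicator_apply, Set.mem_inter_iff, Set.mem_ofPred_eq, Pi.one_apply,
              Finset.mem_filter, Finset.mem_Ioc, h1, Nat.succ_pos, true_and]
          simp only [hg, hsub]
          have hz := tsum_eq_zero_add' (f := fun n : ℕ =>
            if n ∈ (Finset.Ioc 0 (departures S T ω)).filter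
                fun n => numAfterService k N S n ω = j then (1 : ℝ≥0∞) else 0) ENNReal.summable
          rw [if_neg (by simp), zero_add] at hz
          rw [← hz, tsum_eq_sum (s := (Finset.Ioc 0 (departures S T ω)).filter
                fun n => numAfterService k N S n ω = j) (fun n hn => if_neg hn),
            Finset.sum_ite_mem, Finset.inter_self]
          simp
        have hUω : U p ω = ((∑ m ∈ Finset.range (2 ^ p),
            (if (k : ℤ) + N (m * (T / 2 ^ p)) ω - departures S (m * (T / 2 ^ p)) ω = j then
              N ((m + 1 : ℕ) * (T / 2 ^ p)) ω - N (m * (T / 2 ^ p)) ω else 0) : ℕ) : ℝ≥0∞) := by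
          rw [Nat.cast_sum]
          refine Finset.sum_congr rfl fun m _ => ?_
          simp only [Set.indicator_apply, Set.mem_ofPred_eq, numInSystem_eq, Pi.one_apply]
          split_ifs <;> simp
        simp only [hf, hgω, hUω, numInSystem_eq]
        refine (ENNReal.eq_sub_of_add_eq (by split_ifs <;> simp) ?_).symm
        exact_mod_cast key
      · -- Services of length zero may end at time `0`, where no customer has arrived yet.
        rw [Finset.mem_Ioc, ← h1] at hn
        simp only [Nat.cast_zero, zero_mul, nonpos_iff_eq_zero] at hn
        simp [numAfterService, hn.2, h.arrivals.zero]
      · rw [Finset.mem_Ioc, ← h1, ← not_le, ← h1, not_le] at hn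
        simp only [numAfterService, h5 m hm n hn.1 hn.2]
  have heq := tendsto_nhds_unique hUlim1 hUlim2
  rw [heq, hgint]
  have hgf : ∀ ω, g ω ≤ f ω + 1 := fun ω => by
    simp only [hf]
    have h6 : g ω + (if j < numInSystem k N S T ω then 1 else 0) ≤
        g ω + (if j < numInSystem k N S T ω then 1 else 0) - (if j < (k : ℤ) then 1 else 0) +
          (if j < (k : ℤ) then 1 else 0) := le_tsub_add
    refine le_self_add.trans (h6.trans ?_)
    gcongr
    split_ifs <;> simp
  have hfg : ∀ ω, f ω ≤ g ω + 1 := fun ω => by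
    simp only [hf]
    refine tsub_le_self.trans ?_
    gcongr
    split_ifs <;> simp
  constructor
  · calc ∫⁻ ω, g ω ∂P ≤ ∫⁻ ω, (f ω + 1) ∂P := lintegral_mono hgf
      _ = _ := by rw [lintegral_add_right _ measurable_const]; simp
  · calc ∫⁻ ω, f ω ∂P ≤ ∫⁻ ω, (g ω + 1) ∂P := lintegral_mono hfg
      _ = _ := by rw [lintegral_add_right _ measurable_const]; simp

/-- The occupation counts at service completions determine the long-run time averages. -/
theorem abs_time_sub_occupation_le [IsProbabilityMeasure P]
    (h : IsVacationQueueProcess Q P 𝓕 k N S V W) (j : ℕ) {T : ℝ} (hT : 0 < T) :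
    |(Q.arrivalRate : ℝ) * (∫ t in (0 : ℝ)..T,
        P.real {ω | numInSystem k N S t.toNNReal ω = (j : ℤ)}) -
      (occupation P k N S T.toNNReal j).toReal| ≤ 2 := by
  lift T to ℝ≥0 using hT.le
  rw [Real.toNNReal_coe]
  obtain ⟨h1, h2⟩ := h.departures_vs_time (j : ℤ) (T := T) (by exact_mod_cast hT)
  set I : ℝ := ∫ t in (0 : ℝ)..T, P.real {ω | numInSystem k N S t.toNNReal ω = (j : ℤ)} with hI
  set G : ℝ≥0∞ := ∑' n : ℕ, P ({ω | S (n + 1) ω ≤ T} ∩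
    {ω | numAfterService k N S (n + 1) ω = (j : ℤ)}) with hG
  have hI0 : 0 ≤ (Q.arrivalRate : ℝ) * I :=
    mul_nonneg NNReal.zero_le_coe (intervalIntegral.integral_nonneg hT.le fun t _ =>
      measureReal_nonneg)
  have hO : occupation P k N S T j =
      P ({ω | S 0 ω ≤ T} ∩ {ω | numAfterService k N S 0 ω = (j : ℤ)}) + G := by
    rw [occupation, tsum_eq_zero_add' ENNReal.summable]
  have hGtop : G ≠ ∞ := ne_top_of_le_ne_top (by finiteness) h1
  have h3 : G.toReal ≤ Q.arrivalRate * I + 1 := by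
    have := ENNReal.toReal_mono (by finiteness) h1
    rwa [ENNReal.toReal_add (by finiteness) (by finiteness), ENNReal.toReal_ofReal hI0,
      ENNReal.toReal_one] at this
  have h4 : Q.arrivalRate * I ≤ G.toReal + 1 := by
    have := ENNReal.toReal_mono (by finiteness) h2
    rwa [ENNReal.toReal_add hGtop (by finiteness), ENNReal.toReal_ofReal hI0,
      ENNReal.toReal_one] at this
  rw [hO, ENNReal.toReal_add (by finiteness) hGtop]
  have h5 : (P ({ω | S 0 ω ≤ T} ∩ {ω | numAfterService k N S 0 ω = (j : ℤ)})).toReal ≤ 1 :=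
    measureReal_le_one
  have h6 := ENNReal.toReal_nonneg
    (a := P ({ω | S 0 ω ≤ T} ∩ {ω | numAfterService k N S 0 ω = (j : ℤ)}))
  rw [abs_le]
  constructor <;> linarith

end IsVacationQueueProcess

/-! ### Generating functions -/

/-- The generating function of a sequence of real numbers. -/
noncomputable def seqGenFun (c : ℕ → ℝ) (r : ℝ) : ℝ := ∑' m : ℕ, c m * r ^ m

theorem seqGenFun_zero (c : ℕ → ℝ) : seqGenFun c 0 = c 0 := by
  rw [seqGenFun, tsum_eq_single 0 (fun m hm => by simp [hm])]
  simp

theorem summable_mul_pow {c : ℕ → ℝ} (hc : Summable fun m => |c m|) {r : ℝ}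
    (hr : r ∈ Set.Icc (0 : ℝ) 1) : Summable fun m => c m * r ^ m := by
  refine Summable.of_norm_bounded hc fun m => ?_
  rw [norm_mul, Real.norm_eq_abs, norm_pow, Real.norm_eq_abs, abs_of_nonneg hr.1]
  exact mul_le_of_le_one_right (abs_nonneg _) (pow_le_one₀ hr.1 hr.2)

theorem continuousOn_seqGenFun {c : ℕ → ℝ} (hc : Summable fun m => |c m|) :
    ContinuousOn (seqGenFun c) (Set.Icc 0 1) := by
  refine continuousOn_tsum (fun m => by fun_prop) hc fun m r hr => ?_
  rw [norm_mul, Real.norm_eq_abs, norm_pow, Real.norm_eq_abs, abs_of_nonneg hr.1]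
  exact mul_le_of_le_one_right (abs_nonneg _) (pow_le_one₀ hr.1 hr.2)

/-- A summable sequence is determined by its generating function on `(0, 1)`. -/
theorem eq_zero_of_seqGenFun_eq_zero {d : ℕ → ℝ} (hd : Summable fun m => |d m|)
    (h : ∀ r ∈ Set.Ioo (0 : ℝ) 1, seqGenFun d r = 0) (n : ℕ) : d n = 0 := by
  induction n using Nat.strong_induction_on with
  | _ n ih =>
    have hs : Summable fun m => |d (m + n)| := (summable_nat_add_iff n).2 hd
    have hz : ∀ r ∈ Set.Ioo (0 : ℝ) 1, seqGenFun (fun m => d (m + n)) r = 0 := by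
      intro r hr
      have h1 := (summable_mul_pow hd ⟨hr.1.le, hr.2.le⟩).sum_add_tsum_nat_add n
      rw [Finset.sum_eq_zero fun m hm => by rw [ih m (Finset.mem_range.1 hm), zero_mul],
        zero_add] at h1
      have h2 : ∑' m, d (m + n) * r ^ (m + n) = r ^ n * seqGenFun (fun m => d (m + n)) r := by
        rw [seqGenFun, ← tsum_mul_left]
        exact tsum_congr fun m => by ring
      rw [h2] at h1
      have h3 := h r hr
      rw [seqGenFun, ← h1] at h3
      exact (mul_eq_zero.1 h3).resolve_left (pow_pos hr.1 n).ne'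
    have hcont := (continuousOn_seqGenFun hs) 0 ⟨le_rfl, zero_le_one⟩
    have hlim : Tendsto (seqGenFun fun m => d (m + n)) (𝓝[>] 0)
        (𝓝 (seqGenFun (fun m => d (m + n)) 0)) := by
      refine hcont.mono_left ?_
      rw [← nhdsWithin_Ioo_eq_nhdsGT (zero_lt_one (α := ℝ))]
      exact nhdsWithin_mono _ Set.Ioo_subset_Icc_self
    have hlim0 : Tendsto (seqGenFun fun m => d (m + n)) (𝓝[>] 0) (𝓝 0) := by
      refine tendsto_const_nhds.congr' ?_
      filter_upwards [Ioo_mem_nhdsGT (zero_lt_one (α := ℝ))] with r hr using (hz r hr).symm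
    have := tendsto_nhds_unique hlim hlim0
    rwa [seqGenFun_zero, zero_add] at this

theorem hasSum_toReal_pmf (p : PMF ℕ) : HasSum (fun m => (p m).toReal) 1 := by
  have := ENNReal.hasSum_toReal (f := p) (by rw [p.tsum_coe]; simp)
  rwa [← ENNReal.tsum_toReal_eq p.apply_ne_top, p.tsum_coe, ENNReal.toReal_one] at this

theorem summable_abs_toReal_pmf (p : PMF ℕ) : Summable fun m => |(p m).toReal| := by
  simpa using (hasSum_toReal_pmf p).summable

theorem genFun_zero (p : PMF ℕ) : genFun p 0 = (p 0).toReal := seqGenFun_zero _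

theorem genFun_one (p : PMF ℕ) : genFun p 1 = 1 := by
  simpa [genFun] using (hasSum_toReal_pmf p).tsum_eq

theorem continuousOn_genFun (p : PMF ℕ) : ContinuousOn (genFun p) (Set.Icc 0 1) :=
  continuousOn_seqGenFun (summable_abs_toReal_pmf p)

theorem genFun_nonneg (p : PMF ℕ) {r : ℝ} (hr : 0 ≤ r) : 0 ≤ genFun p r :=
  tsum_nonneg fun m => by positivity

theorem genFun_le_one (p : PMF ℕ) {r : ℝ} (hr : r ∈ Set.Icc (0 : ℝ) 1) : genFun p r ≤ 1 := by
  rw [← (hasSum_toReal_pmf p).tsum_eq]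
  refine (summable_mul_pow (summable_abs_toReal_pmf p) hr).tsum_le_tsum (fun m => ?_)
    (hasSum_toReal_pmf p).summable
  exact mul_le_of_le_one_right ENNReal.toReal_nonneg (pow_le_one₀ hr.1 hr.2)

theorem genFun_le_self_of_zero {p : PMF ℕ} (hp : p 0 = 0) {r : ℝ} (hr : r ∈ Set.Icc (0 : ℝ) 1) :
    genFun p r ≤ r := by
  have h1 : HasSum (fun m => (p m).toReal * r) r := by
    simpa using (hasSum_toReal_pmf p).mul_right r
  refine hasSum_le (fun m => ?_) (summable_mul_pow (summable_abs_toReal_pmf p) hr).hasSum h1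
  rcases m.eq_zero_or_pos with rfl | hm
  · simp [hp]
  · gcongr
    exact pow_le_of_le_one hr.1 hr.2 hm.ne'

theorem ofReal_genFun (p : PMF ℕ) {r : ℝ} (hr : r ∈ Set.Icc (0 : ℝ) 1) :
    ENNReal.ofReal (genFun p r) = ∑' m, p m * ENNReal.ofReal r ^ m := by
  rw [genFun, ENNReal.ofReal_tsum_of_nonneg (fun m => mul_nonneg ENNReal.toReal_nonneg
    (pow_nonneg hr.1 m)) (summable_mul_pow (summable_abs_toReal_pmf p) hr)]
  refine tsum_congr fun m => ?_
  rw [ENNReal.ofReal_mul ENNReal.toReal_nonneg, ENNReal.ofReal_toReal (p.apply_ne_top m),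
    ENNReal.ofReal_pow hr.1]

theorem hasSum_one_sub_genFun (p : PMF ℕ) {r : ℝ} (hr : r ∈ Set.Icc (0 : ℝ) 1) :
    HasSum (fun m => (p m).toReal * ((1 - r) * ∑ i ∈ Finset.range m, r ^ i)) (1 - genFun p r) := by
  have h1 := (hasSum_toReal_pmf p).sub
    (summable_mul_pow (summable_abs_toReal_pmf p) hr).hasSum
  refine h1.congr_fun fun m => ?_
  rw [mul_comm (1 - r), geom_sum_mul_neg]
  ring

theorem one_sub_genFun_le {p : PMF ℕ} (hp : Summable fun m => (p m).toReal * (m : ℝ)) {r : ℝ}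
    (hr : r ∈ Set.Icc (0 : ℝ) 1) : 1 - genFun p r ≤ (1 - r) * meanNat p := by
  have h1 := hp.hasSum.mul_left (1 - r)
  refine hasSum_le (fun m => ?_) (hasSum_one_sub_genFun p hr) h1
  have h2 : ∑ i ∈ Finset.range m, r ^ i ≤ m := by
    calc ∑ i ∈ Finset.range m, r ^ i ≤ ∑ i ∈ Finset.range m, (1 : ℝ) :=
          Finset.sum_le_sum fun i _ => pow_le_one₀ hr.1 hr.2
      _ = m := by simp
  have h3 : 0 ≤ 1 - r := sub_nonneg.2 hr.2
  calc (p m).toReal * ((1 - r) * ∑ i ∈ Finset.range m, r ^ i) ≤ (p m).toReal * ((1 - r) * m) := by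
        gcongr
    _ = _ := by ring

/-- The derivative of a generating function at `1` is the mean. -/
theorem tendsto_one_sub_genFun_div {p : PMF ℕ} (hp : Summable fun m => (p m).toReal * (m : ℝ)) :
    Tendsto (fun r => (1 - genFun p r) / (1 - r)) (𝓝[<] 1) (𝓝 (meanNat p)) := by
  have h1 : Tendsto (fun r : ℝ => ∑' m, (p m).toReal * ∑ i ∈ Finset.range m, r ^ i) (𝓝[<] 1)
      (𝓝 (∑' m, (p m).toReal * (m : ℝ))) := by
    refine tendsto_tsum_of_dominated_convergence hp (fun m => ?_) ?_
    · have hc : Continuous fun r : ℝ => (p m).toReal * ∑ i ∈ Finset.range m, r ^ i := by fun_prop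
      have := (hc.tendsto 1).mono_left (nhdsWithin_le_nhds (s := Set.Iio 1))
      simpa using this
    · filter_upwards [Ioo_mem_nhdsLT (zero_lt_one (α := ℝ))] with r hr m
      have h0 : 0 ≤ ∑ i ∈ Finset.range m, r ^ i :=
        Finset.sum_nonneg fun i _ => pow_nonneg hr.1.le i
      rw [norm_mul, Real.norm_eq_abs, Real.norm_eq_abs, abs_of_nonneg ENNReal.toReal_nonneg,
        abs_of_nonneg h0]
      gcongr
      calc ∑ i ∈ Finset.range m, r ^ i ≤ ∑ i ∈ Finset.range m, (1 : ℝ) :=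
            Finset.sum_le_sum fun i _ => pow_le_one₀ hr.1.le hr.2.le
        _ = m := by simp
  refine h1.congr' ?_
  filter_upwards [Ioo_mem_nhdsLT (zero_lt_one (α := ℝ))] with r hr
  have h2 := (hasSum_one_sub_genFun p ⟨hr.1.le, hr.2.le⟩).div_const (1 - r)
  rw [← h2.tsum_eq]
  refine tsum_congr fun m => ?_
  have : 1 - r ≠ 0 := (sub_pos.2 hr.2).ne'
  field_simp

theorem tsum_mul_natCast_ne_top_of_finiteSecondMoment {p : PMF ℕ} (hp : FiniteSecondMoment p) :
    ∑' m : ℕ, p m * (m : ℝ≥0∞) ≠ ∞ := by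
  refine ne_top_of_le_ne_top hp.ne (ENNReal.tsum_le_tsum fun m => ?_)
  gcongr
  norm_cast
  exact Nat.le_self_pow two_ne_zero m

theorem summable_mul_natCast_of_ne_top {p : PMF ℕ} (hp : ∑' m : ℕ, p m * (m : ℝ≥0∞) ≠ ∞) :
    Summable fun m => (p m).toReal * (m : ℝ) := by
  simpa using ENNReal.summable_toReal hp

theorem ofReal_meanNat {p : PMF ℕ} (hp : ∑' m : ℕ, p m * (m : ℝ≥0∞) ≠ ∞) :
    ENNReal.ofReal (meanNat p) = ∑' m : ℕ, p m * (m : ℝ≥0∞) := by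
  rw [meanNat, ENNReal.ofReal_tsum_of_nonneg (fun m => by positivity)
    (summable_mul_natCast_of_ne_top hp)]
  refine tsum_congr fun m => ?_
  rw [ENNReal.ofReal_mul ENNReal.toReal_nonneg, ENNReal.ofReal_toReal (p.apply_ne_top m),
    ENNReal.ofReal_natCast]

theorem meanNat_nonneg (p : PMF ℕ) : 0 ≤ meanNat p := tsum_nonneg fun m => by positivity

/-! ### Arrivals during a service -/

namespace VacationQueue

variable (Q : VacationQueue)

theorem lintegral_service_ne_top : ∫⁻ x, (x : ℝ≥0∞) ∂Q.serviceLaw ≠ ∞ := by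
  have := Q.isProbabilityMeasure_serviceLaw
  have h1 : ∫⁻ x, (1 + (x : ℝ≥0∞) ^ 2) ∂Q.serviceLaw ≠ ∞ := by
    rw [lintegral_add_left measurable_const]
    simp [Q.service_secondMoment.ne]
  refine ne_top_of_le_ne_top h1 (lintegral_mono fun x => ?_)
  rcases le_total x 1 with hx | hx
  · exact (ENNReal.coe_le_one_iff.2 hx).trans le_self_add
  · refine le_trans ?_ le_add_self
    rw [← ENNReal.coe_pow]
    exact ENNReal.coe_le_coe.2 (le_self_pow₀ hx two_ne_zero)

theorem tsum_serviceArrivals_mul_natCast :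
    ∑' l : ℕ, Q.serviceArrivals l * (l : ℝ≥0∞) = ENNReal.ofReal Q.load := by
  simp_rw [Q.serviceArrivals_apply]
  have hm := fun l => (continuous_poissonMeasure_singleton Q.arrivalRate l).measurable
  rw [tsum_congr fun l : ℕ => (lintegral_mul_const (l : ℝ≥0∞) (hm l)).symm]
  rw [← lintegral_tsum fun l => ((hm l).mul_const _).aemeasurable]
  simp_rw [tsum_poissonMeasure_mul_natCast, ENNReal.coe_mul]
  rw [lintegral_const_mul _ (by fun_prop), load, ENNReal.ofReal_mul (by positivity),
    ENNReal.ofReal_coe_nnreal]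
  congr 1
  have h2 : ∫ x, (x : ℝ) ∂Q.serviceLaw = (∫⁻ x, (x : ℝ≥0∞) ∂Q.serviceLaw).toReal := by
    rw [integral_eq_lintegral_of_nonneg_ae (ae_of_all _ fun x => x.2) (by fun_prop)]
    simp
  rw [h2, ENNReal.ofReal_toReal Q.lintegral_service_ne_top]

theorem load_nonneg : 0 ≤ Q.load :=
  mul_nonneg NNReal.zero_le_coe (integral_nonneg fun x => x.2)

theorem tsum_serviceArrivals_ne_top : ∑' l : ℕ, Q.serviceArrivals l * (l : ℝ≥0∞) ≠ ∞ := by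
  rw [Q.tsum_serviceArrivals_mul_natCast]
  exact ENNReal.ofReal_ne_top

theorem meanNat_serviceArrivals : meanNat Q.serviceArrivals = Q.load := by
  have h1 := ofReal_meanNat Q.tsum_serviceArrivals_ne_top
  rw [Q.tsum_serviceArrivals_mul_natCast] at h1
  exact (ENNReal.ofReal_eq_ofReal_iff (meanNat_nonneg _) Q.load_nonneg).1 h1

theorem genFun_serviceArrivals {r : ℝ} (hr : r ∈ Set.Icc (0 : ℝ) 1) :
    genFun Q.serviceArrivals r = Q.serviceArrivalsGF r := by
  have h0 : 0 ≤ Q.serviceArrivalsGF r := integral_nonneg fun x => (Real.exp_pos _).le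
  rw [← ENNReal.ofReal_eq_ofReal_iff (genFun_nonneg _ hr.1) h0, ofReal_genFun _ hr]
  simp_rw [Q.serviceArrivals_apply]
  have hm := fun l => (continuous_poissonMeasure_singleton Q.arrivalRate l).measurable
  rw [tsum_congr fun l : ℕ => (lintegral_mul_const (ENNReal.ofReal r ^ l) (hm l)).symm]
  rw [← lintegral_tsum fun l => ((hm l).mul_const _).aemeasurable]
  simp_rw [tsum_poissonMeasure_mul_pow _ hr.1]
  have := Q.isProbabilityMeasure_serviceLaw
  rw [serviceArrivalsGF, serviceLST, ofReal_integral_eq_lintegral_ofReal]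
  · refine lintegral_congr fun x => ?_
    congr 2
    push_cast
    ring
  · refine (integrable_const (1 : ℝ)).mono' (by fun_prop) (ae_of_all _ fun x => ?_)
    rw [Real.norm_eq_abs, Real.abs_exp]
    refine Real.exp_le_one_iff.2 ?_
    have h3 : 0 ≤ (Q.arrivalRate : ℝ) * (1 - r) * x :=
      mul_nonneg (mul_nonneg NNReal.zero_le_coe (sub_nonneg.2 hr.2)) x.2
    linarith
  · exact ae_of_all _ fun x => (Real.exp_pos _).le

theorem continuousOn_serviceArrivalsGF : ContinuousOn Q.serviceArrivalsGF (Set.Icc 0 1) :=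
  (continuousOn_genFun Q.serviceArrivals).congr fun _ hr => (Q.genFun_serviceArrivals hr).symm

theorem serviceArrivalsGF_le_one {r : ℝ} (hr : r ∈ Set.Icc (0 : ℝ) 1) :
    Q.serviceArrivalsGF r ≤ 1 := by
  rw [← Q.genFun_serviceArrivals hr]
  exact genFun_le_one _ hr

theorem one_sub_serviceArrivalsGF_le {r : ℝ} (hr : r ∈ Set.Icc (0 : ℝ) 1) :
    1 - Q.serviceArrivalsGF r ≤ (1 - r) * Q.load := by
  rw [← Q.genFun_serviceArrivals hr, ← Q.meanNat_serviceArrivals]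
  exact one_sub_genFun_le (summable_mul_natCast_of_ne_top Q.tsum_serviceArrivals_ne_top) hr

/-- In a stable queue `h(r) - r` vanishes at `r = 1` only, and to first order there. -/
theorem mul_one_sub_le_serviceArrivalsGF_sub {r : ℝ} (hr : r ∈ Set.Icc (0 : ℝ) 1) :
    (1 - Q.load) * (1 - r) ≤ Q.serviceArrivalsGF r - r := by
  have := Q.one_sub_serviceArrivalsGF_le hr
  linarith

theorem serviceArrivalsGF_pos (hQ : Q.load < 1) {r : ℝ} (hr : r ∈ Set.Icc (0 : ℝ) 1) :
    0 < Q.serviceArrivalsGF r := by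
  have h1 := Q.one_sub_serviceArrivalsGF_le hr
  have h2 : (1 - r) * Q.load ≤ 1 * Q.load :=
    mul_le_mul_of_nonneg_right (by linarith [hr.1]) Q.load_nonneg
  linarith

theorem serviceArrivalsGF_sub_pos (hQ : Q.load < 1) {r : ℝ} (h0 : 0 ≤ r) (h1 : r < 1) :
    0 < Q.serviceArrivalsGF r - r :=
  (mul_pos (sub_pos.2 hQ) (sub_pos.2 h1)).trans_le
    (Q.mul_one_sub_le_serviceArrivalsGF_sub ⟨h0, h1.le⟩)

theorem tendsto_serviceArrivalsGF_sub_div :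
    Tendsto (fun r => (Q.serviceArrivalsGF r - r) / (1 - r)) (𝓝[<] 1) (𝓝 (1 - Q.load)) := by
  have h1 := (tendsto_one_sub_genFun_div
    (summable_mul_natCast_of_ne_top Q.tsum_serviceArrivals_ne_top)).const_sub 1
  rw [Q.meanNat_serviceArrivals] at h1
  refine h1.congr' ?_
  filter_upwards [Ioo_mem_nhdsLT (zero_lt_one (α := ℝ))] with r hr
  rw [Q.genFun_serviceArrivals ⟨hr.1.le, hr.2.le⟩]
  have : 1 - r ≠ 0 := (sub_pos.2 hr.2).ne'
  field_simp
  ring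

theorem tendsto_serviceArrivalsGF_one : Tendsto Q.serviceArrivalsGF (𝓝[<] 1) (𝓝 1) := by
  have h1 : Tendsto Q.serviceArrivalsGF (𝓝[Set.Icc 0 1] 1) (𝓝 (Q.serviceArrivalsGF 1)) :=
    Q.continuousOn_serviceArrivalsGF 1 ⟨zero_le_one, le_rfl⟩
  rw [← Q.genFun_serviceArrivals ⟨zero_le_one, le_rfl⟩, genFun_one] at h1
  refine h1.mono_left ?_
  rw [← nhdsWithin_Ioo_eq_nhdsLT (zero_lt_one (α := ℝ))]
  exact nhdsWithin_mono _ Set.Ioo_subset_Icc_self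

end VacationQueue

/-! ### The functional equation of the stationary generating function -/

theorem tendsto_seqGenFun_one {c : ℕ → ℝ} (hc : Summable fun m => |c m|) :
    Tendsto (seqGenFun c) (𝓝[<] 1) (𝓝 (seqGenFun c 1)) := by
  refine (continuousOn_seqGenFun hc 1 ⟨zero_le_one, le_rfl⟩).mono_left ?_
  rw [← nhdsWithin_Ioo_eq_nhdsLT (zero_lt_one (α := ℝ))]
  exact nhdsWithin_mono _ Set.Ioo_subset_Icc_self

theorem tendsto_pow_mul_of_continuousOn {F : ℝ → ℝ} {s : Set ℝ} (hF : ContinuousOn F s)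
    (hs : Set.Ico 0 1 ⊆ s) {a r : ℝ} (ha0 : 0 ≤ a) (ha1 : a < 1) (hr : 0 ≤ r) :
    Tendsto (fun i : ℕ => F (a ^ i * r)) atTop (𝓝 (F 0)) := by
  have h1 : Tendsto (fun i : ℕ => a ^ i * r) atTop (𝓝 0) := by
    simpa using (tendsto_pow_atTop_nhds_zero_of_lt_one ha0 ha1).mul_const r
  refine Tendsto.comp (hF 0 (hs ⟨le_rfl, zero_lt_one⟩)) (tendsto_nhdsWithin_iff.2 ⟨h1, ?_⟩)
  filter_upwards [h1.eventually_lt_const zero_lt_one] with i hi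
  exact hs ⟨by positivity, hi⟩

namespace VacationQueue

variable {Q : VacationQueue} {X : PMF ℕ}

theorem Y_of_ne_one {r : ℝ} (hr : r ≠ 1) :
    Q.Y X r = Q.serviceArrivalsGF r * (1 - genFun X r) / (Q.serviceArrivalsGF r - r) := if_neg hr

theorem Y_one : Q.Y X 1 = meanNat X / (1 - Q.load) := if_pos rfl

theorem K_of_ne_one {r : ℝ} (hr : r ≠ 1) :
    Q.K X r = Q.serviceArrivalsGF r * (genFun X r - genFun (Q.vacArrivals 0) r) /
      (Q.serviceArrivalsGF r - r) := if_neg hr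

theorem K_one : Q.K X 1 = (meanNat (Q.vacArrivals 0) - meanNat X) / (1 - Q.load) := if_pos rfl

theorem continuousOn_Y (hQ : Q.load < 1) : ContinuousOn (Q.Y X) (Set.Ico 0 1) := by
  have hsub : Set.Ico (0 : ℝ) 1 ⊆ Set.Icc 0 1 := Set.Ico_subset_Icc_self
  refine ContinuousOn.congr (f := fun r => Q.serviceArrivalsGF r * (1 - genFun X r) /
    (Q.serviceArrivalsGF r - r)) ?_ fun r hr => Y_of_ne_one hr.2.ne
  have h1 := Q.continuousOn_serviceArrivalsGF.mono hsub
  have h2 := (continuousOn_genFun X).mono hsub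
  exact (h1.mul (continuousOn_const.sub h2)).div (h1.sub continuousOn_id) fun r hr =>
    (Q.serviceArrivalsGF_sub_pos hQ hr.1 hr.2).ne'

theorem continuousOn_K (hQ : Q.load < 1) : ContinuousOn (Q.K X) (Set.Ico 0 1) := by
  have hsub : Set.Ico (0 : ℝ) 1 ⊆ Set.Icc 0 1 := Set.Ico_subset_Icc_self
  refine ContinuousOn.congr (f := fun r => Q.serviceArrivalsGF r *
    (genFun X r - genFun (Q.vacArrivals 0) r) / (Q.serviceArrivalsGF r - r)) ?_
    fun r hr => K_of_ne_one hr.2.ne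
  have h1 := Q.continuousOn_serviceArrivalsGF.mono hsub
  have h2 := (continuousOn_genFun X).mono hsub
  have h3 := (continuousOn_genFun (Q.vacArrivals 0)).mono hsub
  exact (h1.mul (h2.sub h3)).div (h1.sub continuousOn_id) fun r hr =>
    (Q.serviceArrivalsGF_sub_pos hQ hr.1 hr.2).ne'

theorem Y_zero (hQ : Q.load < 1) : Q.Y X 0 = 1 - (X 0).toReal := by
  have := Q.serviceArrivalsGF_pos hQ (r := 0) ⟨le_rfl, zero_le_one⟩
  rw [Y_of_ne_one zero_ne_one, genFun_zero, sub_zero]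
  field_simp

theorem tendsto_Y_one (hQ : Q.load < 1) (hX : Summable fun m => (X m).toReal * (m : ℝ)) :
    Tendsto (Q.Y X) (𝓝[<] 1) (𝓝 (Q.Y X 1)) := by
  have h1 := (Q.tendsto_serviceArrivalsGF_one.mul (tendsto_one_sub_genFun_div hX)).div
    Q.tendsto_serviceArrivalsGF_sub_div (sub_pos.2 hQ).ne'
  rw [one_mul, ← Y_one] at h1
  refine h1.congr' ?_
  filter_upwards [Ioo_mem_nhdsLT (zero_lt_one (α := ℝ))] with r hr
  have h2 : 1 - r ≠ 0 := (sub_pos.2 hr.2).ne'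
  have h3 := (Q.serviceArrivalsGF_sub_pos hQ hr.1.le hr.2).ne'
  rw [Y_of_ne_one hr.2.ne, Pi.div_apply]
  field_simp

theorem tendsto_K_one (hQ : Q.load < 1) (hX : Summable fun m => (X m).toReal * (m : ℝ))
    (hX0 : Summable fun m => (Q.vacArrivals 0 m).toReal * (m : ℝ)) :
    Tendsto (Q.K X) (𝓝[<] 1) (𝓝 (Q.K X 1)) := by
  have h1 := (Q.tendsto_serviceArrivalsGF_one.mul
    ((tendsto_one_sub_genFun_div hX0).sub (tendsto_one_sub_genFun_div hX))).div
    Q.tendsto_serviceArrivalsGF_sub_div (sub_pos.2 hQ).ne'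
  rw [one_mul, ← K_one] at h1
  refine h1.congr' ?_
  filter_upwards [Ioo_mem_nhdsLT (zero_lt_one (α := ℝ))] with r hr
  have h2 : 1 - r ≠ 0 := (sub_pos.2 hr.2).ne'
  have h3 := (Q.serviceArrivalsGF_sub_pos hQ hr.1.le hr.2).ne'
  rw [K_of_ne_one hr.2.ne, Pi.div_apply]
  field_simp
  ring

/-- What is known about a limit `c` of the normalised occupation counts before it has been
identified: `c` is a subprobability that is invariant for the Markov chain of the numbers of
customers left behind at service completions (`balance`, in terms of generating functions), and it
accounts for all arrivals (`mass`), so that no mass is lost in the limit. -/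
structure IsStationarySequence (Q : VacationQueue) (X : PMF ℕ) (a : ℝ) (c : ℕ → ℝ) : Prop where
  nonneg : ∀ i, 0 ≤ c i
  summable : Summable c
  tsum_le_one : ∑' i, c i ≤ 1
  balance : ∀ r ∈ Set.Ico (0 : ℝ) 1, (Q.serviceArrivalsGF r - r) * seqGenFun c r =
    Q.serviceArrivalsGF r * ((1 - genFun X r) * seqGenFun c (a * r) +
      (genFun X r - genFun (Q.vacArrivals 0) r) * c 0)
  mass : 1 - Q.load ≤ meanNat X * seqGenFun c a + (meanNat (Q.vacArrivals 0) - meanNat X) * c 0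

namespace IsStationarySequence

variable {a : ℝ} {c : ℕ → ℝ}

theorem summable_abs (hc : IsStationarySequence Q X a c) : Summable fun i => |c i| := by
  simpa only [abs_of_nonneg (hc.nonneg _)] using hc.summable

theorem recursion (hc : IsStationarySequence Q X a c) (ha0 : 0 ≤ a) (ha1 : a < 1)
    (hQ : Q.load < 1) (hX : Summable fun m => (X m).toReal * (m : ℝ))
    (hX0 : Summable fun m => (Q.vacArrivals 0 m).toReal * (m : ℝ)) {r : ℝ}
    (hr : r ∈ Set.Icc (0 : ℝ) 1) :
    seqGenFun c r = Q.Y X r * seqGenFun c (a * r) + Q.K X r * c 0 := by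
  have hlt : ∀ r ∈ Set.Ico (0 : ℝ) 1,
      seqGenFun c r = Q.Y X r * seqGenFun c (a * r) + Q.K X r * c 0 := by
    intro r hr
    have h1 := (Q.serviceArrivalsGF_sub_pos hQ hr.1 hr.2).ne'
    have h2 := hc.balance r hr
    rw [Y_of_ne_one hr.2.ne, K_of_ne_one hr.2.ne, div_mul_eq_mul_div, div_mul_eq_mul_div,
      ← add_div, eq_div_iff h1]
    linarith
  rcases hr.2.lt_or_eq with h1 | rfl
  · exact hlt r ⟨hr.1, h1⟩
  · -- At `r = 1`, where `Y` and `K` are defined by their limits, all terms are continuous.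
    have hleft := tendsto_seqGenFun_one hc.summable_abs
    have hga : Tendsto (fun r => seqGenFun c (a * r)) (𝓝[<] 1) (𝓝 (seqGenFun c (a * 1))) := by
      have h2 : ContinuousOn (fun r => seqGenFun c (a * r)) (Set.Icc 0 1) :=
        (continuousOn_seqGenFun hc.summable_abs).comp (by fun_prop) fun r hr =>
          ⟨mul_nonneg ha0 hr.1, mul_le_one₀ ha1.le hr.1 hr.2⟩
      refine (h2 1 ⟨zero_le_one, le_rfl⟩).mono_left ?_
      rw [← nhdsWithin_Ioo_eq_nhdsLT (zero_lt_one (α := ℝ))]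
      exact nhdsWithin_mono _ Set.Ioo_subset_Icc_self
    have hright := ((tendsto_Y_one hQ hX).mul hga).add ((tendsto_K_one hQ hX hX0).mul_const (c 0))
    refine tendsto_nhds_unique hleft (hright.congr' ?_)
    filter_upwards [Ioo_mem_nhdsLT (zero_lt_one (α := ℝ))] with r hr
    exact (hlt r ⟨hr.1.le, hr.2⟩).symm

/-- No mass is lost: the left limit at `1` of the functional equation turns the inequality `mass`
into `1 ≤ ∑ c i`. -/
theorem seqGenFun_one (hc : IsStationarySequence Q X a c) (ha0 : 0 ≤ a) (ha1 : a < 1)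
    (hQ : Q.load < 1) (hX : Summable fun m => (X m).toReal * (m : ℝ))
    (hX0 : Summable fun m => (Q.vacArrivals 0 m).toReal * (m : ℝ)) : seqGenFun c 1 = 1 := by
  have h1 : seqGenFun c 1 = ∑' i, c i := by simp [seqGenFun]
  refine le_antisymm (h1.trans_le hc.tsum_le_one) ?_
  rw [hc.recursion ha0 ha1 hQ hX hX0 ⟨zero_le_one, le_rfl⟩, Y_one, K_one, mul_one]
  have h2 : 0 < 1 - Q.load := sub_pos.2 hQ
  calc (1 : ℝ) = (1 - Q.load) / (1 - Q.load) := (div_self h2.ne').symm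
    _ ≤ (meanNat X * seqGenFun c a + (meanNat (Q.vacArrivals 0) - meanNat X) * c 0) /
        (1 - Q.load) := by
          gcongr
          exact hc.mass
    _ = _ := by ring

theorem iterate (hc : IsStationarySequence Q X a c) (ha0 : 0 ≤ a) (ha1 : a < 1)
    (hQ : Q.load < 1) (hX : Summable fun m => (X m).toReal * (m : ℝ))
    (hX0 : Summable fun m => (Q.vacArrivals 0 m).toReal * (m : ℝ)) {r : ℝ}
    (hr : r ∈ Set.Icc (0 : ℝ) 1) (n : ℕ) :
    seqGenFun c r = (∏ i ∈ Finset.range n, Q.Y X (a ^ i * r)) * seqGenFun c (a ^ n * r) +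
      (∑ j ∈ Finset.range n, Q.K X (a ^ j * r) * ∏ i ∈ Finset.range j, Q.Y X (a ^ i * r)) *
        c 0 := by
  induction n with
  | zero => simp
  | succ n ih =>
    have hmem : a ^ n * r ∈ Set.Icc (0 : ℝ) 1 :=
      ⟨mul_nonneg (pow_nonneg ha0 n) hr.1, mul_le_one₀ (pow_le_one₀ ha0 ha1.le) hr.1 hr.2⟩
    rw [ih, hc.recursion ha0 ha1 hQ hX hX0 hmem, Finset.prod_range_succ, Finset.sum_range_succ,
      ← mul_assoc a, ← pow_succ']
    ring

end IsStationarySequence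

/-! ### Convergence of the products and series -/

/-- When `P(X = 0) = 0`, the factors `Y(a ^ i r)` tend to `Y(0) = 1` geometrically fast. -/
theorem Y_sub_one_le {a s : ℝ} (ha1 : a < 1) (hQ : Q.load < 1) (hX : X 0 = 0) (hs0 : 0 ≤ s)
    (hsa : s ≤ a) : |Q.Y X s - 1| ≤ 2 / ((1 - Q.load) * (1 - a)) * s := by
  have hs1 : s < 1 := hsa.trans_lt ha1
  have hs : s ∈ Set.Icc (0 : ℝ) 1 := ⟨hs0, hs1.le⟩
  have h1 := Q.serviceArrivalsGF_sub_pos hQ hs0 hs1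
  have h2 : Q.Y X s - 1 = (s - Q.serviceArrivalsGF s * genFun X s) /
      (Q.serviceArrivalsGF s - s) := by
    rw [Y_of_ne_one hs1.ne]
    field_simp
    ring
  have h3 : (1 - Q.load) * (1 - a) ≤ Q.serviceArrivalsGF s - s := by
    refine le_trans ?_ (Q.mul_one_sub_le_serviceArrivalsGF_sub hs)
    have := sub_pos.2 hQ
    gcongr
  have h4 : 0 < (1 - Q.load) * (1 - a) := mul_pos (sub_pos.2 hQ) (sub_pos.2 ha1)
  have h5 : 0 ≤ Q.serviceArrivalsGF s * genFun X s :=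
    mul_nonneg (Q.serviceArrivalsGF_pos hQ hs).le (genFun_nonneg X hs0)
  have h6 : Q.serviceArrivalsGF s * genFun X s ≤ s :=
    (mul_le_of_le_one_left (genFun_nonneg X hs0) (Q.serviceArrivalsGF_le_one hs)).trans
      (genFun_le_self_of_zero hX hs)
  rw [h2, abs_div, abs_of_pos h1]
  calc |s - Q.serviceArrivalsGF s * genFun X s| / (Q.serviceArrivalsGF s - s)
      ≤ (2 * s) / ((1 - Q.load) * (1 - a)) := by
        gcongr
        rw [abs_le]
        constructor <;> linarith
    _ = _ := by ring

theorem multipliable_Y {a : ℝ} (ha0 : 0 ≤ a) (ha1 : a < 1) (hQ : Q.load < 1) (hX : X 0 = 0)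
    {r : ℝ} (hr : r ∈ Set.Icc (0 : ℝ) 1) : Multipliable fun i : ℕ => Q.Y X (a ^ i * r) := by
  have h1 : Summable fun i : ℕ => ‖Q.Y X (a ^ i * r) - 1‖ := by
    -- The factor with `i = 0` is left out, because its argument `r` may be `1`.
    rw [← summable_nat_add_iff 1]
    refine Summable.of_nonneg_of_le (fun i => norm_nonneg _) (fun i => ?_)
      (((summable_geometric_of_lt_one ha0 ha1).mul_right (a * r)).mul_left
        (2 / ((1 - Q.load) * (1 - a))))
    have h2 : a ^ (i + 1) * r = a ^ i * (a * r) := by ring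
    have h3 : a * r ≤ a := mul_le_of_le_one_right ha0 hr.2
    have h4 : 0 ≤ a * r := mul_nonneg ha0 hr.1
    rw [Real.norm_eq_abs, h2]
    exact Y_sub_one_le ha1 hQ hX (mul_nonneg (pow_nonneg ha0 i) h4)
      ((mul_le_of_le_one_left h4 (pow_le_one₀ ha0 ha1.le)).trans h3)
  simpa using multipliable_one_add_of_summable h1

theorem summable_prod_Y {a : ℝ} (ha0 : 0 ≤ a) (ha1 : a < 1) (hQ : Q.load < 1) (hX : 0 < X 0)
    {r : ℝ} (hr : r ∈ Set.Icc (0 : ℝ) 1) :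
    Summable fun j : ℕ => ∏ i ∈ Finset.range j, Q.Y X (a ^ i * r) := by
  have hpos : 0 < (X 0).toReal := ENNReal.toReal_pos hX.ne' (X.apply_ne_top 0)
  have hle : (X 0).toReal ≤ 1 := ENNReal.toReal_le_of_le_ofReal zero_le_one
    (by simpa using X.coe_le_one 0)
  have h1 := (tendsto_pow_mul_of_continuousOn (continuousOn_Y (X := X) hQ) subset_rfl ha0 ha1
    hr.1).norm
  rw [Y_zero hQ, Real.norm_eq_abs, abs_of_nonneg (sub_nonneg.2 hle)] at h1
  -- The factors tend to `Y(0) = 1 - P(X = 0) < 1`.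
  refine summable_of_ratio_norm_eventually_le (r := 1 - (X 0).toReal / 2) (by linarith) ?_
  filter_upwards [h1.eventually_le_const (u := 1 - (X 0).toReal / 2) (by linarith)] with n hn
  rw [Finset.prod_range_succ, norm_mul, mul_comm]
  gcongr

theorem summable_K_mul_prod_Y {a : ℝ} (ha0 : 0 ≤ a) (ha1 : a < 1) (hQ : Q.load < 1)
    (hX : 0 < X 0) {r : ℝ} (hr : r ∈ Set.Icc (0 : ℝ) 1) :
    Summable fun j : ℕ => Q.K X (a ^ j * r) * ∏ i ∈ Finset.range j, Q.Y X (a ^ i * r) := by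
  have h1 := (tendsto_pow_mul_of_continuousOn (continuousOn_K (X := X) hQ) subset_rfl ha0 ha1
    hr.1).norm
  refine Summable.of_norm_bounded_eventually_nat
    ((summable_prod_Y ha0 ha1 hQ hX hr).norm.mul_left (‖Q.K X 0‖ + 1)) ?_
  filter_upwards [h1.eventually_le_const (u := ‖Q.K X 0‖ + 1) (by linarith)] with n hn
  rw [norm_mul]
  gcongr

namespace IsStationarySequence

variable {a : ℝ} {c : ℕ → ℝ}

theorem tendsto_seqGenFun_pow (hc : IsStationarySequence Q X a c) (ha0 : 0 ≤ a) (ha1 : a < 1)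
    {r : ℝ} (hr : 0 ≤ r) : Tendsto (fun n : ℕ => seqGenFun c (a ^ n * r)) atTop (𝓝 (c 0)) := by
  have := tendsto_pow_mul_of_continuousOn (continuousOn_seqGenFun hc.summable_abs)
    Set.Ico_subset_Icc_self ha0 ha1 hr
  rwa [seqGenFun_zero] at this

theorem eq_tprod (hc : IsStationarySequence Q X a c) (ha0 : 0 ≤ a) (ha1 : a < 1)
    (hQ : Q.load < 1) (hX : Summable fun m => (X m).toReal * (m : ℝ))
    (hX0 : Q.vacArrivals 0 = X) {r : ℝ} (hr : r ∈ Set.Icc (0 : ℝ) 1) :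
    seqGenFun c r = (∏' i : ℕ, Q.Y X (a ^ i * r)) * c 0 := by
  have hX00 : X 0 = 0 := hX0 ▸ Q.vacArrivals_zero
  have hK : ∀ s, Q.K X s = 0 := fun s => by simp [K, hX0]
  have h1 := ((multipliable_Y ha0 ha1 hQ hX00 hr).tendsto_prod_tprod_nat).mul
    (hc.tendsto_seqGenFun_pow ha0 ha1 hr.1)
  refine tendsto_nhds_unique (tendsto_const_nhds.congr fun n => ?_) h1
  rw [hc.iterate ha0 ha1 hQ hX (hX0.symm ▸ hX) hr n]
  simp [hK]

theorem eq_tsum (hc : IsStationarySequence Q X a c) (ha0 : 0 ≤ a) (ha1 : a < 1)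
    (hQ : Q.load < 1) (hX : Summable fun m => (X m).toReal * (m : ℝ))
    (hX0 : Summable fun m => (Q.vacArrivals 0 m).toReal * (m : ℝ)) (hX00 : 0 < X 0)
    {r : ℝ} (hr : r ∈ Set.Icc (0 : ℝ) 1) :
    seqGenFun c r =
      (∑' j : ℕ, Q.K X (a ^ j * r) * ∏ i ∈ Finset.range j, Q.Y X (a ^ i * r)) * c 0 := by
  have h1 := ((summable_prod_Y ha0 ha1 hQ hX00 hr).tendsto_atTop_zero.mul
    (hc.tendsto_seqGenFun_pow ha0 ha1 hr.1)).add
    ((summable_K_mul_prod_Y ha0 ha1 hQ hX00 hr).hasSum.tendsto_sum_nat.mul_const (c 0))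
  rw [zero_mul, zero_add] at h1
  exact tendsto_nhds_unique (tendsto_const_nhds.congr fun n =>
    hc.iterate ha0 ha1 hQ hX hX0 hr n) h1

/-- The functional equation and the normalisation at `1` leave no freedom. -/
theorem unique {c' : ℕ → ℝ} (hc : IsStationarySequence Q X a c)
    (hc' : IsStationarySequence Q X a c') (ha0 : 0 ≤ a) (ha1 : a < 1)
    (hQ : Q.load < 1) (hX : Summable fun m => (X m).toReal * (m : ℝ))
    (hX0 : Summable fun m => (Q.vacArrivals 0 m).toReal * (m : ℝ))
    (hXX : Q.vacArrivals 0 = X ∨ 0 < X 0) : c = c' := by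
  obtain ⟨F, hF⟩ : ∃ F : ℝ → ℝ, ∀ c, IsStationarySequence Q X a c →
      ∀ r ∈ Set.Icc (0 : ℝ) 1, seqGenFun c r = F r * c 0 := by
    rcases hXX with h | h
    · exact ⟨_, fun c hc r hr => hc.eq_tprod ha0 ha1 hQ hX h hr⟩
    · exact ⟨_, fun c hc r hr => hc.eq_tsum ha0 ha1 hQ hX hX0 h hr⟩
  have h1 : F 1 * c 0 = 1 := by
    rw [← hF c hc 1 ⟨zero_le_one, le_rfl⟩, hc.seqGenFun_one ha0 ha1 hQ hX hX0]
  have h2 : F 1 * c' 0 = 1 := by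
    rw [← hF c' hc' 1 ⟨zero_le_one, le_rfl⟩, hc'.seqGenFun_one ha0 ha1 hQ hX hX0]
  have h3 : c 0 = c' 0 := by
    have h4 : F 1 ≠ 0 := left_ne_zero_of_mul_eq_one h1
    exact mul_left_cancel₀ h4 (h1.trans h2.symm)
  have hsub : Summable fun m => |c m - c' m| :=
    (hc.summable.sub hc'.summable).abs
  have hz := eq_zero_of_seqGenFun_eq_zero hsub fun r hr => by
    have hr' : r ∈ Set.Icc (0 : ℝ) 1 := ⟨hr.1.le, hr.2.le⟩
    have h5 := (summable_mul_pow hc.summable_abs hr').tsum_sub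
      (summable_mul_pow hc'.summable_abs hr')
    have h6 : seqGenFun (fun m => c m - c' m) r = seqGenFun c r - seqGenFun c' r := by
      simp only [seqGenFun, sub_mul]
      exact h5
    rw [h6, hF c hc r hr', hF c' hc' r hr', h3, sub_self]
  funext m
  exact sub_eq_zero.1 (hz m)

end IsStationarySequence

end VacationQueue

/-! ### Limits of the normalised occupation counts -/

theorem tsum_mul_ofReal {u : ℕ → ℝ≥0∞} (hu : ∑' i, u i ≠ ∞) {w : ℕ → ℝ} {C : ℝ}
    (hw0 : ∀ i, 0 ≤ w i) (hwC : ∀ i, w i ≤ C) :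
    (Summable fun i => (u i).toReal * w i) ∧
      ∑' i, u i * ENNReal.ofReal (w i) = ENNReal.ofReal (∑' i, (u i).toReal * w i) := by
  have hs : Summable fun i => (u i).toReal * w i := by
    refine Summable.of_nonneg_of_le (fun i => mul_nonneg ENNReal.toReal_nonneg (hw0 i))
      (fun i => ?_) ((ENNReal.summable_toReal hu).mul_right C)
    exact mul_le_mul_of_nonneg_left (hwC i) ENNReal.toReal_nonneg
  refine ⟨hs, ?_⟩
  rw [ENNReal.ofReal_tsum_of_nonneg (fun i => mul_nonneg ENNReal.toReal_nonneg (hw0 i)) hs]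
  refine tsum_congr fun i => ?_
  rw [ENNReal.ofReal_mul ENNReal.toReal_nonneg,
    ENNReal.ofReal_toReal (ENNReal.ne_top_of_tsum_ne_top hu i)]

namespace VacationQueue

theorem tsum_idleArrivals_mul_pow (Q : VacationQueue) (i : ℕ) {r : ℝ}
    (hr : r ∈ Set.Icc (0 : ℝ) 1) :
    ∑' m, Q.idleArrivals i m * ENNReal.ofReal r ^ m =
      ENNReal.ofReal (1 - Q.deact i + Q.deact i * genFun (Q.vacArrivals i) r) := by
  simp only [idleArrivals, add_mul, ite_mul, zero_mul, mul_assoc]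
  rw [ENNReal.tsum_add, ENNReal.tsum_mul_left, ← ofReal_genFun _ hr,
    ← ENNReal.ofReal_mul (Q.deact_nonneg i), tsum_ite_eq, pow_zero, mul_one,
    ← ENNReal.ofReal_add (mul_nonneg (Q.deact_nonneg i) (genFun_nonneg _ hr.1))
      (sub_nonneg.2 (Q.deact_le_one i)), add_comm]

theorem tsum_idleArrivals_mul_natCast (Q : VacationQueue) (i : ℕ) :
    ∑' m : ℕ, Q.idleArrivals i m * (m : ℝ≥0∞) =
      ENNReal.ofReal (Q.deact i * meanNat (Q.vacArrivals i)) := by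
  have h1 := tsum_mul_natCast_ne_top_of_finiteSecondMoment (Q.vacArrivals_secondMoment i)
  simp only [idleArrivals, add_mul, ite_mul, zero_mul, mul_assoc]
  rw [ENNReal.tsum_add, ENNReal.tsum_mul_left, ← ofReal_meanNat h1,
    ← ENNReal.ofReal_mul (Q.deact_nonneg i), tsum_ite_eq]
  simp

theorem tsum_cycle_pow (Q : VacationQueue) (i : ℕ) {r : ℝ} (hr : r ∈ Set.Icc (0 : ℝ) 1) :
    ∑' m : ℕ, Q.idleArrivals i m *
        ∑' l : ℕ, Q.serviceArrivals l * ENNReal.ofReal r ^ (i + m + l) =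
      ENNReal.ofReal (Q.serviceArrivalsGF r) * ENNReal.ofReal
        (r ^ i * (1 - Q.deact i + Q.deact i * genFun (Q.vacArrivals i) r)) := by
  have h1 : ∀ m : ℕ, Q.idleArrivals i m *
      ∑' l : ℕ, Q.serviceArrivals l * ENNReal.ofReal r ^ (i + m + l) =
      Q.idleArrivals i m * ENNReal.ofReal r ^ m *
        (ENNReal.ofReal r ^ i * ENNReal.ofReal (Q.serviceArrivalsGF r)) := fun m => by
    rw [← Q.genFun_serviceArrivals hr, ofReal_genFun _ hr, ← ENNReal.tsum_mul_left,
      ← ENNReal.tsum_mul_left, ← ENNReal.tsum_mul_left]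
    exact tsum_congr fun l => by ring
  simp_rw [h1]
  rw [ENNReal.tsum_mul_right, Q.tsum_idleArrivals_mul_pow i hr,
    ENNReal.ofReal_mul (pow_nonneg hr.1 i), ENNReal.ofReal_pow hr.1]
  ring

theorem tsum_cycle_natCast (Q : VacationQueue) (i : ℕ) :
    ∑' m : ℕ, Q.idleArrivals i m * ∑' l : ℕ, Q.serviceArrivals l * ((m : ℝ≥0∞) + l) =
      ENNReal.ofReal (Q.deact i * meanNat (Q.vacArrivals i) + Q.load) := by
  simp_rw [mul_add, ENNReal.tsum_add, ENNReal.tsum_mul_right, Q.serviceArrivals.tsum_coe,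
    Q.tsum_serviceArrivals_mul_natCast, one_mul]
  simp_rw [mul_add]
  rw [ENNReal.tsum_add, ENNReal.tsum_mul_right, Q.tsum_idleArrivals,
    Q.tsum_idleArrivals_mul_natCast, one_mul,
    ENNReal.ofReal_add (mul_nonneg (Q.deact_nonneg i) (meanNat_nonneg _)) Q.load_nonneg]

end VacationQueue

theorem tendsto_tsum_mul_of_pointwise {l : Filter ℝ} {q : ℝ → ℕ → ℝ} {c w : ℕ → ℝ}
    (hq : ∀ᶠ T in l, ∀ i, |q T i| ≤ 2) (hc : ∀ i, Tendsto (fun T => q T i) l (𝓝 (c i)))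
    (hw : Summable fun i => |w i|) :
    Tendsto (fun T => ∑' i, q T i * w i) l (𝓝 (∑' i, c i * w i)) := by
  refine tendsto_tsum_of_dominated_convergence (hw.mul_left 2)
    (fun i => (hc i).mul_const (w i)) ?_
  filter_upwards [hq] with T hT i
  rw [norm_mul, Real.norm_eq_abs, Real.norm_eq_abs]
  exact mul_le_mul_of_nonneg_right (hT i) (abs_nonneg _)

/-- Every limit point of a family of almost invariant measures on `ℕ` whose total masses are
asymptotically at most `1` is a stationary sequence. -/
theorem VacationQueue.exists_isStationarySequence_of_ultrafilter {Q : VacationQueue} {X : PMF ℕ}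
    {a : ℝ} (ha0 : 0 ≤ a) (ha1 : a < 1) {q : ℝ → ℕ → ℝ} {C : ℝ}
    (hq0 : ∀ T > 0, ∀ i, 0 ≤ q T i) (hqs : ∀ T > 0, Summable (q T))
    (hq1 : ∀ T > 0, ∑' i, q T i ≤ 1 + C / T)
    (hmass : ∀ T > 0, 1 ≤ ∑' i, q T i * (meanNat X * a ^ i +
      if i = 0 then meanNat (Q.vacArrivals 0) - meanNat X else 0) + Q.load * ∑' i, q T i)
    (hbal : ∀ T > 0, ∀ r ∈ Set.Ico (0 : ℝ) 1, |r * seqGenFun (q T) r - Q.serviceArrivalsGF r *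
      ∑' i, q T i * (r ^ i - (1 - genFun X r) * (a * r) ^ i +
        if i = 0 then genFun (Q.vacArrivals 0) r - genFun X r else 0)| ≤ C / T)
    (𝒰 : Ultrafilter ℝ) (h𝒰 : (𝒰 : Filter ℝ) ≤ atTop) :
    ∃ c, Q.IsStationarySequence X a c ∧ ∀ i, Tendsto (fun T => q T i) 𝒰 (𝓝 (c i)) := by
  have hpos : ∀ᶠ T : ℝ in 𝒰, 0 < T := h𝒰 (eventually_gt_atTop 0)
  have hC : Tendsto (fun T : ℝ => C / T) 𝒰 (𝓝 0) :=
    (tendsto_const_nhds.div_atTop tendsto_id).mono_left h𝒰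
  have hle2 : ∀ᶠ T in (𝒰 : Filter ℝ), ∀ i, q T i ∈ Set.Icc (0 : ℝ) 2 := by
    filter_upwards [hpos, hC.eventually_le_const zero_lt_one] with T hT hCT i
    refine ⟨hq0 T hT i, ?_⟩
    have := (hqs T hT).le_tsum i fun j _ => hq0 T hT j
    linarith [hq1 T hT]
  have hex : ∀ i, ∃ x, Tendsto (fun T => q T i) 𝒰 (𝓝 x) := by
    intro i
    have h1 : Ultrafilter.map (fun T => q T i) 𝒰 ≤ 𝓟 (Set.Icc (0 : ℝ) 2) := by
      rw [Ultrafilter.coe_map]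
      exact tendsto_principal.2 (hle2.mono fun T hT => hT i)
    obtain ⟨x, _, hx⟩ := (isCompact_Icc (a := (0 : ℝ)) (b := 2)).ultrafilter_le_nhds _ h1
    exact ⟨x, hx⟩
  choose c hc using hex
  refine ⟨c, ?_, hc⟩
  have habs : ∀ᶠ T in (𝒰 : Filter ℝ), ∀ i, |q T i| ≤ 2 := by
    filter_upwards [hle2] with T hT i
    rw [abs_of_nonneg (hT i).1]
    exact (hT i).2
  have hc0 : ∀ i, 0 ≤ c i := fun i => ge_of_tendsto (hc i) (by
    filter_upwards [hpos] with T hT using hq0 T hT i)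
  have hfin : ∀ F : Finset ℕ, ∑ i ∈ F, c i ≤ 1 := by
    intro F
    have h1 : Tendsto (fun T : ℝ => 1 + C / T) 𝒰 (𝓝 (1 + 0)) := hC.const_add 1
    rw [add_zero] at h1
    refine le_of_tendsto_of_tendsto (tendsto_finsetSum F fun i _ => hc i) h1 ?_
    filter_upwards [hpos] with T hT
    exact ((hqs T hT).sum_le_tsum F fun i _ => hq0 T hT i).trans (hq1 T hT)
  have hcs : Summable c := summable_of_sum_le hc0 hfin
  have hcabs : Summable fun i => |c i| := by simpa only [abs_of_nonneg (hc0 _)] using hcs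
  have hite : ∀ x : ℝ, Summable fun i : ℕ => if i = 0 then x else 0 := fun x =>
    (hasSum_ite_eq 0 x).summable
  have hctite : ∀ x : ℝ, ∑' i : ℕ, c i * (if i = 0 then x else 0) = c 0 * x := fun x => by
    rw [tsum_eq_single 0 fun i hi => by simp [hi]]
    simp
  have hcite : ∀ x : ℝ, Summable fun i : ℕ => c i * (if i = 0 then x else 0) := fun x =>
    summable_of_ne_finset_zero (s := {0}) fun i hi => by simp at hi; simp [hi]
  have hgeo : ∀ s ∈ Set.Ico (0 : ℝ) 1, Summable fun i : ℕ => s ^ i := fun s hs =>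
    summable_geometric_of_lt_one hs.1 hs.2
  have haI : a ∈ Set.Ico (0 : ℝ) 1 := ⟨ha0, ha1⟩
  have hIcc : ∀ {s : ℝ}, s ∈ Set.Ico (0 : ℝ) 1 → s ∈ Set.Icc (0 : ℝ) 1 := fun hs =>
    Set.Ico_subset_Icc_self hs
  refine ⟨hc0, hcs, hcs.tsum_le_of_sum_le hfin, fun r hr => ?_, ?_⟩
  · have har : a * r ∈ Set.Ico (0 : ℝ) 1 :=
      ⟨mul_nonneg ha0 hr.1, mul_lt_one_of_nonneg_of_lt_one_left ha0 ha1 hr.2.le⟩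
    set w : ℕ → ℝ := fun i => r ^ i - (1 - genFun X r) * (a * r) ^ i +
        if i = 0 then genFun (Q.vacArrivals 0) r - genFun X r else 0 with hw
    have hws : Summable w := ((hgeo r hr).sub ((hgeo _ har).mul_left _)).add (hite _)
    have h1 := tendsto_tsum_mul_of_pointwise habs hc (hgeo r hr).abs
    have h2 := tendsto_tsum_mul_of_pointwise habs hc hws.abs
    have h3 : Tendsto (fun T => r * seqGenFun (q T) r - Q.serviceArrivalsGF r *
        ∑' i, q T i * w i) 𝒰 (𝓝 0) := by
      refine squeeze_zero_norm' ?_ hC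
      filter_upwards [hpos] with T hT using hbal T hT r hr
    have h4 := tendsto_nhds_unique h3 ((h1.const_mul r).sub (h2.const_mul _))
    have h5 : ∑' i, c i * w i = seqGenFun c r - (1 - genFun X r) * seqGenFun c (a * r) +
        c 0 * (genFun (Q.vacArrivals 0) r - genFun X r) := by
      have e1 := (summable_mul_pow hcabs (hIcc hr)).hasSum
      have e2 := (summable_mul_pow hcabs (hIcc har)).hasSum.mul_left (1 - genFun X r)
      have e3 := (hcite (genFun (Q.vacArrivals 0) r - genFun X r)).hasSum
      rw [hctite] at e3
      refine HasSum.tsum_eq (((e1.sub e2).add e3).congr_fun fun i => ?_)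
      simp only [hw]
      ring
    rw [h5] at h4
    change 0 = r * seqGenFun c r - _ at h4
    linarith
  · set w : ℕ → ℝ := fun i => meanNat X * a ^ i +
      if i = 0 then meanNat (Q.vacArrivals 0) - meanNat X else 0 with hw
    have hws : Summable w := ((hgeo a haI).mul_left _).add (hite _)
    have h2 := tendsto_tsum_mul_of_pointwise habs hc hws.abs
    have h3 : Tendsto (fun T : ℝ => ∑' i, q T i * w i + Q.load * (1 + C / T)) 𝒰
        (𝓝 (∑' i, c i * w i + Q.load * (1 + 0))) := h2.add ((hC.const_add 1).const_mul _)
    have h4 : 1 ≤ ∑' i, c i * w i + Q.load * (1 + 0) := by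
      refine ge_of_tendsto h3 ?_
      filter_upwards [hpos] with T hT
      have := mul_le_mul_of_nonneg_left (hq1 T hT) Q.load_nonneg
      linarith [hmass T hT]
    have h5 : ∑' i, c i * w i = meanNat X * seqGenFun c a +
        c 0 * (meanNat (Q.vacArrivals 0) - meanNat X) := by
      have e2 := (summable_mul_pow hcabs (hIcc haI)).hasSum.mul_left (meanNat X)
      have e3 := (hcite (meanNat (Q.vacArrivals 0) - meanNat X)).hasSum
      rw [hctite] at e3
      refine HasSum.tsum_eq ((e2.add e3).congr_fun fun i => ?_)
      simp only [hw]
      ring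
    rw [h5] at h4
    linarith

/-- The time averages of a convergent function converge to its limit. -/
theorem tendsto_timeAverage_of_tendsto {φ : ℝ≥0 → ℝ} (hφ : Measurable φ) (hb : ∀ t, ‖φ t‖ ≤ 1)
    {c : ℝ} (hc : Tendsto φ atTop (𝓝 c)) :
    Tendsto (fun T : ℝ => T⁻¹ * ∫ t in (0 : ℝ)..T, φ t.toNNReal) atTop (𝓝 c) := by
  have h1 : Tendsto (fun T : ℝ => ∫ s in (0 : ℝ)..1, φ (T * s).toNNReal) atTop
      (𝓝 (∫ _ in (0 : ℝ)..1, c)) := by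
    refine intervalIntegral.tendsto_integral_filter_of_dominated_convergence (fun _ => 1)
      (Eventually.of_forall fun T => ?_)
      (Eventually.of_forall fun T => ae_of_all _ fun t _ => hb _)
      intervalIntegrable_const (ae_of_all _ fun s hs => ?_)
    · exact (hφ.comp (measurable_real_toNNReal.comp (measurable_const_mul T))).aestronglyMeasurable
    · rw [Set.uIoc_of_le zero_le_one] at hs
      exact hc.comp (tendsto_real_toNNReal_atTop.comp (tendsto_id.atTop_mul_const hs.1))
  rw [intervalIntegral.integral_const, sub_zero, one_smul] at h1
  refine h1.congr' ?_
  filter_upwards [eventually_gt_atTop 0] with T hT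
  have := intervalIntegral.integral_comp_mul_left (a := 0) (b := 1)
    (fun t : ℝ => φ t.toNNReal) hT.ne'
  rw [this, mul_zero, mul_one, smul_eq_mul]

/-! ### The steady state -/

theorem VacationQueue.cycle_genFun_eq {Q : VacationQueue} {X : PMF ℕ} {a : ℝ}
    (hdeact : ∀ i : ℕ, Q.deact i = a ^ i) (hX : ∀ i, 1 ≤ i → Q.vacArrivals i = X) (i : ℕ) (r : ℝ) :
    r ^ i * (1 - Q.deact i + Q.deact i * genFun (Q.vacArrivals i) r) =
      r ^ i - (1 - genFun X r) * (a * r) ^ i +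
        if i = 0 then genFun (Q.vacArrivals 0) r - genFun X r else 0 := by
  rcases i.eq_zero_or_pos with rfl | hi
  · simp [Q.deact_zero]
  · rw [hX i hi, if_neg hi.ne', hdeact]
    ring

theorem VacationQueue.cycle_mean_eq {Q : VacationQueue} {X : PMF ℕ} {a : ℝ}
    (hdeact : ∀ i : ℕ, Q.deact i = a ^ i) (hX : ∀ i, 1 ≤ i → Q.vacArrivals i = X) (i : ℕ) :
    Q.deact i * meanNat (Q.vacArrivals i) = meanNat X * a ^ i +
      if i = 0 then meanNat (Q.vacArrivals 0) - meanNat X else 0 := by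
  rcases i.eq_zero_or_pos with rfl | hi
  · simp [Q.deact_zero]
  · rw [hX i hi, if_neg hi.ne', hdeact]
    ring

namespace IsVacationQueueProcess

variable {Ω : Type*} {mΩ : MeasurableSpace Ω} {Q : VacationQueue} {P : Measure Ω}
  {𝓕 : Filtration ℝ≥0 mΩ} {k : ℕ} {N : ℝ≥0 → Ω → ℕ} {S V : ℕ → Ω → ℝ≥0} {W : ℕ → Set Ω}
  {X : PMF ℕ} {a : ℝ}

theorem tsum_occupation_ne_top [IsProbabilityMeasure P]
    (h : IsVacationQueueProcess Q P 𝓕 k N S V W) (T : ℝ≥0) :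
    ∑' i, occupation P k N S T i ≠ ∞ :=
  ne_top_of_le_ne_top (by finiteness) (h.tsum_occupation_le T)

theorem tsum_toReal_occupation_le [IsProbabilityMeasure P]
    (h : IsVacationQueueProcess Q P 𝓕 k N S V W) (T : ℝ≥0) :
    ∑' i, (occupation P k N S T i).toReal ≤ 1 + k + Q.arrivalRate * T := by
  have h1 := ENNReal.toReal_mono (by finiteness) (h.tsum_occupation_le T)
  rw [ENNReal.tsum_toReal_eq fun i => ENNReal.ne_top_of_tsum_ne_top (h.tsum_occupation_ne_top T) i]
    at h1
  refine h1.trans_eq ?_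
  rw [ENNReal.toReal_add (by finiteness) (by finiteness),
    ENNReal.toReal_add (by finiteness) (by finiteness)]
  simp

theorem arrivals_le_occupation [IsProbabilityMeasure P]
    (h : IsVacationQueueProcess Q P 𝓕 k N S V W) (ha0 : 0 ≤ a) (ha1 : a < 1)
    (hdeact : ∀ i : ℕ, Q.deact i = a ^ i) (hX : ∀ i, 1 ≤ i → Q.vacArrivals i = X) (T : ℝ≥0) :
    (Q.arrivalRate * T : ℝ) ≤ ∑' i, (occupation P k N S T i).toReal * (meanNat X * a ^ i +
      if i = 0 then meanNat (Q.vacArrivals 0) - meanNat X else 0) +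
        Q.load * ∑' i, (occupation P k N S T i).toReal := by
  have h1 := h.arrivals_le_tsum_occupation T
  simp_rw [Q.tsum_cycle_natCast, VacationQueue.cycle_mean_eq hdeact hX] at h1
  have hnn : ∀ i, 0 ≤ meanNat X * a ^ i +
      if i = 0 then meanNat (Q.vacArrivals 0) - meanNat X else 0 := fun i => by
    rw [← VacationQueue.cycle_mean_eq hdeact hX]
    exact mul_nonneg (Q.deact_nonneg i) (meanNat_nonneg _)
  have hle : ∀ i, meanNat X * a ^ i +
      (if i = 0 then meanNat (Q.vacArrivals 0) - meanNat X else 0) ≤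
      meanNat X + meanNat (Q.vacArrivals 0) := fun i => by
    have h2 : meanNat X * a ^ i ≤ meanNat X :=
      mul_le_of_le_one_right (meanNat_nonneg X) (pow_le_one₀ ha0 ha1.le)
    have h3 := meanNat_nonneg X
    have h4 := meanNat_nonneg (Q.vacArrivals 0)
    split_ifs <;> linarith
  obtain ⟨hs1, _⟩ := tsum_mul_ofReal (h.tsum_occupation_ne_top T) hnn hle
  obtain ⟨hs2, he2⟩ := tsum_mul_ofReal (h.tsum_occupation_ne_top T)
    (fun i => add_nonneg (hnn i) Q.load_nonneg) fun i => add_le_add_left (hle i) Q.load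
  rw [he2, ← ENNReal.coe_mul, ← ENNReal.ofReal_coe_nnreal, ENNReal.ofReal_le_ofReal_iff
    (tsum_nonneg fun i => mul_nonneg ENNReal.toReal_nonneg
      (add_nonneg (hnn i) Q.load_nonneg))] at h1
  rw [← tsum_mul_left, ← hs1.tsum_add
    ((ENNReal.summable_toReal (h.tsum_occupation_ne_top T)).mul_left _)]
  push_cast at h1
  refine h1.trans_eq (tsum_congr fun i => ?_)
  ring

theorem abs_occupation_balance_le [IsProbabilityMeasure P]
    (h : IsVacationQueueProcess Q P 𝓕 k N S V W)
    (hdeact : ∀ i : ℕ, Q.deact i = a ^ i) (hX : ∀ i, 1 ≤ i → Q.vacArrivals i = X) (T : ℝ≥0)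
    {r : ℝ} (hr : r ∈ Set.Icc (0 : ℝ) 1) :
    |r * seqGenFun (fun i => (occupation P k N S T i).toReal) r - Q.serviceArrivalsGF r *
      ∑' i, (occupation P k N S T i).toReal * (r ^ i - (1 - genFun X r) * (a * r) ^ i +
        if i = 0 then genFun (Q.vacArrivals 0) r - genFun X r else 0)| ≤ 1 := by
  have hu := h.tsum_occupation_ne_top T
  obtain ⟨h1, h2⟩ := h.occupation_balance T (x := ENNReal.ofReal r)
    (ENNReal.ofReal_le_one.2 hr.2)
  simp_rw [Q.tsum_cycle_pow _ hr, VacationQueue.cycle_genFun_eq hdeact hX,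
    mul_left_comm _ (ENNReal.ofReal (Q.serviceArrivalsGF r)), ← ENNReal.ofReal_pow hr.1] at h1 h2
  set w : ℕ → ℝ := fun i => r ^ i - (1 - genFun X r) * (a * r) ^ i +
        if i = 0 then genFun (Q.vacArrivals 0) r - genFun X r else 0 with hw
  have hw0 : ∀ i, 0 ≤ w i := fun i => by
    simp only [hw]
    rw [← VacationQueue.cycle_genFun_eq hdeact hX]
    exact mul_nonneg (pow_nonneg hr.1 i) (add_nonneg (sub_nonneg.2 (Q.deact_le_one i))
      (mul_nonneg (Q.deact_nonneg i) (genFun_nonneg _ hr.1)))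
  have hw1 : ∀ i, w i ≤ 1 := fun i => by
    simp only [hw]
    rw [← VacationQueue.cycle_genFun_eq hdeact hX]
    refine mul_le_one₀ (pow_le_one₀ hr.1 hr.2) (add_nonneg (sub_nonneg.2 (Q.deact_le_one i))
      (mul_nonneg (Q.deact_nonneg i) (genFun_nonneg _ hr.1))) ?_
    have := mul_le_of_le_one_right (Q.deact_nonneg i) (genFun_le_one (Q.vacArrivals i) hr)
    linarith
  obtain ⟨hs1, he1⟩ := tsum_mul_ofReal hu (fun i => pow_nonneg hr.1 i)
    fun i => pow_le_one₀ hr.1 hr.2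
  obtain ⟨hs2, he2⟩ := tsum_mul_ofReal hu hw0 hw1
  have hh : 0 ≤ Q.serviceArrivalsGF r := by
    rw [← Q.genFun_serviceArrivals hr]
    exact genFun_nonneg _ hr.1
  have hA : 0 ≤ ∑' i, (occupation P k N S T i).toReal * r ^ i :=
    tsum_nonneg fun i => mul_nonneg ENNReal.toReal_nonneg (pow_nonneg hr.1 i)
  have hB : 0 ≤ ∑' i, (occupation P k N S T i).toReal * w i :=
    tsum_nonneg fun i => mul_nonneg ENNReal.toReal_nonneg (hw0 i)
  rw [ENNReal.tsum_mul_left, he1, he2, ← ENNReal.ofReal_mul hr.1, ← ENNReal.ofReal_mul hh,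
    ← ENNReal.ofReal_one] at h1 h2
  rw [← ENNReal.ofReal_add zero_le_one (mul_nonneg hh hB),
    ENNReal.ofReal_le_ofReal_iff (add_nonneg zero_le_one (mul_nonneg hh hB))] at h1
  rw [← ENNReal.ofReal_add zero_le_one (mul_nonneg hr.1 hA),
    ENNReal.ofReal_le_ofReal_iff (add_nonneg zero_le_one (mul_nonneg hr.1 hA))] at h2
  rw [abs_le, seqGenFun]
  constructor <;> linarith

/-- The long-run frequencies of the numbers of customers left behind at service completions exist
and form the stationary sequence. -/
theorem exists_tendsto_occupation [IsProbabilityMeasure P]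
    (h : IsVacationQueueProcess Q P 𝓕 k N S V W) (ha0 : 0 ≤ a) (ha1 : a < 1)
    (hdeact : ∀ i : ℕ, Q.deact i = a ^ i) (hQ : Q.load < 1)
    (hX : ∀ i, 1 ≤ i → Q.vacArrivals i = X) (hXX : Q.vacArrivals 0 = X ∨ 0 < X 0) :
    ∃ c, Q.IsStationarySequence X a c ∧ ∀ i, Tendsto
      (fun T : ℝ => (occupation P k N S T.toNNReal i).toReal / (Q.arrivalRate * T)) atTop
        (𝓝 (c i)) := by
  have hlam : (0 : ℝ) < Q.arrivalRate := by exact_mod_cast Q.arrivalRate_pos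
  have hmX : Summable fun m => (X m).toReal * (m : ℝ) := by
    rw [← hX 1 le_rfl]
    exact summable_mul_natCast_of_ne_top
      (tsum_mul_natCast_ne_top_of_finiteSecondMoment (Q.vacArrivals_secondMoment 1))
  have hmX0 : Summable fun m => (Q.vacArrivals 0 m).toReal * (m : ℝ) :=
    summable_mul_natCast_of_ne_top
      (tsum_mul_natCast_ne_top_of_finiteSecondMoment (Q.vacArrivals_secondMoment 0))
  set q : ℝ → ℕ → ℝ := fun T i =>
    (occupation P k N S T.toNNReal i).toReal / (Q.arrivalRate * T) with hq
  have hqw : ∀ (T : ℝ) (w : ℕ → ℝ), ∑' i, q T i * w i =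
      (∑' i, (occupation P k N S T.toNNReal i).toReal * w i) / (Q.arrivalRate * T) := by
    intro T w
    rw [← tsum_div_const]
    exact tsum_congr fun i => by simp only [hq]; ring
  have hq1 : ∀ T : ℝ, ∑' i, q T i =
      (∑' i, (occupation P k N S T.toNNReal i).toReal) / (Q.arrivalRate * T) := fun T => by
    rw [← tsum_div_const]
  have hlim : ∀ 𝒰 : Ultrafilter ℝ, (𝒰 : Filter ℝ) ≤ atTop → ∃ c, Q.IsStationarySequence X a c ∧
      ∀ i, Tendsto (fun T => q T i) 𝒰 (𝓝 (c i)) := by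
    refine VacationQueue.exists_isStationarySequence_of_ultrafilter ha0 ha1
      (C := (1 + k) / Q.arrivalRate) (fun T hT i => ?_) (fun T hT => ?_) (fun T hT => ?_)
      (fun T hT => ?_) (fun T hT r hr => ?_)
    · have hT' : 0 < T := hT
      simp only [hq]
      positivity
    · exact (ENNReal.summable_toReal (h.tsum_occupation_ne_top _)).div_const _
    · have hT' : 0 < T := hT
      have h1 := h.tsum_toReal_occupation_le T.toNNReal
      rw [Real.coe_toNNReal T hT'.le] at h1
      rw [hq1, div_le_iff₀ (by positivity)]
      refine h1.trans_eq ?_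
      field_simp
      ring
    · have hT' : 0 < T := hT
      have h1 := h.arrivals_le_occupation ha0 ha1 hdeact hX T.toNNReal
      rw [Real.coe_toNNReal T hT'.le] at h1
      rw [hqw, hq1, ← mul_div_assoc, ← add_div, le_div_iff₀ (by positivity), one_mul]
      exact h1
    · have hT' : 0 < T := hT
      have h1 := h.abs_occupation_balance_le hdeact hX T.toNNReal ⟨hr.1, hr.2.le⟩
      rw [seqGenFun, hqw, hqw, ← mul_div_assoc, ← mul_div_assoc, ← sub_div, abs_div,
        abs_of_pos (a := (Q.arrivalRate : ℝ) * T) (by positivity), div_div]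
      gcongr
      refine h1.trans ?_
      have : (0 : ℝ) ≤ k := Nat.cast_nonneg k
      linarith
  -- All ultrafilter limits agree, since the stationary sequence is unique.
  obtain ⟨c, hc, -⟩ := hlim (Ultrafilter.of atTop) (Ultrafilter.of_le atTop)
  refine ⟨c, hc, fun i => (tendsto_iff_ultrafilter _ _ _).2 fun 𝒰 h𝒰 => ?_⟩
  obtain ⟨c', hc', hlim'⟩ := hlim 𝒰 h𝒰
  rw [hc.unique hc' ha0 ha1 hQ hmX hmX0 hXX]
  exact hlim' i

theorem tendsto_timeAverage [IsProbabilityMeasure P]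
    (h : IsVacationQueueProcess Q P 𝓕 k N S V W) {j : ℕ} {c : ℝ}
    (hc : Tendsto (fun T : ℝ => (occupation P k N S T.toNNReal j).toReal / (Q.arrivalRate * T))
      atTop (𝓝 c)) :
    Tendsto (fun T : ℝ => T⁻¹ * ∫ t in (0 : ℝ)..T,
      P.real {ω | numInSystem k N S t.toNNReal ω = (j : ℤ)}) atTop (𝓝 c) := by
  have hlam : (0 : ℝ) < Q.arrivalRate := by exact_mod_cast Q.arrivalRate_pos
  have hzero : Tendsto (fun T : ℝ => ((Q.arrivalRate : ℝ) * (∫ t in (0 : ℝ)..T,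
      P.real {ω | numInSystem k N S t.toNNReal ω = (j : ℤ)}) -
        (occupation P k N S T.toNNReal j).toReal) / (Q.arrivalRate * T)) atTop (𝓝 0) := by
    refine squeeze_zero_norm' (a := fun T : ℝ => 2 / (Q.arrivalRate * T)) ?_
      (tendsto_const_nhds.div_atTop (tendsto_id.const_mul_atTop hlam))
    filter_upwards [eventually_gt_atTop 0] with T hT
    rw [norm_div, Real.norm_eq_abs, Real.norm_eq_abs,
      abs_of_pos (a := (Q.arrivalRate : ℝ) * T) (by positivity)]
    gcongr
    exact h.abs_time_sub_occupation_le j hT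
  have h2 := hzero.add hc
  rw [zero_add] at h2
  refine h2.congr' ?_
  filter_upwards [eventually_gt_atTop 0] with T hT
  field_simp
  ring

end IsVacationQueueProcess

theorem StochStrictlyLarger.ne {p q : PMF ℕ} (h : StochStrictlyLarger p q) : p ≠ q := by
  rintro rfl
  obtain ⟨w, hw⟩ := h.2
  exact lt_irrefl _ hw

theorem mainTheorem5 (Q : VacationQueue) (a : ℝ) (ha0 : 0 ≤ a) (ha1 : a < 1)
    (hdeact : ∀ i : ℕ, Q.deact i = a ^ i) (hstable : Q.load < 1)
    (X : PMF ℕ) (hX : Q.EqualVacations X)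
    {Ω : Type*} {mΩ : MeasurableSpace Ω} (P : Measure Ω) [IsProbabilityMeasure P]
    (𝓕 : Filtration ℝ≥0 mΩ) (k : ℕ) (N : ℝ≥0 → Ω → ℕ) (S V : ℕ → Ω → ℝ≥0) (W : ℕ → Set Ω)
    (hproc : IsVacationQueueProcess Q P 𝓕 k N S V W) :
    ∃ p : PMF ℕ,
      IsSteadyStateLaw P (numInSystem k N S) p ∧
      (∀ (j : ℕ) (c : ℝ),
        Tendsto (fun t : ℝ≥0 => P.real {ω | numInSystem k N S t ω = (j : ℤ)}) atTop (𝓝 c) →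
          (p j).toReal = c) ∧
      (Q.vacArrivals 0 = X →
        (∀ r ∈ Set.Icc (0 : ℝ) 1, Multipliable fun i : ℕ => Q.Y X (a ^ i * r)) ∧
        0 < ∏' i : ℕ, Q.Y X (a ^ i) ∧
        ∀ r ∈ Set.Icc (0 : ℝ) 1,
          genFun p r = (∏' i : ℕ, Q.Y X (a ^ i * r)) / ∏' i : ℕ, Q.Y X (a ^ i)) ∧
      (StochStrictlyLarger (Q.vacArrivals 0) X →
        (∀ r ∈ Set.Icc (0 : ℝ) 1, Summable fun j : ℕ =>
          Q.K X (a ^ j * r) * ∏ i ∈ Finset.range j, Q.Y X (a ^ i * r)) ∧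
        0 < ∑' j : ℕ, Q.K X (a ^ j) * ∏ i ∈ Finset.range j, Q.Y X (a ^ i) ∧
        ∀ r ∈ Set.Icc (0 : ℝ) 1,
          genFun p r =
            (∑' j : ℕ, Q.K X (a ^ j * r) * ∏ i ∈ Finset.range j, Q.Y X (a ^ i * r)) /
              ∑' j : ℕ, Q.K X (a ^ j) * ∏ i ∈ Finset.range j, Q.Y X (a ^ i)) := by
  obtain ⟨hXi, -, hcases⟩ := hX
  have hmX : Summable fun m => (X m).toReal * (m : ℝ) := by
    rw [← hXi 1 le_rfl]
    exact summable_mul_natCast_of_ne_top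
      (tsum_mul_natCast_ne_top_of_finiteSecondMoment (Q.vacArrivals_secondMoment 1))
  have hmX0 : Summable fun m => (Q.vacArrivals 0 m).toReal * (m : ℝ) :=
    summable_mul_natCast_of_ne_top
      (tsum_mul_natCast_ne_top_of_finiteSecondMoment (Q.vacArrivals_secondMoment 0))
  obtain ⟨c, hc, hlim⟩ := hproc.exists_tendsto_occupation ha0 ha1 hdeact hstable hXi
    (hcases.imp And.left And.right)
  have hone := hc.seqGenFun_one ha0 ha1 hstable hmX hmX0
  have hsum : HasSum c 1 := by
    have h1 : seqGenFun c 1 = ∑' i, c i := by simp [seqGenFun]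
    rw [← hone, h1]
    exact hc.summable.hasSum
  set p : PMF ℕ := ⟨fun i => ENNReal.ofReal (c i), by
    rw [ENNReal.summable.hasSum_iff, ← ENNReal.ofReal_tsum_of_nonneg hc.nonneg hc.summable,
      hsum.tsum_eq, ENNReal.ofReal_one]⟩ with hp
  have hpc : ∀ i, (p i).toReal = c i := fun i => ENNReal.toReal_ofReal (hc.nonneg i)
  have hgen : ∀ r, genFun p r = seqGenFun c r := fun r => by
    simp only [genFun, seqGenFun, hpc]
  have hst : IsSteadyStateLaw P (numInSystem k N S) p := fun j => by
    rw [hpc]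
    exact hproc.tendsto_timeAverage (hlim j)
  have hmem1 : (1 : ℝ) ∈ Set.Icc (0 : ℝ) 1 := ⟨zero_le_one, le_rfl⟩
  refine ⟨p, hst, fun j c' hc' => ?_, fun h0 => ?_, fun h0 => ?_⟩
  · refine tendsto_nhds_unique (hst j) (tendsto_timeAverage_of_tendsto
      (measurable_of_tendsto_nhdsGE (hproc.tendsto_measure_numInSystem j)) (fun t => ?_) hc')
    rw [Real.norm_eq_abs, abs_of_nonneg measureReal_nonneg]
    exact measureReal_le_one
  · have hX00 : X 0 = 0 := h0 ▸ Q.vacArrivals_zero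
    have hF := fun r hr => hc.eq_tprod ha0 ha1 hstable hmX h0 (r := r) hr
    -- The normalisation `G(1) = 1` yields the positivity of the denominator.
    have h1 : (∏' i : ℕ, Q.Y X (a ^ i)) * c 0 = 1 := by
      simpa [hone] using (hF 1 hmem1).symm
    have hpos : 0 < ∏' i : ℕ, Q.Y X (a ^ i) :=
      pos_of_mul_pos_left (h1 ▸ zero_lt_one) (hc.nonneg 0)
    refine ⟨fun r hr => VacationQueue.multipliable_Y ha0 ha1 hstable hX00 hr, hpos,
      fun r hr => ?_⟩
    rw [hgen, hF r hr, eq_div_iff hpos.ne', mul_assoc, mul_comm (c 0), h1, mul_one]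
  · have hX00 : 0 < X 0 := hcases.elim (fun h => absurd h.1 h0.ne) And.right
    have hF := fun r hr => hc.eq_tsum ha0 ha1 hstable hmX hmX0 hX00 (r := r) hr
    have h1 : (∑' j : ℕ, Q.K X (a ^ j) * ∏ i ∈ Finset.range j, Q.Y X (a ^ i)) * c 0 = 1 := by
      simpa [hone] using (hF 1 hmem1).symm
    have hpos : 0 < ∑' j : ℕ, Q.K X (a ^ j) * ∏ i ∈ Finset.range j, Q.Y X (a ^ i) :=
      pos_of_mul_pos_left (h1 ▸ zero_lt_one) (hc.nonneg 0)
    refine ⟨fun r hr => VacationQueue.summable_K_mul_prod_Y ha0 ha1 hstable hX00 hr, hpos,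
      fun r hr => ?_⟩
    rw [hgen, hF r hr, eq_div_iff hpos.ne', mul_assoc, mul_comm (c 0), h1, mul_one]
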